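/- Let $b\ge 2$. The random $b$-ary recursive tree is defined inside the infinite complete $b$-ary rooted ordered tree: the tree of size $1$ has the root as its only internal node and the $b$ children of the root as external nodes; the tree of size $n+1$ arises from the tree of size $n$ by choosing an external node uniformly at random, making it internal and adding its $b$ children to the external nodes (the tree of size $0$ is empty). Let $Z=(Z_1,\dots,Z_b)$ be a random vector with non-negative (possibly dependent) entries whose Euclidean norm is almost surely bounded, and attach to every node $u$ of the infinite complete $b$-ary tree an independent copy $Z^{(u)}$ of $Z$, the family being independent of the random tree; $Z^{(u)}_i$ is the weight of the edge from $u$ to its $i$-th child. The distance of two nodes is the sum of the edge weights on the path between them. For the tree of size $n$, let $W_n$ be the Wiener index (the sum of the distances of all unordered pairs of internal nodes), $P_n$ the internal path length (the sum of the distances of all internal nodes from the root), $Y_n=(W_n,P_n)^T$, and $I_n=(I_{n,1},\dots,I_{n,b})$ the vector of the sizes of the $b$ subtrees of the root. Put $$X_n=\begin{bmatrix}\frac1{n^2}&0\\0&\frac1n\end{bmatrix}(Y_n-E[Y_n]),\qquad X_0=0 .$$ Then $W_n$ and $P_n$ are integrable, and $X_n$ satisfies for $n\ge1$ the distributional recursion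 $$X_n\stackrel{d}{=}\sum_{i=1}^b A_i(I_n)X^{(i)}_{I_{n,i}}+d(I_n,Z),\qquad A_i(I_n)=\begin{bmatrix}\frac{I_{n,i}^2}{n^2}&\frac{I_{n,i}(n-I_{n,i})}{n^2}\\0&\frac{I_{n,i}}n\end{bmatrix},$$ where each $X^{(i)}_m$ has the distribution of $X_m$, the families $X^{(1)},\dots,X^{(b)}$, $I_n$ and $Z$ are independent, and the toll vector $d(I_n,Z)=d^{(n)}(I_n,Z)$, which has mean $0$, is given for $x\in\{0,\dots,n-1\}^b$ and $z\in\mathbb R^b$ by $$d^{(n)}_1(x,z)=\frac1{n^2}\Big(\sum_{i=1}^b\big(E[W_{x_i}]+(n-x_i)(E[P_{x_i}]+z_ix_i)\big)-E[W_n]\Big),\qquad d^{(n)}_2(x,z)=\frac1n\Big(\sum_{i=1}^b\big(E[P_{x_i}]+z_ix_i\big)-E[P_n]\Big).$$ Moreover, let $\gamma\approx2.0047$ be the positive solution of $12/7=e^{2/\gamma}-2/\gamma$ and $L_0\approx5.0177$ the largest root of $e^L=6L^2$. Then there is a constant $D>0$ such that for all $n\ge1$ one has $\|d(I_n,Z)\|\le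 D$ almost surely and, with $C:=48D/\gamma+D\sqrt{48(48/\gamma^2-5)}$, for all $t>0$ each of the probabilities $$P\Big(\frac{W_n-E[W_n]}{n^2}>t\Big),\quad P\Big(\frac{P_n-E[P_n]}{n}>t\Big),\quad P\Big(\frac{W_n-E[W_n]}{n^2}<-t\Big),\quad P\Big(\frac{P_n-E[P_n]}{n}<-t\Big)$$ is at most $$\begin{cases}\exp\left(-\frac{t^2}{10\gamma^2D^2}\right),&0\le t\le5\gamma D,\\ \exp\left(\frac52-\frac t{\gamma D}\right),&5\gamma D<t\le C,\\ \exp\left(-\frac{t^2}{96D^2}\right),&C<t\le48DL_0,\\ \exp\left(24L_0^2-\frac{L_0}Dt\right),&48DL_0<t\le4De^{L_0},\\ \exp\left(\frac tD-\frac tD\log\left(\frac t{4D}\right)\right),&4De^{L_0}<t.\end{cases}$$ -/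

import Mathlib

open MeasureTheory ProbabilityTheory

noncomputable section

namespace BaryTree

/-! ### The random b-ary recursive tree -/

/-- Nodes of the infinite complete `b`-ary ordered tree: a node is the word of directions that
leads from the root `[]` to it, first step first. The `i`-th child of `u` is `u ++ [i]`. -/
abbrev Node (b : ℕ) : Type := List (Fin b)

/-- The external nodes of the tree with set of internal nodes `T`: the children of internal nodes
that are not internal themselves. For the empty tree the only external node is the root. -/
def external {b : ℕ} (T : Finset (Node b)) : Finset (Node b) :=
  insert [] (T.biUnion fun u => Finset.univ.image fun i : Fin b => u ++ [i]) \ T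

open Classical in
/-- The law of the set of internal nodes of the random `b`-ary recursive tree of size `n`.
One starts with the empty tree (so that the tree of size `1` is the root), and in each step an
external node, chosen uniformly at random, becomes internal. (For `1 ≤ b` there always is an
external node, so the last branch is never used.) -/
def treeLaw (b : ℕ) : ℕ → PMF (Finset (Node b))
  | 0 => PMF.pure ∅
  | n + 1 => (treeLaw b n).bind fun T =>
      if h : (external T).Nonempty then
        (PMF.uniformOfFinset (external T) h).map fun u => insert u T
      else PMF.pure T

/-- `T n` is, for every `n`, a random `b`-ary recursive tree of size `n` (given by its set of
internal nodes), and the random vectors `Z u`, attached to the nodes `u` of the infinite complete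
`b`-ary tree, are independent with law `ν` and, as a family, independent of `T n`.
The number `Z u i` is the weight of the edge from `u` to its `i`-th child. -/
structure IsWeightedRecursiveTree {b : ℕ} {Ω : Type*} [MeasurableSpace Ω] (P : Measure Ω)
    (ν : Measure (EuclideanSpace ℝ (Fin b)))
    (T : ℕ → Ω → Finset (Node b)) (Z : Node b → Ω → EuclideanSpace ℝ (Fin b)) : Prop where
  measurable_tree : ∀ n, Measurable (T n)
  law_tree : ∀ n, P.map (T n) = (treeLaw b n).toMeasure
  measurable_weight : ∀ u, Measurable (Z u)
  law_weight : ∀ u, P.map (Z u) = ν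
  indep_weight : iIndepFun Z P
  indep_tree : ∀ n, IndepFun (T n) (fun ω u => Z u ω) P

/-! ### Internal path length and Wiener index for edge weights `w`

`w u i` is the weight of the edge from `u` to its `i`-th child; the weights in the `i`-th subtree
of the root are `fun v => w (i :: v)`. -/

/-- The weighted depth of a node: the sum of the weights of the edges between the root and it. -/
def weightedDepth {b : ℕ} : (Node b → EuclideanSpace ℝ (Fin b)) → Node b → ℝ
  | _, [] => 0
  | w, i :: u => w [] i + weightedDepth (fun v => w (i :: v)) u

/-- The weighted distance of two nodes: the sum of the weights of the edges on the unique path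
between them. If both nodes lie in the same subtree of the root, so does the path; otherwise
the path runs through the root. -/
def weightedDist {b : ℕ} : (Node b → EuclideanSpace ℝ (Fin b)) → Node b → Node b → ℝ
  | w, [], v => weightedDepth w v
  | w, i :: u, [] => weightedDepth w (i :: u)
  | w, i :: u, j :: v =>
      if i = j then weightedDist (fun x => w (i :: x)) u v
      else weightedDepth w (i :: u) + weightedDepth w (j :: v)

/-- The internal path length: the sum of the depths of all internal nodes. -/
def pathLength {b : ℕ} (w : Node b → EuclideanSpace ℝ (Fin b)) (T : Finset (Node b)) : ℝ :=
  ∑ u ∈ T, weightedDepth w u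

/-- The Wiener index: the sum of the distances between all unordered pairs of internal nodes. -/
def wienerIndex {b : ℕ} (w : Node b → EuclideanSpace ℝ (Fin b)) (T : Finset (Node b)) : ℝ :=
  (∑ u ∈ T, ∑ v ∈ T, weightedDist w u v) / 2

/-- The sizes of the `b` subtrees of the root. -/
def subtreeSizes {b : ℕ} (T : Finset (Node b)) (i : Fin b) : ℕ :=
  (T.filter fun u => u.head? = some i).card

/-! ### Distributional recursions of sum type -/

/-- The laws `lawX m` of random vectors `X_m` satisfy, at index `n`, the distributional recursion
`X_n =ᵈ ∑ i, A_i(I) X^{(i)}_{I_i} + d(I, Z)`, where `I ∈ {0, …, n-1}^b` has law `lawI`, `Z` has law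
`lawZ`, every `X^{(i)}_m` has law `lawX m`, the objects `I`, `Z` and `X^{(1)}, …, X^{(b)}` are
independent, and `E[d(I, Z)] = 0`. -/
def SolvesSumRecursion {b k : ℕ} (n : ℕ) (lawI : Measure (Fin b → ℕ))
    (lawZ : Measure (EuclideanSpace ℝ (Fin b))) (lawX : ℕ → Measure (EuclideanSpace ℝ (Fin k)))
    (A : Fin b → (Fin b → ℕ) → Matrix (Fin k) (Fin k) ℝ)
    (d : (Fin b → ℕ) → EuclideanSpace ℝ (Fin b) → EuclideanSpace ℝ (Fin k)) : Prop :=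
  ∃ (Ω : Type) (_ : MeasurableSpace Ω) (Q : Measure Ω) (I : Ω → Fin b → ℕ)
    (Z : Ω → EuclideanSpace ℝ (Fin b)) (X : Fin b → ℕ → Ω → EuclideanSpace ℝ (Fin k)),
    IsProbabilityMeasure Q ∧
    HasLaw I lawI Q ∧ HasLaw Z lawZ Q ∧ (∀ i m, HasLaw (X i m) (lawX m) Q) ∧
    IndepFun I Z Q ∧
    iIndepFun (fun i ω m => X i m ω) Q ∧
    IndepFun (fun ω => (I ω, Z ω)) (fun ω i m => X i m ω) Q ∧
    (∀ᵐ ω ∂Q, ∀ i, I ω i < n) ∧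
    Integrable (fun ω => d (I ω) (Z ω)) Q ∧
    ∫ ω, d (I ω) (Z ω) ∂Q = 0 ∧
    HasLaw (fun ω => ∑ i, (A i (I ω)).toEuclideanLin (X i (I ω i) ω) + d (I ω) (Z ω)) (lawX n) Q

/-! ### The recursion for (Wiener index, internal path length) -/

/-- The normalized vector `((W_n - E W_n) / n², (P_n - E P_n) / n)`. -/
def normalized {Ω : Type*} [MeasurableSpace Ω] (P : Measure Ω) (W L : ℕ → Ω → ℝ) (n : ℕ) (ω : Ω) :
    EuclideanSpace ℝ (Fin 2) :=
  !₂[(W n ω - ∫ ω', W n ω' ∂P) / (n : ℝ) ^ 2, (L n ω - ∫ ω', L n ω' ∂P) / (n : ℝ)]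

/-- The coefficient matrices of the recursion, for subtree sizes `x`. -/
def coeff {b : ℕ} (n : ℕ) (i : Fin b) (x : Fin b → ℕ) : Matrix (Fin 2) (Fin 2) ℝ :=
  !![(x i : ℝ) ^ 2 / (n : ℝ) ^ 2, (x i : ℝ) * ((n : ℝ) - x i) / (n : ℝ) ^ 2;
     0, (x i : ℝ) / n]

/-- The toll vector `d(x, z)` of the recursion, for subtree sizes `x` and weights `z` of the edges
at the root, where `eW m` and `eL m` are the means of the Wiener index and of the internal path
length of the tree of size `m`. -/
def toll {b : ℕ} (eW eL : ℕ → ℝ) (n : ℕ) (x : Fin b → ℕ) (z : EuclideanSpace ℝ (Fin b)) :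
    EuclideanSpace ℝ (Fin 2) :=
  !₂[(∑ i, (eW (x i) + ((n : ℝ) - x i) * (eL (x i) + z i * x i)) - eW n) / (n : ℝ) ^ 2,
     (∑ i, (eL (x i) + z i * x i) - eL n) / (n : ℝ)]

/-! ### The tail bound -/

/-- The upper bound for the tail probabilities at `t`, with constants `γ`, `L₀` and `D`. -/
def tailBound (γ L₀ D t : ℝ) : ℝ :=
  if t ≤ 5 * γ * D then Real.exp (-(t ^ 2 / (10 * γ ^ 2 * D ^ 2)))
  else if t ≤ 48 * D / γ + D * √(48 * (48 / γ ^ 2 - 5)) then Real.exp (5 / 2 - t / (γ * D))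
  else if t ≤ 48 * D * L₀ then Real.exp (-(t ^ 2 / (96 * D ^ 2)))
  else if t ≤ 4 * D * Real.exp L₀ then Real.exp (24 * L₀ ^ 2 - L₀ / D * t)
  else Real.exp (t / D - t / D * Real.log (t / (4 * D)))

end BaryTree

end

/-! A tree with k internal nodes has N_k = (b - 1) k + 1 external nodes, whatever its shape. Hence a
growth step that falls into a subtree of the root is a uniform growth step of that subtree, and
given their sizes the root's subtrees are independent random recursive trees (`treeExp_forest`). The
weights in the subtrees are independent copies of the whole family, so expectations factor at the
root (`integral_decomposition`). With the deterministic decompositions `pathLength_eq` and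
`wienerIndex_eq`, this yields the recursion by comparing characteristic functions
(`solvesSumRecursion`).

Toll. Let H_n = 1/N_1 + ... + 1/N_n and let c be the sum of the mean edge weights at the root. The
mean path length is c (H_0 + ... + H_{n-1}) = c n H_n + O(n), the mean Wiener index is c n² H_n +
O(n²), and n H_n is additive over the subtrees up to O(n). The main terms cancel in the toll, which
is therefore bounded (`exists_toll_bound`). The remainder of the mean Wiener index is controlled
because the sum of the squared relative subtree sizes has mean at most 1 - δ, uniformly in n
(`le_treeExp_sizeDefect`).

Moment generating function. With y = D₀ (|s₀| + |s₁|), where D₀ bounds the toll, induction on n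
proves E exp⟨X_n, s⟩ ≤ exp κ for κ = K y² e^y (`integral_exp_normVec_le`). The transpose of A_i
shrinks the ℓ¹ norm by v_i = I_i / n, so the induction hypotheses multiply to at most exp(κ ∑ v_i²)
= exp(κ - κ U), where U is the size defect. It remains to see that E[exp(⟨d, s⟩ - κ U)] ≤ 1
(`treeExp_mul_exp_neg_sizeDefect_le_one`). For small y this holds since the toll has mean 0 and U
has mean at least δ; for large y since E exp(-κ U) = O(1/κ), a consequence of P(I_i = k) ≤ 1/(k +
1).

Tails. Enlarging D₀ to D = B D₀ replaces the exponent by its value at y/B. For large B this lies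
below the quadratics 5γ²y²/2 and 24y² on a given bounded range and below 4e^y everywhere
(`exists_scale`); optimizing Chernoff's bound for these functions gives the five branches of
`tailBound`. -/

namespace BaryTree

variable {b : ℕ}

/-! ### Prefix-closed sets of nodes and their subtrees -/

/-- A finite set of nodes is a tree if it contains the parent of each of its nodes. -/
def IsTree (T : Finset (Node b)) : Prop := ∀ u (i : Fin b), u ++ [i] ∈ T → u ∈ T

/-- The children of the nodes in `T`. -/
def children (T : Finset (Node b)) : Finset (Node b) :=
  T.biUnion fun u => Finset.univ.image fun i : Fin b => u ++ [i]

lemma mem_children {T : Finset (Node b)} {v : Node b} :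
    v ∈ children T ↔ ∃ u ∈ T, ∃ i : Fin b, u ++ [i] = v := by
  simp [children]

lemma mem_external {T : Finset (Node b)} {v : Node b} :
    v ∈ external T ↔ (v = [] ∨ ∃ u ∈ T, ∃ i : Fin b, u ++ [i] = v) ∧ v ∉ T := by
  simp [external]

lemma card_children (T : Finset (Node b)) : (children T).card = b * T.card := by
  rw [children, Finset.card_biUnion]
  · rw [Finset.sum_congr rfl (g := fun _ => b), Finset.sum_const, smul_eq_mul, mul_comm]
    intro u _
    rw [Finset.card_image_of_injective, Finset.card_univ, Fintype.card_fin]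
    intro i j h
    simpa using h
  · intro u _ v _ huv
    rw [Function.onFun, Finset.disjoint_left]
    intro x hx hx'
    simp only [Finset.mem_image, Finset.mem_univ, true_and] at hx hx'
    obtain ⟨i, rfl⟩ := hx
    obtain ⟨j, hj⟩ := hx'
    exact huv (List.append_inj' hj rfl).1.symm

lemma IsTree.subset {T : Finset (Node b)} (hT : IsTree T) : T ⊆ insert [] (children T) := by
  intro v hv
  rcases List.eq_nil_or_concat v with rfl | ⟨u, i, rfl⟩
  · simp
  · rw [List.concat_eq_append] at hv ⊢
    exact Finset.mem_insert_of_mem (mem_children.2 ⟨u, hT u i hv, i, rfl⟩)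

/-- The root and the b |T| children are pairwise distinct and contain T; what remains after removing
T is external. The count does not depend on the shape, and everything about conditional independence
rests on this. -/
lemma IsTree.card_external {T : Finset (Node b)} (hT : IsTree T) :
    (external T).card + T.card = b * T.card + 1 := by
  have h : external T = insert [] (children T) \ T := rfl
  rw [h, Finset.card_sdiff_add_card_eq_card hT.subset, Finset.card_insert_of_notMem,
    card_children]
  simp [mem_children]

/-- The number of external nodes of a tree with `n` internal nodes, as a real number. -/
noncomputable def numExternal (b : ℕ) (n : ℕ) : ℝ := ((b : ℝ) - 1) * n + 1

lemma numExternal_pos (hb : 2 ≤ b) (n : ℕ) : 0 < numExternal b n := by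
  have : (2 : ℝ) ≤ b := by exact_mod_cast hb
  have h1 : (0 : ℝ) ≤ ((b : ℝ) - 1) * n := mul_nonneg (by linarith) (by positivity)
  unfold numExternal
  linarith

lemma add_one_le_numExternal (hb : 2 ≤ b) (n : ℕ) : (n : ℝ) + 1 ≤ numExternal b n := by
  have h2 : (2 : ℝ) ≤ b := by exact_mod_cast hb
  have h1 : (0 : ℝ) ≤ ((b : ℝ) - 2) * n := mul_nonneg (by linarith) (by positivity)
  unfold numExternal
  linarith

lemma IsTree.card_external_cast {T : Finset (Node b)} (hT : IsTree T) :
    ((external T).card : ℝ) = numExternal b T.card := by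
  have h : ((external T).card : ℝ) + T.card = b * T.card + 1 := by exact_mod_cast hT.card_external
  unfold numExternal
  linarith

lemma IsTree.insert {T : Finset (Node b)} (hT : IsTree T) {u : Node b} (hu : u ∈ external T) :
    IsTree (insert u T) := by
  intro v i hv
  rw [Finset.mem_insert] at hv ⊢
  rcases hv with hv | hv
  · rcases (mem_external.1 hu).1 with h | ⟨w, hw, j, h⟩
    · simp [h] at hv
    · rw [← h] at hv
      right
      rwa [(List.append_inj' hv rfl).1]
  · exact Or.inr (hT v i hv)

lemma isTree_empty : IsTree (∅ : Finset (Node b)) := by simp [IsTree]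

/-- The `i`-th subtree of the root. -/
noncomputable def sub (T : Finset (Node b)) (i : Fin b) : Finset (Node b) :=
  T.preimage (fun v => i :: v) (List.cons_injective.injOn)

@[simp] lemma mem_sub {T : Finset (Node b)} {i : Fin b} {v : Node b} :
    v ∈ sub T i ↔ i :: v ∈ T := by simp [sub]

lemma card_sub (T : Finset (Node b)) (i : Fin b) : (sub T i).card = subtreeSizes T i := by
  rw [subtreeSizes, ← Finset.card_image_of_injective (sub T i) (List.cons_injective (a := i))]
  congr 1
  ext u
  simp only [Finset.mem_image, mem_sub, Finset.mem_filter]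
  constructor
  · rintro ⟨v, hv, rfl⟩
    exact ⟨hv, rfl⟩
  · rintro ⟨hu, h⟩
    cases u with
    | nil => simp at h
    | cons j v =>
      simp only [List.head?_cons, Option.some.injEq] at h
      subst h
      exact ⟨v, hu, rfl⟩

lemma sum_eq_root_add {M : Type*} [AddCommMonoid M] {T : Finset (Node b)} (hT : [] ∈ T)
    (g : Node b → M) : ∑ u ∈ T, g u = g [] + ∑ i, ∑ v ∈ sub T i, g (i :: v) := by
  have h : T = insert [] (Finset.univ.biUnion fun i => (sub T i).image fun v => i :: v) := by
    ext u
    cases u with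
    | nil => simpa using hT
    | cons j v => simp
  conv_lhs => rw [h]
  rw [Finset.sum_insert (by simp), Finset.sum_biUnion]
  · congr 1
    refine Finset.sum_congr rfl fun i _ => ?_
    rw [Finset.sum_image (List.cons_injective.injOn)]
  · intro i _ j _ hij
    rw [Function.onFun, Finset.disjoint_left]
    intro x hx hx'
    simp only [Finset.mem_image] at hx hx'
    obtain ⟨v, _, rfl⟩ := hx
    obtain ⟨w, _, h⟩ := hx'
    exact hij (List.cons.inj h).1.symm

lemma card_eq_one_add_sum {T : Finset (Node b)} (hT : [] ∈ T) :
    T.card = 1 + ∑ i, subtreeSizes T i := by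
  have := sum_eq_root_add hT (fun _ => 1)
  simpa [card_sub] using this

lemma IsTree.sub {T : Finset (Node b)} (hT : IsTree T) (i : Fin b) : IsTree (sub T i) := by
  intro u j h
  rw [mem_sub] at h ⊢
  exact hT (i :: u) j h

lemma cons_mem_external {T : Finset (Node b)} (hT : [] ∈ T) {i : Fin b} {v : Node b} :
    i :: v ∈ external T ↔ v ∈ external (BaryTree.sub T i) := by
  rw [mem_external, mem_external, mem_sub]
  refine and_congr_left fun hv => ?_
  constructor
  · rintro (h | ⟨u, hu, j, h⟩)
    · simp at h
    · cases u with
      | nil =>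
        simp only [List.nil_append, List.cons.injEq] at h
        exact Or.inl h.2.symm
      | cons k w =>
        simp only [List.cons_append, List.cons.injEq] at h
        obtain ⟨rfl, rfl⟩ := h
        exact Or.inr ⟨w, mem_sub.2 hu, j, rfl⟩
  · rintro (rfl | ⟨u, hu, j, rfl⟩)
    · exact Or.inr ⟨[], hT, i, rfl⟩
    · exact Or.inr ⟨i :: u, mem_sub.1 hu, j, rfl⟩

lemma sum_external {M : Type*} [AddCommMonoid M] {T : Finset (Node b)} (hT : [] ∈ T)
    (g : Node b → M) :
    ∑ u ∈ external T, g u = ∑ i, ∑ v ∈ external (BaryTree.sub T i), g (i :: v) := by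
  have h : external T
      = Finset.univ.biUnion fun i => (external (BaryTree.sub T i)).image fun v => i :: v := by
    ext u
    cases u with
    | nil => simp [mem_external, hT]
    | cons j v => simp [cons_mem_external hT]
  conv_lhs => rw [h]
  rw [Finset.sum_biUnion]
  · refine Finset.sum_congr rfl fun i _ => ?_
    rw [Finset.sum_image (List.cons_injective.injOn)]
  · intro i _ j _ hij
    rw [Function.onFun, Finset.disjoint_left]
    intro x hx hx'
    simp only [Finset.mem_image] at hx hx'
    obtain ⟨v, _, rfl⟩ := hx
    obtain ⟨w, _, h⟩ := hx'
    exact hij (List.cons.inj h).1.symm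

lemma sub_insert (T : Finset (Node b)) (i : Fin b) (v : Node b) :
    BaryTree.sub (insert (i :: v) T) = Function.update (BaryTree.sub T) i (insert v (BaryTree.sub T i)) := by
  funext j
  ext w
  by_cases hj : j = i
  · subst hj; simp
  · simp [hj]

/-! ### The expectation functional of the random tree -/

/-- The expectation of `f` under the law of the random tree of size `n`. -/
noncomputable def treeExp {𝕜 : Type*} [RCLike 𝕜] : ℕ → (Finset (Node b) → 𝕜) → 𝕜
  | 0, f => f ∅
  | n + 1, f => treeExp n fun T => (∑ u ∈ external T, f (insert u T)) / ((external T).card : 𝕜)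

/-- The possible trees of size `n`. -/
def shapes (b : ℕ) : ℕ → Finset (Finset (Node b))
  | 0 => {∅}
  | n + 1 => (shapes b n).biUnion fun T => (external T).image fun u => insert u T

lemma mem_shapes_succ {n : ℕ} {T : Finset (Node b)} :
    T ∈ shapes b (n + 1) ↔ ∃ T' ∈ shapes b n, ∃ u ∈ external T', insert u T' = T := by
  simp [shapes]

lemma isTree_of_mem_shapes {n : ℕ} {T : Finset (Node b)} (h : T ∈ shapes b n) : IsTree T := by
  induction n generalizing T with
  | zero =>
    rw [shapes, Finset.mem_singleton] at h
    exact h ▸ isTree_empty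
  | succ n ih =>
    obtain ⟨T', hT', u, hu, rfl⟩ := mem_shapes_succ.1 h
    exact (ih hT').insert hu

lemma card_of_mem_shapes {n : ℕ} {T : Finset (Node b)} (h : T ∈ shapes b n) : T.card = n := by
  induction n generalizing T with
  | zero =>
    rw [shapes, Finset.mem_singleton] at h
    simp [h]
  | succ n ih =>
    obtain ⟨T', hT', u, hu, rfl⟩ := mem_shapes_succ.1 h
    rw [Finset.card_insert_of_notMem (mem_external.1 hu).2, ih hT']

lemma root_mem_of_mem_shapes {n : ℕ} {T : Finset (Node b)} (h : T ∈ shapes b (n + 1)) :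
    [] ∈ T := by
  induction n generalizing T with
  | zero =>
    obtain ⟨T', hT', u, hu, rfl⟩ := mem_shapes_succ.1 h
    rw [shapes, Finset.mem_singleton] at hT'
    subst hT'
    have : u = [] := by simpa [mem_external] using hu
    simp [this]
  | succ n ih =>
    obtain ⟨T', hT', u, hu, rfl⟩ := mem_shapes_succ.1 h
    exact Finset.mem_insert_of_mem (ih hT')

section
variable {𝕜 : Type*} [RCLike 𝕜]

lemma treeExp_congr {n : ℕ} {f g : Finset (Node b) → 𝕜} (h : ∀ T ∈ shapes b n, f T = g T) :
    treeExp n f = treeExp n g := by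
  induction n generalizing f g with
  | zero => exact h ∅ (by simp [shapes])
  | succ n ih =>
    refine ih fun T hT => ?_
    congr 1
    exact Finset.sum_congr rfl fun u hu => h _ (mem_shapes_succ.2 ⟨T, hT, u, hu, rfl⟩)

lemma treeExp_sum {ι : Type*} (n : ℕ) (s : Finset ι) (f : ι → Finset (Node b) → 𝕜) :
    treeExp n (fun T => ∑ j ∈ s, f j T) = ∑ j ∈ s, treeExp n (f j) := by
  induction n generalizing f with
  | zero => rfl
  | succ n ih =>
    simp only [treeExp]
    rw [← ih]
    congr 1
    funext T
    rw [Finset.sum_comm, Finset.sum_div]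

lemma treeExp_add (n : ℕ) (f g : Finset (Node b) → 𝕜) :
    treeExp n (fun T => f T + g T) = treeExp n f + treeExp n g := by
  have := treeExp_sum n Finset.univ (fun j : Bool => fun T => if j then f T else g T)
  simpa using this

lemma treeExp_const_mul (n : ℕ) (c : 𝕜) (f : Finset (Node b) → 𝕜) :
    treeExp n (fun T => c * f T) = c * treeExp n f := by
  induction n generalizing f with
  | zero => rfl
  | succ n ih =>
    simp only [treeExp]
    rw [← ih]
    congr 1
    funext T
    rw [← Finset.mul_sum, mul_div_assoc]

lemma treeExp_sub (n : ℕ) (f g : Finset (Node b) → 𝕜) :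
    treeExp n (fun T => f T - g T) = treeExp n f - treeExp n g := by
  have := treeExp_add n f (fun T => (-1) * g T)
  rw [treeExp_const_mul] at this
  simpa [sub_eq_add_neg] using this

lemma card_external_ne_zero {n : ℕ} {T : Finset (Node b)} (hb : 2 ≤ b) (hT : T ∈ shapes b n) :
    ((external T).card : 𝕜) ≠ 0 := by
  have h := (isTree_of_mem_shapes hT).card_external_cast
  have h2 := numExternal_pos hb T.card
  rw [← h] at h2
  have : (external T).card ≠ 0 := by
    intro h0
    simp [h0] at h2
  exact_mod_cast this

lemma card_external_of_mem_shapes {n : ℕ} {T : Finset (Node b)} (hT : T ∈ shapes b n) :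
    ((external T).card : 𝕜) = ((numExternal b n : ℝ) : 𝕜) := by
  rw [← card_of_mem_shapes hT, ← (isTree_of_mem_shapes hT).card_external_cast]
  simp

/-- On the possible trees the number of external nodes is deterministic, so the normalization leaves
the expectation. -/
lemma treeExp_succ (n : ℕ) (f : Finset (Node b) → 𝕜) :
    treeExp (n + 1) f
      = treeExp n (fun T => ∑ u ∈ external T, f (insert u T)) / ((numExternal b n : ℝ) : 𝕜) := by
  rw [div_eq_inv_mul, ← treeExp_const_mul, treeExp]
  refine treeExp_congr fun T hT => ?_
  rw [card_external_of_mem_shapes hT, div_eq_inv_mul]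

lemma treeExp_const (hb : 2 ≤ b) (n : ℕ) (c : 𝕜) :
    treeExp n (fun _ : Finset (Node b) => c) = c := by
  induction n with
  | zero => rfl
  | succ n ih =>
    rw [treeExp]
    conv_rhs => rw [← ih]
    refine treeExp_congr fun T hT => ?_
    rw [Finset.sum_const, nsmul_eq_mul, mul_div_cancel_left₀ _ (card_external_ne_zero hb hT)]

end

lemma treeExp_mono {n : ℕ} {f g : Finset (Node b) → ℝ} (h : ∀ T ∈ shapes b n, f T ≤ g T) :
    treeExp n f ≤ treeExp n g := by
  induction n generalizing f g with
  | zero => exact h ∅ (by simp [shapes])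
  | succ n ih =>
    refine ih fun T hT => ?_
    gcongr with u hu
    exact h _ (mem_shapes_succ.2 ⟨T, hT, u, hu, rfl⟩)

/-! ### Independence of the subtrees, given their sizes -/

section
variable {𝕜 : Type*} [RCLike 𝕜]

/-- A Leibniz rule: each external node lies in exactly one subtree, and inserting it changes only
the factor of that subtree. -/
lemma treeExp_prod_succ {n : ℕ} (f : Fin b → Finset (Node b) → 𝕜) :
    treeExp (n + 2) (fun T => ∏ i, f i (sub T i))
      = (∑ i, treeExp (n + 1) (fun T => ∏ j, Function.update f i
          (fun t => ∑ v ∈ external t, f i (insert v t)) j (sub T j)))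
        / ((numExternal b (n + 1) : ℝ) : 𝕜) := by
  rw [treeExp_succ, ← treeExp_sum]
  congr 1
  refine treeExp_congr fun T hT => ?_
  rw [sum_external (root_mem_of_mem_shapes hT)]
  refine Finset.sum_congr rfl fun i _ => ?_
  rw [← Finset.mul_prod_erase _ _ (Finset.mem_univ i), Function.update_self, Finset.sum_mul]
  refine Finset.sum_congr rfl fun v _ => ?_
  rw [← Finset.mul_prod_erase _ _ (Finset.mem_univ i), sub_insert, Function.update_self]
  congr 1
  refine Finset.prod_congr rfl fun j hj => ?_
  rw [Function.update_of_ne (Finset.ne_of_mem_erase hj),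
    Function.update_of_ne (Finset.ne_of_mem_erase hj)]

/-- By the Leibniz rule both sides satisfy the same recursion. In the altered factor, the sum of f
over one-step extensions has expectation N_k times the expectation of f at size k + 1, which is also
what the sum over external nodes gives for a function of the size alone. -/
theorem treeExp_prod (hb : 2 ≤ b) (n : ℕ) (f : Fin b → Finset (Node b) → 𝕜) :
    treeExp (n + 1) (fun T => ∏ i, f i (sub T i))
      = treeExp (n + 1) (fun T => ∏ i, treeExp (sub T i).card (f i)) := by
  induction n generalizing f with
  | zero =>
    refine treeExp_congr fun T hT => ?_
    refine Finset.prod_congr rfl fun i _ => ?_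
    have h1 := card_of_mem_shapes hT
    have h2 := card_eq_one_add_sum (root_mem_of_mem_shapes hT)
    have h3 : ∑ i, subtreeSizes T i = 0 := by omega
    have h4 : sub T i = ∅ := by
      rw [← Finset.card_eq_zero, card_sub]
      exact Finset.sum_eq_zero_iff.1 h3 i (Finset.mem_univ i)
    rw [h4]
    rfl
  | succ n ih =>
    rw [treeExp_prod_succ, treeExp_prod_succ (fun i t => treeExp t.card (f i))]
    congr 1
    refine Finset.sum_congr rfl fun i _ => ?_
    rw [ih]
    refine treeExp_congr fun T hT => ?_
    refine Finset.prod_congr rfl fun j _ => ?_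
    by_cases hj : j = i
    · subst hj
      rw [Function.update_self, Function.update_self]
      have ht := (isTree_of_mem_shapes hT).sub j
      have h0 : ((numExternal b (sub T j).card : ℝ) : 𝕜) ≠ 0 := by
        exact_mod_cast (numExternal_pos hb _).ne'
      have h1 := treeExp_succ (sub T j).card (f j)
      rw [eq_div_iff h0] at h1
      rw [← h1, ← ht.card_external_cast]
      -- Every one-step extension has one node more, so the summand is constant over the external
      -- nodes.
      rw [Finset.sum_congr rfl (g := fun _ => treeExp ((sub T j).card + 1) (f j))]
      · simp [mul_comm]
      · intro v hv
        rw [Finset.card_insert_of_notMem (mem_external.1 hv).2]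
    · rw [Function.update_of_ne hj, Function.update_of_ne hj]

/-- Conditional independence given the sizes. The functions may depend on the whole size vector, so
the expectation is first split according to that vector. -/
theorem treeExp_forest (hb : 2 ≤ b) (n : ℕ) (g : (Fin b → ℕ) → 𝕜)
    (f : (Fin b → ℕ) → Fin b → Finset (Node b) → 𝕜) :
    treeExp (n + 1) (fun T => g (subtreeSizes T) * ∏ i, f (subtreeSizes T) i (sub T i))
      = treeExp (n + 1) (fun T => g (subtreeSizes T) *
          ∏ i, treeExp (subtreeSizes T i) (f (subtreeSizes T) i)) := by
  classical
  -- The indicator of a given size vector is a product of one indicator per subtree, which brings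
  -- each term into the form of `treeExp_prod`.
  have key : ∀ F : (Fin b → ℕ) → Fin b → Finset (Node b) → 𝕜,
      treeExp (n + 1) (fun T => g (subtreeSizes T) * ∏ i, F (subtreeSizes T) i (sub T i))
      = ∑ x ∈ Fintype.piFinset fun _ : Fin b => Finset.range (n + 1), g x *
        treeExp (n + 1) (fun T => ∏ i, if (sub T i).card = x i then F x i (sub T i) else 0) := by
    intro F
    simp only [← treeExp_const_mul]
    rw [← treeExp_sum]
    refine treeExp_congr fun T hT => ?_
    rw [Finset.sum_eq_single (subtreeSizes T)]
    · simp [card_sub]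
    · intro x _ hx
      obtain ⟨i, hi⟩ := Function.ne_iff.1 hx
      rw [Finset.prod_eq_zero (Finset.mem_univ i), mul_zero]
      rw [if_neg]
      rw [card_sub]
      exact fun h => hi h.symm
    · intro h
      exfalso
      apply h
      rw [Fintype.mem_piFinset]
      intro i
      rw [Finset.mem_range]
      have h1 := card_of_mem_shapes hT
      have h2 := card_eq_one_add_sum (root_mem_of_mem_shapes hT)
      have h3 := Finset.single_le_sum (f := subtreeSizes T) (fun _ _ => Nat.zero_le _)
        (Finset.mem_univ i)
      omega
  rw [key, key (fun x i t => treeExp (x i) (f x i))]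
  refine Finset.sum_congr rfl fun x _ => ?_
  rw [treeExp_prod hb n (fun i t => if t.card = x i then f x i t else 0)]
  congr 1
  refine treeExp_congr fun T hT => ?_
  refine Finset.prod_congr rfl fun i _ => ?_
  by_cases h : (sub T i).card = x i
  · rw [if_pos h, h]
    refine treeExp_congr fun t ht => ?_
    rw [if_pos (card_of_mem_shapes ht)]
  · rw [if_neg h]
    have : treeExp (sub T i).card (fun t : Finset (Node b) => if t.card = x i then f x i t else 0)
        = treeExp (sub T i).card (fun _ : Finset (Node b) => (0 : 𝕜)) := by
      refine treeExp_congr fun t ht => ?_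
      rw [if_neg]
      rwa [card_of_mem_shapes ht]
    rw [this, treeExp_const hb]

end

end BaryTree

namespace BaryTree

variable {b : ℕ}

set_option linter.unusedSectionVars false

/-! ### The expectation functional as an integral -/

/-- The law of the tree after one more step, starting from `T`. -/
noncomputable def stepLaw (T : Finset (Node b)) : PMF (Finset (Node b)) :=
  open Classical in
  if h : (external T).Nonempty then
    (PMF.uniformOfFinset (external T) h).map fun u => insert u T
  else PMF.pure T

lemma treeLaw_succ (n : ℕ) : treeLaw b (n + 1) = (treeLaw b n).bind stepLaw := by
  rw [treeLaw]
  congr 1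

lemma IsTree.external_nonempty {T : Finset (Node b)} (hb : 2 ≤ b) (hT : IsTree T) :
    (external T).Nonempty := by
  have h := hT.card_external_cast
  have h2 := numExternal_pos hb T.card
  rw [← h] at h2
  exact Finset.card_pos.1 (by exact_mod_cast h2)

lemma stepLaw_apply (hb : 2 ≤ b) {T : Finset (Node b)} (hT : IsTree T) (S : Finset (Node b)) :
    stepLaw T S = ∑ u ∈ external T, if S = insert u T then ((external T).card : ENNReal)⁻¹ else 0 := by
  unfold stepLaw
  rw [dif_pos (hT.external_nonempty hb), PMF.map_apply, tsum_eq_sum (s := external T)]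
  · refine Finset.sum_congr rfl fun u hu => ?_
    rw [PMF.uniformOfFinset_apply, if_pos hu]
    congr!
  · intro u hu
    rw [PMF.uniformOfFinset_apply, if_neg hu, ite_self]

lemma mem_shapes_of_treeLaw_ne_zero (hb : 2 ≤ b) {n : ℕ} {S : Finset (Node b)}
    (h : treeLaw b n S ≠ 0) : S ∈ shapes b n := by
  induction n generalizing S with
  | zero =>
    rw [treeLaw, PMF.pure_apply] at h
    simpa [shapes] using h
  | succ n ih =>
    rw [treeLaw_succ, PMF.bind_apply] at h
    obtain ⟨T, hT⟩ := not_forall.1 (fun h' => h (ENNReal.tsum_eq_zero.2 h'))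
    have h1 := ih (left_ne_zero_of_mul hT)
    have h2 := right_ne_zero_of_mul hT
    rw [stepLaw_apply hb (isTree_of_mem_shapes h1)] at h2
    obtain ⟨u, hu, h3⟩ := Finset.exists_ne_zero_of_sum_ne_zero h2
    refine mem_shapes_succ.2 ⟨T, h1, u, hu, ?_⟩
    by_contra h4
    exact h3 (if_neg (Ne.symm h4))

/-- Identifies `treeExp` with the mean under `treeLaw`. The support lies in the finite set `shapes b
n`, so the sum over intermediate trees in `bind` is finite and can be interchanged with the sum over
final trees. -/
lemma treeExp_eq_sum {𝕜 : Type*} [RCLike 𝕜] (hb : 2 ≤ b) (n : ℕ) (f : Finset (Node b) → 𝕜) :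
    treeExp n f = ∑ S ∈ shapes b n, (((treeLaw b n S).toReal : ℝ) : 𝕜) * f S := by
  induction n generalizing f with
  | zero => simp [treeExp, shapes, treeLaw]
  | succ n ih =>
    have h1 : ∀ S, (treeLaw b (n + 1) S).toReal
        = ∑ T ∈ shapes b n, (treeLaw b n T).toReal * (stepLaw T S).toReal := by
      intro S
      rw [treeLaw_succ, PMF.bind_apply, tsum_eq_sum (s := shapes b n), ENNReal.toReal_sum]
      · simp
      · intro T _
        exact ENNReal.mul_ne_top (PMF.apply_ne_top _ _) (PMF.apply_ne_top _ _)
      · intro T hT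
        rw [by_contra fun h => hT (mem_shapes_of_treeLaw_ne_zero hb h), zero_mul]
    simp only [h1, treeExp]
    rw [ih]
    simp only [RCLike.ofReal_sum, Finset.sum_mul]
    rw [Finset.sum_comm]
    refine Finset.sum_congr rfl fun T hT => ?_
    simp only [RCLike.ofReal_mul, mul_assoc]
    rw [← Finset.mul_sum]
    congr 1
    have h2 : ∀ S, (((stepLaw T S).toReal : ℝ) : 𝕜)
        = ∑ u ∈ external T, if S = insert u T then (((external T).card : 𝕜))⁻¹ else 0 := by
      intro S
      rw [stepLaw_apply hb (isTree_of_mem_shapes hT), ENNReal.toReal_sum]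
      · rw [RCLike.ofReal_sum]
        refine Finset.sum_congr rfl fun u _ => ?_
        split_ifs <;> simp
      · intro u hu
        split_ifs
        · have : (external T).card ≠ 0 := Finset.card_ne_zero_of_mem hu
          simpa using this
        · simp
    simp only [h2, Finset.sum_mul]
    rw [Finset.sum_comm, Finset.sum_div]
    refine Finset.sum_congr rfl fun u hu => ?_
    rw [Finset.sum_eq_single (insert u T)]
    · rw [if_pos rfl, div_eq_inv_mul]
    · intro S _ hS
      rw [if_neg hS, zero_mul]
    · intro h
      exact absurd (mem_shapes_succ.2 ⟨T, hT, u, hu, rfl⟩) h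

section
variable {Ω : Type*} [MeasurableSpace Ω] {P : Measure Ω} [IsProbabilityMeasure P]
  {ν : Measure (EuclideanSpace ℝ (Fin b))}
  {T : ℕ → Ω → Finset (Node b)} {Z : Node b → Ω → EuclideanSpace ℝ (Fin b)}

namespace IsWeightedRecursiveTree

lemma real_eq (h : IsWeightedRecursiveTree P ν T Z) (n : ℕ) (S : Finset (Node b)) :
    P.real (T n ⁻¹' {S}) = (treeLaw b n S).toReal := by
  rw [← map_measureReal_apply (h.measurable_tree n) (measurableSet_singleton S), h.law_tree,
    Measure.real, PMF.toMeasure_apply_singleton _ _ (measurableSet_singleton S)]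

lemma ae_mem_shapes (hb : 2 ≤ b) (h : IsWeightedRecursiveTree P ν T Z) (n : ℕ) :
    ∀ᵐ ω ∂P, T n ω ∈ shapes b n := by
  have h1 : ∀ᵐ S ∂(P.map (T n)), S ∈ shapes b n := by
    rw [h.law_tree, ae_iff, PMF.toMeasure_apply_eq_zero_iff _ (MeasurableSet.of_discrete)]
    rw [Set.disjoint_left]
    intro S hS hS'
    exact hS' (mem_shapes_of_treeLaw_ne_zero hb ((PMF.mem_support_iff _ _).1 hS))
  exact ae_of_ae_map (h.measurable_tree n).aemeasurable h1

variable {𝕜 : Type*} [RCLike 𝕜]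

lemma measurable_weights (h : IsWeightedRecursiveTree P ν T Z) :
    Measurable (fun ω u => Z u ω) := measurable_pi_lambda _ h.measurable_weight

lemma ae_eq_sum_indicator (hb : 2 ≤ b) (h : IsWeightedRecursiveTree P ν T Z) (n : ℕ)
    (F : Finset (Node b) → (Node b → EuclideanSpace ℝ (Fin b)) → 𝕜) :
    (fun ω => F (T n ω) (fun u => Z u ω)) =ᵐ[P] fun ω =>
      ∑ S ∈ shapes b n, (T n ⁻¹' {S}).indicator (fun ω => F S (fun u => Z u ω)) ω := by
  filter_upwards [h.ae_mem_shapes hb n] with ω hω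
  rw [Finset.sum_eq_single (T n ω)]
  · rw [Set.indicator_of_mem (show ω ∈ T n ⁻¹' {T n ω} from rfl)]
  · intro S _ hS
    exact Set.indicator_of_notMem (fun h' : ω ∈ T n ⁻¹' {S} => hS (Eq.symm h')) _
  · intro h'
    exact absurd hω h'

lemma integrable_tree (hb : 2 ≤ b) (h : IsWeightedRecursiveTree P ν T Z) (n : ℕ)
    {F : Finset (Node b) → (Node b → EuclideanSpace ℝ (Fin b)) → 𝕜}
    (hi : ∀ S ∈ shapes b n, Integrable (fun ω => F S (fun u => Z u ω)) P) :
    Integrable (fun ω => F (T n ω) (fun u => Z u ω)) P := by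
  rw [integrable_congr (h.ae_eq_sum_indicator hb n F)]
  exact integrable_finsetSum _ fun S hS =>
    (hi S hS).indicator (h.measurable_tree n (measurableSet_singleton S))

lemma integral_indicator_tree (h : IsWeightedRecursiveTree P ν T Z) (n : ℕ)
    (S : Finset (Node b)) {F : (Node b → EuclideanSpace ℝ (Fin b)) → 𝕜} (hF : Measurable F) :
    ∫ ω, (T n ⁻¹' {S}).indicator (fun ω => F (fun u => Z u ω)) ω ∂P
      = (((treeLaw b n S).toReal : ℝ) : 𝕜) * ∫ ω, F (fun u => Z u ω) ∂P := by
  have h1 : IndepFun (fun ω => ({S} : Set (Finset (Node b))).indicator (fun _ => (1 : 𝕜)) (T n ω))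
      (fun ω => F (fun u => Z u ω)) P :=
    (h.indep_tree n).comp (measurable_one.indicator (measurableSet_singleton S)) hF
  have h2 := h1.integral_fun_mul_eq_mul_integral
    (((measurable_one.indicator (measurableSet_singleton S)).comp
      (h.measurable_tree n)).aestronglyMeasurable)
    ((hF.comp h.measurable_weights).aestronglyMeasurable)
  have h3 : ∫ ω, ({S} : Set (Finset (Node b))).indicator (fun _ => (1 : 𝕜)) (T n ω) ∂P
      = (((treeLaw b n S).toReal : ℝ) : 𝕜) := by
    have : (fun ω => ({S} : Set (Finset (Node b))).indicator (fun _ => (1 : 𝕜)) (T n ω))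
      = (T n ⁻¹' {S}).indicator (fun _ => (1 : 𝕜)) := by
      funext ω
      simp [Set.indicator]
    rw [this, integral_indicator (h.measurable_tree n (measurableSet_singleton S)),
      setIntegral_const, h.real_eq, RCLike.real_smul_eq_coe_mul, mul_one]
  rw [← h3, ← h2]
  congr 1
  funext ω
  simp [Set.indicator]

/-- The tree takes finitely many values and is independent of the weights: freeze the tree,
integrate over the weights, then average over the trees. -/
theorem integral_eq_treeExp (hb : 2 ≤ b) (h : IsWeightedRecursiveTree P ν T Z) (n : ℕ)
    {F : Finset (Node b) → (Node b → EuclideanSpace ℝ (Fin b)) → 𝕜} (hF : ∀ S, Measurable (F S))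
    (hi : ∀ S ∈ shapes b n, Integrable (fun ω => F S (fun u => Z u ω)) P) :
    ∫ ω, F (T n ω) (fun u => Z u ω) ∂P
      = treeExp n fun S => ∫ ω, F S (fun u => Z u ω) ∂P := by
  rw [integral_congr_ae (h.ae_eq_sum_indicator hb n F), integral_finsetSum, treeExp_eq_sum hb]
  · exact Finset.sum_congr rfl fun S _ => h.integral_indicator_tree n S (hF S)
  · exact fun S hS => (hi S hS).indicator (h.measurable_tree n (measurableSet_singleton S))

end IsWeightedRecursiveTree

end

end BaryTree

namespace BaryTree

variable {b : ℕ}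

/-! ### Decomposition of path length and Wiener index at the root -/

/-- The weights in the `i`-th subtree of the root. -/
def shift (w : Node b → EuclideanSpace ℝ (Fin b)) (i : Fin b) : Node b → EuclideanSpace ℝ (Fin b) :=
  fun v => w (i :: v)

lemma weightedDepth_cons (w : Node b → EuclideanSpace ℝ (Fin b)) (i : Fin b) (v : Node b) :
    weightedDepth w (i :: v) = w [] i + weightedDepth (shift w i) v := rfl

lemma pathLength_eq {T : Finset (Node b)} (hT : [] ∈ T)
    (w : Node b → EuclideanSpace ℝ (Fin b)) :
    pathLength w T
      = ∑ i, (pathLength (shift w i) (sub T i) + w [] i * (subtreeSizes T i : ℝ)) := by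
  rw [pathLength, sum_eq_root_add hT]
  simp only [weightedDepth, zero_add]
  refine Finset.sum_congr rfl fun i _ => ?_
  rw [Finset.sum_add_distrib, Finset.sum_const, card_sub, nsmul_eq_mul, pathLength]
  ring!

lemma weightedDist_nil_right (w : Node b → EuclideanSpace ℝ (Fin b)) (u : Node b) :
    weightedDist w u [] = weightedDepth w u := by
  cases u <;> simp [weightedDist]

/-- A pair within one subtree keeps its distance. Every other path runs through the root, so a node
of the i-th subtree contributes its depth once for each node outside that subtree. -/
lemma wienerIndex_eq {T : Finset (Node b)} (hT : [] ∈ T)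
    (w : Node b → EuclideanSpace ℝ (Fin b)) :
    wienerIndex w T
      = ∑ i, (wienerIndex (shift w i) (sub T i) + ((T.card : ℝ) - subtreeSizes T i) *
          (pathLength (shift w i) (sub T i) + w [] i * (subtreeSizes T i : ℝ))) := by
  classical
  obtain ⟨q, hq⟩ : ∃ q : Fin b → ℝ, ∀ i,
      pathLength (shift w i) (sub T i) + w [] i * (subtreeSizes T i : ℝ) = q i := ⟨_, fun _ => rfl⟩
  simp only [hq]
  have hq' : ∀ i, ∑ v ∈ sub T i, weightedDepth w (i :: v) = q i := by
    intro i
    simp only [weightedDepth_cons]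
    rw [Finset.sum_add_distrib, Finset.sum_const, card_sub, nsmul_eq_mul, ← hq, pathLength]
    ring
  have hcard : (T.card : ℝ) = 1 + ∑ i, (subtreeSizes T i : ℝ) := by
    exact_mod_cast card_eq_one_add_sum hT
  have hpair : ∀ i j, ∑ u ∈ sub T i, ∑ v ∈ sub T j, weightedDist w (i :: u) (j :: v)
      = if i = j then 2 * wienerIndex (shift w i) (sub T i)
        else subtreeSizes T j * q i + subtreeSizes T i * q j := by
    intro i j
    split_ifs with hij
    · subst hij
      simp only [weightedDist, if_true, wienerIndex]
      rw [mul_div_cancel₀ _ two_ne_zero]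
      rfl
    · simp only [weightedDist, if_neg hij]
      simp only [Finset.sum_add_distrib, Finset.sum_const, hq', card_sub, nsmul_eq_mul,
        ← Finset.mul_sum]
  have hmain : ∑ u ∈ T, ∑ v ∈ T, weightedDist w u v
      = ∑ i, 2 * q i + ∑ i, ∑ j, (if i = j then 2 * wienerIndex (shift w i) (sub T i)
        else subtreeSizes T j * q i + subtreeSizes T i * q j) := by
    rw [sum_eq_root_add hT]
    have h1 : ∑ v ∈ T, weightedDist w [] v = ∑ i, q i := by
      rw [sum_eq_root_add hT]
      simp [weightedDist, weightedDepth, ← hq']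
    have h2 : ∀ i, ∑ u ∈ sub T i, ∑ v ∈ T, weightedDist w (i :: u) v
        = q i + ∑ j, (if i = j then 2 * wienerIndex (shift w i) (sub T i)
          else subtreeSizes T j * q i + subtreeSizes T i * q j) := by
      intro i
      simp only [sum_eq_root_add hT (fun v => weightedDist w (i :: _) v), Finset.sum_add_distrib,
        weightedDist_nil_right, hq', ← hpair]
      rw [Finset.sum_comm]
    rw [h1, Finset.sum_congr rfl fun i _ => h2 i, Finset.sum_add_distrib, ← Finset.mul_sum,
      two_mul, add_assoc]
  have hdiag : ∀ i, ∑ j, (if i = j then 2 * wienerIndex (shift w i) (sub T i)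
        else subtreeSizes T j * q i + subtreeSizes T i * q j)
      = 2 * wienerIndex (shift w i) (sub T i) - 2 * subtreeSizes T i * q i
        + (∑ j, (subtreeSizes T j : ℝ)) * q i + subtreeSizes T i * ∑ j, q j := by
    intro i
    -- The off-diagonal formula is extended to j = i and corrected there, so that the double sum
    -- factors.
    have : ∀ j, (if i = j then 2 * wienerIndex (shift w i) (sub T i)
        else subtreeSizes T j * q i + subtreeSizes T i * q j)
      = (if i = j then (2 * wienerIndex (shift w i) (sub T i) - 2 * subtreeSizes T i * q i) else 0)
        + (subtreeSizes T j * q i + subtreeSizes T i * q j) := by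
      intro j
      split_ifs with hij
      · subst hij; ring
      · ring
    simp only [this, Finset.sum_add_distrib, Finset.sum_ite_eq, Finset.mem_univ, if_true,
      ← Finset.sum_mul, ← Finset.mul_sum]
    ring
  rw [wienerIndex, hmain, Finset.sum_congr rfl fun i _ => hdiag i, hcard]
  simp only [Finset.sum_add_distrib, Finset.sum_sub_distrib, sub_mul, add_mul, one_mul,
    ← Finset.mul_sum, ← Finset.sum_mul, mul_assoc]
  ring

/-! ### Measurability and bounds in the weights -/

lemma measurable_shift (i : Fin b) :
    Measurable fun w : Node b → EuclideanSpace ℝ (Fin b) => shift w i :=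
  measurable_pi_lambda _ fun v => measurable_pi_apply (i :: v)

lemma measurable_weight_apply (u : Node b) (i : Fin b) :
    Measurable fun w : Node b → EuclideanSpace ℝ (Fin b) => w u i := by
  have h : Measurable fun z : EuclideanSpace ℝ (Fin b) => z i := by fun_prop
  exact h.comp (measurable_pi_apply u)

lemma measurable_weightedDepth (u : Node b) :
    Measurable fun w : Node b → EuclideanSpace ℝ (Fin b) => weightedDepth w u := by
  induction u with
  | nil => exact measurable_const
  | cons i u ih => exact (measurable_weight_apply [] i).add (ih.comp (measurable_shift i))

lemma measurable_weightedDist (u v : Node b) :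
    Measurable fun w : Node b → EuclideanSpace ℝ (Fin b) => weightedDist w u v := by
  induction u generalizing v with
  | nil => simpa only [weightedDist] using measurable_weightedDepth v
  | cons i u ih =>
    cases v with
    | nil => simpa only [weightedDist] using measurable_weightedDepth (i :: u)
    | cons j v =>
      simp only [weightedDist]
      split_ifs
      · exact (ih v).comp (measurable_shift i)
      · exact (measurable_weightedDepth _).add (measurable_weightedDepth _)

lemma measurable_pathLength (T : Finset (Node b)) :
    Measurable fun w : Node b → EuclideanSpace ℝ (Fin b) => pathLength w T :=
  Finset.measurable_fun_sum _ fun u _ => measurable_weightedDepth u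

lemma measurable_wienerIndex (T : Finset (Node b)) :
    Measurable fun w : Node b → EuclideanSpace ℝ (Fin b) => wienerIndex w T :=
  (Finset.measurable_fun_sum _ fun u _ =>
    Finset.measurable_fun_sum _ fun v _ => measurable_weightedDist u v).div_const 2

lemma abs_weightedDepth_le {M : ℝ} {w : Node b → EuclideanSpace ℝ (Fin b)}
    (hw : ∀ u i, |w u i| ≤ M) (u : Node b) : |weightedDepth w u| ≤ M * u.length := by
  induction u generalizing w with
  | nil => simp [weightedDepth]
  | cons i u ih =>
    rw [weightedDepth_cons, List.length_cons]
    have := ih (w := shift w i) fun v j => hw _ _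
    push_cast
    linarith [abs_add_le (w [] i) (weightedDepth (shift w i) u), hw [] i]

lemma abs_weightedDist_le {M : ℝ} {w : Node b → EuclideanSpace ℝ (Fin b)} (hM : 0 ≤ M)
    (hw : ∀ u i, |w u i| ≤ M) (u v : Node b) :
    |weightedDist w u v| ≤ M * u.length + M * v.length := by
  induction u generalizing v w with
  | nil => simpa [weightedDist] using abs_weightedDepth_le hw v
  | cons i u ih =>
    cases v with
    | nil => simpa [weightedDist] using abs_weightedDepth_le hw (i :: u)
    | cons j v =>
      simp only [weightedDist]
      split_ifs
      · refine (ih (w := shift w i) (fun v j => hw _ _) v).trans ?_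
        simp only [List.length_cons]
        push_cast
        linarith
      · exact (abs_add_le _ _).trans
          (add_le_add (abs_weightedDepth_le hw _) (abs_weightedDepth_le hw _))

lemma exists_bound (M : ℝ) (hM : 0 ≤ M) (T : Finset (Node b)) :
    ∃ C : ℝ, ∀ w : Node b → EuclideanSpace ℝ (Fin b), (∀ u i, |w u i| ≤ M) →
      |wienerIndex w T| ≤ C ∧ |pathLength w T| ≤ C := by
  refine ⟨max ((∑ u ∈ T, ∑ v ∈ T, (M * u.length + M * v.length)) / 2)
    (∑ u ∈ T, M * u.length), fun w hw => ⟨le_max_of_le_left ?_, le_max_of_le_right ?_⟩⟩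
  · rw [wienerIndex, abs_div, abs_two]
    gcongr
    refine (Finset.abs_sum_le_sum_abs _ _).trans (Finset.sum_le_sum fun u _ => ?_)
    exact (Finset.abs_sum_le_sum_abs _ _).trans
      (Finset.sum_le_sum fun v _ => abs_weightedDist_le hM hw u v)
  · exact (Finset.abs_sum_le_sum_abs _ _).trans
      (Finset.sum_le_sum fun u _ => abs_weightedDepth_le hw u)

end BaryTree

/-! ### Grouping an independent family into independent blocks -/

/-- If the random variables `X i j` are independent, then so are the families `X i`. -/
lemma ProbabilityTheory.iIndepFun.sigma_curry {Ω ι : Type*} [MeasurableSpace Ω] {P : Measure Ω}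
    {κ : ι → Type*} {𝓧 : Type*} [MeasurableSpace 𝓧] {X : (i : ι) → κ i → Ω → 𝓧}
    (mX : ∀ i j, Measurable (X i j))
    (h : iIndepFun (fun (p : (i : ι) × κ i) ω => X p.1 p.2 ω) P) :
    iIndepFun (fun i ω j => X i j ω) P := by
  have := h.isProbabilityMeasure
  have hp : ∀ i j, IsProbabilityMeasure (P.map (X i j)) :=
    fun i j => Measure.isProbabilityMeasure_map (mX i j).aemeasurable
  have hm : ∀ i, Measurable fun ω j => X i j ω := fun i => measurable_pi_lambda _ (mX i)
  rw [iIndepFun_iff_map_fun_eq_infinitePi_map hm]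
  have h1 : ∀ i, P.map (fun ω j => X i j ω) = Measure.infinitePi fun j => P.map (X i j) := by
    intro i
    exact (h.precomp (g := fun j : κ i => (⟨i, j⟩ : (i : ι) × κ i))
      sigma_mk_injective).map_fun_eq_infinitePi_map (mX i)
  simp only [h1]
  have h2 := h.map_fun_eq_infinitePi_map (fun p : (i : ι) × κ i => mX p.1 p.2)
  rw [← Measure.infinitePi_map_piCurry (fun i j => P.map (X i j)), ← h2,
    Measure.map_map (by fun_prop) (measurable_pi_lambda _ fun p : (i : ι) × κ i => mX p.1 p.2)]
  rfl

namespace BaryTree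

variable {b : ℕ}

set_option linter.unusedSectionVars false

section
variable {Ω : Type*} [MeasurableSpace Ω] {P : Measure Ω} [IsProbabilityMeasure P]
  {ν : Measure (EuclideanSpace ℝ (Fin b))}
  {T : ℕ → Ω → Finset (Node b)} {Z : Node b → Ω → EuclideanSpace ℝ (Fin b)}
  {𝕜 : Type*} [RCLike 𝕜]

/-! ### Independence of the weights at the root and in the subtrees -/

/-- The index set of the weights at the root (`none`) and in the `i`-th subtree (`some i`). -/
def BlockIndex (b : ℕ) : Option (Fin b) → Type
  | none => Unit
  | some _ => Node b

/-- The node of the tree that corresponds to an index in a block. -/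
def blockNode : (p : (o : Option (Fin b)) × BlockIndex b o) → Node b
  | ⟨none, _⟩ => []
  | ⟨some i, v⟩ => List.cons i v

lemma blockNode_injective : Function.Injective (blockNode (b := b)) := by
  rintro ⟨_ | i, u⟩ ⟨_ | j, v⟩ h
  · rfl
  · simp [blockNode] at h
  · simp [blockNode] at h
  · obtain ⟨rfl, rfl⟩ := List.cons.inj (show List.cons i u = List.cons j v from h)
    rfl

namespace IsWeightedRecursiveTree

/-- Both families are independent with marginals ν, hence both have the infinite product of ν as
law. -/
lemma identDistrib_shift (h : IsWeightedRecursiveTree P ν T Z) (i : Fin b) :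
    IdentDistrib (fun ω => shift (fun u => Z u ω) i) (fun ω u => Z u ω) P P where
  aemeasurable_fst := ((measurable_shift i).comp h.measurable_weights).aemeasurable
  aemeasurable_snd := h.measurable_weights.aemeasurable
  map_eq := by
    rw [h.indep_weight.map_fun_eq_infinitePi_map h.measurable_weight]
    have h1 := (h.indep_weight.precomp (g := fun v : Node b => List.cons i v)
      List.cons_injective).map_fun_eq_infinitePi_map (fun v => h.measurable_weight _)
    simp only [h.law_weight] at h1 ⊢
    exact h1

lemma iIndepFun_blocks (h : IsWeightedRecursiveTree P ν T Z) :
    iIndepFun (fun (o : Option (Fin b)) ω (j : BlockIndex b o) => Z (blockNode ⟨o, j⟩) ω) P :=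
  iIndepFun.sigma_curry (fun _ _ => h.measurable_weight _)
    (h.indep_weight.precomp blockNode_injective)

section
variable {g : EuclideanSpace ℝ (Fin b) → 𝕜}
  {f : Fin b → (Node b → EuclideanSpace ℝ (Fin b)) → 𝕜}

/-- A function of the weights at the root and functions of the weights in the subtrees, as
functions of the blocks of weights. -/
def blockFun (g : EuclideanSpace ℝ (Fin b) → 𝕜)
    (f : Fin b → (Node b → EuclideanSpace ℝ (Fin b)) → 𝕜) :
    (o : Option (Fin b)) → (BlockIndex b o → EuclideanSpace ℝ (Fin b)) → 𝕜
  | none => fun z => g (z ())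
  | some i => f i

lemma iIndepFun_blockFun (h : IsWeightedRecursiveTree P ν T Z) (hg : Measurable g)
    (hf : ∀ i, Measurable (f i)) :
    iIndepFun (fun o ω => blockFun g f o fun j => Z (blockNode ⟨o, j⟩) ω) P := by
  refine h.iIndepFun_blocks.comp (blockFun g f) ?_
  rintro (_ | i)
  · exact hg.comp (measurable_pi_apply _)
  · exact hf i

lemma blockFun_prod (ω : Ω) :
    ∏ o, blockFun g f o (fun j => Z (blockNode ⟨o, j⟩) ω)
      = g (Z [] ω) * ∏ i, f i (shift (fun u => Z u ω) i) := by
  rw [Fintype.prod_option]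
  rfl

lemma measurable_blockFun (h : IsWeightedRecursiveTree P ν T Z) (hg : Measurable g)
    (hf : ∀ i, Measurable (f i)) (o : Option (Fin b)) :
    Measurable fun ω => blockFun g f o (fun j => Z (blockNode ⟨o, j⟩) ω) := by
  cases o with
  | none => exact hg.comp (h.measurable_weight [])
  | some i => exact (hf i).comp ((measurable_shift i).comp h.measurable_weights)

lemma integral_shift (h : IsWeightedRecursiveTree P ν T Z) {F : (Node b → EuclideanSpace ℝ (Fin b)) → 𝕜}
    (hF : Measurable F) (i : Fin b) :
    ∫ ω, F (shift (fun u => Z u ω) i) ∂P = ∫ ω, F (fun u => Z u ω) ∂P :=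
  ((h.identDistrib_shift i).comp hF).integral_eq

lemma integral_root_mul_prod (h : IsWeightedRecursiveTree P ν T Z) (hg : Measurable g)
    (hf : ∀ i, Measurable (f i)) :
    ∫ ω, g (Z [] ω) * ∏ i, f i (shift (fun u => Z u ω) i) ∂P
      = (∫ ω, g (Z [] ω) ∂P) * ∏ i, ∫ ω, f i (fun u => Z u ω) ∂P := by
  have h1 := (h.iIndepFun_blockFun hg hf).integral_fun_prod_eq_prod_integral
    fun o => (h.measurable_blockFun hg hf o).aestronglyMeasurable
  simp only [blockFun_prod] at h1
  rw [h1, Fintype.prod_option]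
  congr 1
  refine Finset.prod_congr rfl fun i _ => ?_
  rw [← h.integral_shift (hf i) i]
  rfl

/-- A product of integrable functions need not be integrable; here independence turns the joint law
into a product measure, under which integrability of the factors suffices. -/
lemma integrable_root_mul_prod (h : IsWeightedRecursiveTree P ν T Z) (hg : Measurable g)
    (hf : ∀ i, Measurable (f i)) (hgi : Integrable (fun ω => g (Z [] ω)) P)
    (hfi : ∀ i, Integrable (fun ω => f i (fun u => Z u ω)) P) :
    Integrable (fun ω => g (Z [] ω) * ∏ i, f i (shift (fun u => Z u ω) i)) P := by
  simp only [← blockFun_prod]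
  have hm := h.measurable_blockFun hg hf
  have h1 := (h.iIndepFun_blockFun hg hf).map_fun_eq_pi_map fun o => (hm o).aemeasurable
  have h2 : Integrable (fun x : Option (Fin b) → 𝕜 => ∏ o, x o)
      (P.map fun ω o => blockFun g f o fun j => Z (blockNode ⟨o, j⟩) ω) := by
    rw [h1]
    have : ∀ o, IsProbabilityMeasure
        (P.map fun ω => blockFun g f o fun j => Z (blockNode ⟨o, j⟩) ω) :=
      fun o => Measure.isProbabilityMeasure_map (hm o).aemeasurable
    refine Integrable.fintype_prod (f := fun _ x => x) fun o => ?_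
    refine (integrable_map_measure aestronglyMeasurable_id (hm o).aemeasurable).2 ?_
    cases o with
    | none => exact hgi
    | some i => exact (((h.identDistrib_shift i).comp (hf i)).integrable_iff).2 (hfi i)
  exact h2.comp_measurable (measurable_pi_lambda _ hm)

end

/-! ### The recursive decomposition of expectations -/

lemma measurable_subtreeSizes (h : IsWeightedRecursiveTree P ν T Z) (n : ℕ) :
    Measurable fun ω => subtreeSizes (T n ω) :=
  (Measurable.of_discrete (f := subtreeSizes)).comp (h.measurable_tree n)

lemma integral_tree (hb : 2 ≤ b) (h : IsWeightedRecursiveTree P ν T Z) (n : ℕ)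
    (F : Finset (Node b) → 𝕜) : ∫ ω, F (T n ω) ∂P = treeExp n F := by
  rw [h.integral_eq_treeExp hb n (F := fun S _ => F S) (fun _ => measurable_const)
    (fun _ _ => integrable_const _)]
  simp

/-- For a fixed tree, independence of the weight blocks factors the integral; `treeExp_forest` then
replaces each subtree by a random tree of its size. It is applied with complex exponentials for the
recursion and with real ones for the moment generating function. -/
theorem integral_decomposition (hb : 2 ≤ b) (h : IsWeightedRecursiveTree P ν T Z) (n : ℕ)
    {g : (Fin b → ℕ) → EuclideanSpace ℝ (Fin b) → 𝕜}
    {f : (Fin b → ℕ) → Fin b → Finset (Node b) → (Node b → EuclideanSpace ℝ (Fin b)) → 𝕜}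
    (hg : ∀ x, Measurable (g x)) (hf : ∀ x i t, Measurable (f x i t))
    (hgi : ∀ x, Integrable (fun ω => g x (Z [] ω)) P)
    (hfi : ∀ x i t, Integrable (fun ω => f x i t (fun u => Z u ω)) P) :
    ∫ ω, g (subtreeSizes (T (n + 1) ω)) (Z [] ω) * ∏ i, f (subtreeSizes (T (n + 1) ω)) i
        (sub (T (n + 1) ω) i) (shift (fun u => Z u ω) i) ∂P
      = ∫ ω, (∫ ω', g (subtreeSizes (T (n + 1) ω)) (Z [] ω') ∂P) *
          ∏ i, ∫ ω', f (subtreeSizes (T (n + 1) ω)) i (T (subtreeSizes (T (n + 1) ω) i) ω')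
            (fun u => Z u ω') ∂P ∂P := by
  rw [h.integral_eq_treeExp hb (n + 1) (F := fun S w => g (subtreeSizes S) (w []) *
      ∏ i, f (subtreeSizes S) i (sub S i) (shift w i)),
    h.integral_tree hb (n + 1) (F := fun S => (∫ ω', g (subtreeSizes S) (Z [] ω') ∂P) *
          ∏ i, ∫ ω', f (subtreeSizes S) i (T (subtreeSizes S i) ω')
            (fun u => Z u ω') ∂P)]
  · simp only [h.integral_root_mul_prod (hg _) (hf _ · _)]
    rw [treeExp_forest hb n (fun x => ∫ ω, g x (Z [] ω) ∂P)
      (fun x i t => ∫ ω, f x i t (fun u => Z u ω) ∂P)]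
    refine treeExp_congr fun S _ => ?_
    congr 1
    refine Finset.prod_congr rfl fun i _ => ?_
    rw [h.integral_eq_treeExp hb _ (hf _ i) (fun t _ => hfi _ i t)]
  · intro S
    have h0 : Measurable fun w : Node b → EuclideanSpace ℝ (Fin b) => g (subtreeSizes S) (w []) :=
      (hg _).comp (measurable_pi_apply _)
    refine h0.mul (Finset.measurable_fun_prod _ fun i _ => ?_)
    exact (hf (subtreeSizes S) i (sub S i)).comp (measurable_shift i)
  · intro S _
    exact h.integrable_root_mul_prod (hg _) (fun i => hf _ i _) (hgi _) (fun i => hfi _ i _)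

end IsWeightedRecursiveTree

end

end BaryTree

namespace BaryTree

set_option linter.unusedSectionVars false

section
variable {b k : ℕ} {lawI : Measure (Fin b → ℕ)} {lawZ : Measure (EuclideanSpace ℝ (Fin b))}
  {lawX : ℕ → Measure (EuclideanSpace ℝ (Fin k))} [IsProbabilityMeasure lawI]
  [IsProbabilityMeasure lawZ] [∀ m, IsProbabilityMeasure (lawX m)]
  {A : Fin b → (Fin b → ℕ) → Matrix (Fin k) (Fin k) ℝ}
  {d : (Fin b → ℕ) → EuclideanSpace ℝ (Fin b) → EuclideanSpace ℝ (Fin k)}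

/-! ### A sum recursion in terms of characteristic functions -/

lemma measurable_toEuclideanLin (B : Matrix (Fin k) (Fin k) ℝ) : Measurable B.toEuclideanLin :=
  B.toEuclideanLin.continuous_of_finiteDimensional.measurable

lemma measurable_uncurry_toll (hd : ∀ x, Measurable (d x)) :
    Measurable fun p : (Fin b → ℕ) × EuclideanSpace ℝ (Fin b) => d p.1 p.2 :=
  measurable_from_prod_countable_right hd

lemma measurable_sum_toEuclideanLin_eval (A : Fin b → (Fin b → ℕ) → Matrix (Fin k) (Fin k) ℝ) :
    Measurable (Function.uncurry fun (x : Fin b → ℕ) (X : Fin b → ℕ → EuclideanSpace ℝ (Fin k)) =>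
      ∑ i, (A i x).toEuclideanLin (X i (x i))) := by
  refine measurable_from_prod_countable_right fun x => ?_
  simp only [Function.uncurry_apply_pair]
  refine Finset.measurable_fun_sum _ fun i _ => ?_
  have h0 : Measurable fun X : Fin b → ℕ → EuclideanSpace ℝ (Fin k) => X i (x i) := by fun_prop
  exact (measurable_toEuclideanLin (A i x)).comp h0

lemma measurable_recursion_rhs (A : Fin b → (Fin b → ℕ) → Matrix (Fin k) (Fin k) ℝ)
    (hd : ∀ x, Measurable (d x)) :
    Measurable fun ω : ((Fin b → ℕ) × EuclideanSpace ℝ (Fin b)) ×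
        (Fin b → ℕ → EuclideanSpace ℝ (Fin k)) =>
      ∑ i, (A i ω.1.1).toEuclideanLin (ω.2 i (ω.1.1 i)) + d ω.1.1 ω.1.2 := by
  have h1 : Measurable fun ω : ((Fin b → ℕ) × EuclideanSpace ℝ (Fin b)) ×
        (Fin b → ℕ → EuclideanSpace ℝ (Fin k)) => (ω.1.1, ω.2) := by fun_prop
  have h2 := (measurable_sum_toEuclideanLin_eval A).comp h1
  have h0 : Measurable fun ω : ((Fin b → ℕ) × EuclideanSpace ℝ (Fin b)) ×
        (Fin b → ℕ → EuclideanSpace ℝ (Fin k)) => ω.1 := by fun_prop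
  have h3 := (measurable_uncurry_toll hd).comp h0
  simp only [Function.comp_def, Function.uncurry] at h2 h3
  exact h2.add h3

lemma norm_charFun_integrand {E : Type*} [NormedAddCommGroup E] [InnerProductSpace ℝ E] (x s : E) :
    ‖Complex.exp (inner ℝ x s * Complex.I)‖ = 1 := Complex.norm_exp_ofReal_mul_I _

/-- The required variables are coordinates on a product space, so all the independence conditions
hold by construction. By Fubini, the characteristic function of the right-hand side is the
expression in `hchar`. -/
theorem solvesSumRecursion_of_charFun (n : ℕ) (hd : ∀ x, Measurable (d x))
    (hlt : ∀ᵐ x ∂lawI, ∀ i, x i < n)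
    (hint : Integrable (fun p : _ × _ => d p.1 p.2) (lawI.prod lawZ))
    (hzero : ∫ p, d p.1 p.2 ∂(lawI.prod lawZ) = 0)
    (hchar : ∀ s, charFun (lawX n) s
      = ∫ x, (∫ z, Complex.exp (inner ℝ (d x z) s * Complex.I) ∂lawZ) *
          ∏ i, ∫ y, Complex.exp (inner ℝ ((A i x).toEuclideanLin y) s * Complex.I)
            ∂(lawX (x i)) ∂lawI) :
    SolvesSumRecursion n lawI lawZ lawX A d := by
  -- The dependence between different m within one family is immaterial, since the recursion
  -- evaluates the i-th family only at m = I_i; a product law is the simplest choice.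
  set μ : Measure (Fin b → ℕ → EuclideanSpace ℝ (Fin k)) :=
    Measure.pi fun _ => Measure.infinitePi lawX with hμ
  set Q := (lawI.prod lawZ).prod μ with hQ
  have h1 : Q.map Prod.fst = lawI.prod lawZ := by
    rw [hQ, ← Measure.fst, Measure.fst_prod]
  have h2 : Q.map Prod.snd = μ := by
    rw [hQ, ← Measure.snd, Measure.snd_prod]
  have hI : Q.map (fun ω => ω.1.1) = lawI := by
    rw [← Function.comp_def Prod.fst Prod.fst, ← Measure.map_map measurable_fst measurable_fst, h1,
      ← Measure.fst, Measure.fst_prod]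
  have hZ : Q.map (fun ω => ω.1.2) = lawZ := by
    rw [← Function.comp_def Prod.snd Prod.fst, ← Measure.map_map measurable_snd measurable_fst, h1,
      ← Measure.snd, Measure.snd_prod]
  have hXi : ∀ i, Q.map (fun ω => ω.2 i) = Measure.infinitePi lawX := by
    intro i
    rw [← Function.comp_def (fun x : Fin b → ℕ → EuclideanSpace ℝ (Fin k) => x i) Prod.snd,
      ← Measure.map_map (measurable_pi_apply i) measurable_snd, h2,
      (measurePreserving_eval _ i).map_eq]
  have hX : ∀ i m, Q.map (fun ω => ω.2 i m) = lawX m := by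
    intro i m
    rw [← Measure.infinitePi_map_eval lawX m, ← hXi i,
      Measure.map_map (measurable_pi_apply m) (by fun_prop)]
    rfl
  have hdm := measurable_uncurry_toll hd
  refine ⟨_, inferInstance, Q, fun ω => ω.1.1, fun ω => ω.1.2, fun i m ω => ω.2 i m,
    inferInstance, ⟨by fun_prop, hI⟩, ⟨by fun_prop, hZ⟩, fun i m => ⟨by fun_prop, hX i m⟩,
    ?_, ?_, ?_, ?_, ?_, ?_, ?_⟩
  · rw [indepFun_iff_map_prod_eq_prod_map_map (by fun_prop) (by fun_prop), hI, hZ]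
    exact h1
  · rw [iIndepFun_iff_map_fun_eq_pi_map (fun i => by fun_prop)]
    have : ∀ i, Q.map (fun ω m => ω.2 i m) = Measure.infinitePi lawX := hXi
    simp only [this]
    exact h2
  · exact (indepFun_iff_map_prod_eq_prod_map_map (by fun_prop) (by fun_prop)).2 (by
      have e1 : Q.map (fun ω => (ω.1.1, ω.1.2)) = lawI.prod lawZ := h1
      have e2 : Q.map (fun ω i m => ω.2 i m) = μ := h2
      rw [e1, e2]
      exact Measure.map_id)
  · rw [← hI] at hlt
    exact ae_of_ae_map (by fun_prop) hlt
  · rw [← h1] at hint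
    exact hint.comp_measurable measurable_fst
  · rw [← h1, integral_map measurable_fst.aemeasurable hdm.aestronglyMeasurable] at hzero
    exact hzero
  · have hm := measurable_recursion_rhs A hd
    refine ⟨hm.aemeasurable, ?_⟩
    have : IsProbabilityMeasure (Q.map fun ω =>
        ∑ i, (A i ω.1.1).toEuclideanLin (ω.2 i (ω.1.1 i)) + d ω.1.1 ω.1.2) :=
      Measure.isProbabilityMeasure_map hm.aemeasurable
    refine Measure.ext_of_charFun (funext fun s => ?_)
    rw [hchar, charFun_apply, integral_map hm.aemeasurable
      (Continuous.aestronglyMeasurable (by fun_prop)), hQ, integral_prod]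
    · have hinner : ∀ p : (Fin b → ℕ) × EuclideanSpace ℝ (Fin b),
          ∫ X, Complex.exp (inner ℝ (∑ i, (A i p.1).toEuclideanLin (X i (p.1 i)) + d p.1 p.2) s
            * Complex.I) ∂μ
          = Complex.exp (inner ℝ (d p.1 p.2) s * Complex.I) *
            ∏ i, ∫ y, Complex.exp (inner ℝ ((A i p.1).toEuclideanLin y) s * Complex.I)
              ∂(lawX (p.1 i)) := by
        intro p
        have e1 : ∀ X : Fin b → ℕ → EuclideanSpace ℝ (Fin k),
            Complex.exp (inner ℝ (∑ i, (A i p.1).toEuclideanLin (X i (p.1 i)) + d p.1 p.2) s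
              * Complex.I)
            = Complex.exp (inner ℝ (d p.1 p.2) s * Complex.I) *
              ∏ i, Complex.exp (inner ℝ ((A i p.1).toEuclideanLin (X i (p.1 i))) s
                * Complex.I) := by
          intro X
          rw [inner_add_left, sum_inner, ← Complex.exp_sum, ← Complex.exp_add]
          congr 1
          push_cast
          rw [← Finset.sum_mul]
          ring
        simp only [e1]
        rw [integral_const_mul, hμ, integral_fintype_prod_eq_prod (fun i (X : ℕ → _) =>
          Complex.exp (inner ℝ ((A i p.1).toEuclideanLin (X (p.1 i))) s * Complex.I))]
        congr 1
        refine Finset.prod_congr rfl fun i _ => ?_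
        rw [← Measure.infinitePi_map_eval lawX (p.1 i), integral_map (measurable_pi_apply _).aemeasurable]
        refine Measurable.aestronglyMeasurable ?_
        have := measurable_toEuclideanLin (A i p.1)
        fun_prop
      simp only [hinner]
      rw [integral_prod]
      · simp only [integral_mul_const]
      · refine Integrable.of_bound (C := 1) ?_ (Filter.Eventually.of_forall fun p => ?_)
        · refine Measurable.aestronglyMeasurable (Measurable.mul (by fun_prop) ?_)
          exact (Measurable.of_discrete (f := fun x : Fin b → ℕ => ∏ i, ∫ y, Complex.exp
            (inner ℝ ((A i x).toEuclideanLin y) s * Complex.I) ∂(lawX (x i)))).comp measurable_fst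
        · rw [norm_mul, norm_charFun_integrand, one_mul, norm_prod]
          refine Finset.prod_le_one (fun _ _ => norm_nonneg _) fun i _ => ?_
          refine (norm_integral_le_integral_norm _).trans ?_
          simp
    · refine Integrable.of_bound (C := 1) ?_ (Filter.Eventually.of_forall fun p => ?_)
      · exact Measurable.aestronglyMeasurable (by fun_prop)
      · rw [norm_charFun_integrand]

end

end BaryTree

namespace BaryTree

set_option linter.unusedSectionVars false

/-! ### The recursion for Wiener index and path length -/

section
variable {b : ℕ}

/-- The normalized vector for fixed weights and a fixed tree. -/
noncomputable def normVec (eW eL : ℕ → ℝ) (n : ℕ) (w : Node b → EuclideanSpace ℝ (Fin b))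
    (S : Finset (Node b)) : EuclideanSpace ℝ (Fin 2) :=
  !₂[(wienerIndex w S - eW n) / (n : ℝ) ^ 2, (pathLength w S - eL n) / (n : ℝ)]

lemma euclidean_two_eq (x y : ℝ) : (!₂[x, y] : EuclideanSpace ℝ (Fin 2))
    = x • EuclideanSpace.single 0 1 + y • EuclideanSpace.single 1 1 := by
  ext i
  fin_cases i <;> simp

lemma measurable_euclidean_two {α : Type*} [MeasurableSpace α] {f g : α → ℝ} (hf : Measurable f)
    (hg : Measurable g) : Measurable fun a => (!₂[f a, g a] : EuclideanSpace ℝ (Fin 2)) := by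
  simp only [euclidean_two_eq]
  fun_prop

lemma measurable_normVec (eW eL : ℕ → ℝ) (n : ℕ) (S : Finset (Node b)) :
    Measurable fun w => normVec eW eL n w S :=
  measurable_euclidean_two (((measurable_wienerIndex S).sub_const _).div_const _)
    (((measurable_pathLength S).sub_const _).div_const _)

lemma measurable_toll (eW eL : ℕ → ℝ) (n : ℕ) (x : Fin b → ℕ) : Measurable (toll eW eL n x) := by
  unfold toll
  exact measurable_euclidean_two (by fun_prop) (by fun_prop)

lemma toEuclideanLin_coeff (n : ℕ) (i : Fin b) (x : Fin b → ℕ) (y : EuclideanSpace ℝ (Fin 2)) :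
    (coeff n i x).toEuclideanLin y
      = !₂[(x i : ℝ) ^ 2 / (n : ℝ) ^ 2 * y 0 + (x i : ℝ) * ((n : ℝ) - x i) / (n : ℝ) ^ 2 * y 1,
          (x i : ℝ) / n * y 1] := by
  ext j
  fin_cases j <;> simp [coeff, Matrix.toEuclideanLin, Matrix.mulVec, dotProduct, Fin.sum_univ_two]

/-- A pathwise identity: the factors in `coeff` cancel the normalization at the subtree sizes and
restore the one at n + 1, and the toll collects the centring constants and the root edges. -/
theorem normVec_decomposition {eW eL : ℕ → ℝ} (hW0 : eW 0 = 0) (hL0 : eL 0 = 0) {n : ℕ}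
    (w : Node b → EuclideanSpace ℝ (Fin b)) {S : Finset (Node b)} (hS : S ∈ shapes b (n + 1)) :
    normVec eW eL (n + 1) w S
      = ∑ i, (coeff (n + 1) i (subtreeSizes S)).toEuclideanLin
          (normVec eW eL (subtreeSizes S i) (shift w i) (sub S i))
        + toll eW eL (n + 1) (subtreeSizes S) (w []) := by
  have hroot := root_mem_of_mem_shapes hS
  have hcard := card_of_mem_shapes hS
  have hn : ((n + 1 : ℕ) : ℝ) ≠ 0 := by positivity
  have h0 : ∀ i, subtreeSizes S i = 0 → sub S i = ∅ := by
    intro i hi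
    rw [← Finset.card_eq_zero, card_sub, hi]
  have hA : ∀ i, (coeff (n + 1) i (subtreeSizes S)).toEuclideanLin
      (normVec eW eL (subtreeSizes S i) (shift w i) (sub S i))
      = !₂[((wienerIndex (shift w i) (sub S i) - eW (subtreeSizes S i))
          + (((n + 1 : ℕ) : ℝ) - subtreeSizes S i) *
            (pathLength (shift w i) (sub S i) - eL (subtreeSizes S i))) / ((n + 1 : ℕ) : ℝ) ^ 2,
          (pathLength (shift w i) (sub S i) - eL (subtreeSizes S i)) / ((n + 1 : ℕ) : ℝ)] := by
    intro i
    rw [toEuclideanLin_coeff]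
    -- For an empty subtree the normalization divides by zero; both sides then vanish because `eW 0
    -- = eL 0 = 0`.
    by_cases hi : subtreeSizes S i = 0
    · rw [h0 i hi, hi, hW0, hL0]
      simp [wienerIndex, pathLength]
    · have hi' : (subtreeSizes S i : ℝ) ≠ 0 := by exact_mod_cast hi
      ext j
      fin_cases j
      · simp [normVec]
        field_simp
      · simp [normVec]
        field_simp
  simp only [hA]
  ext j
  fin_cases j
  · simp only [normVec, toll, wienerIndex_eq hroot, hcard]
    simp
    simp only [← Finset.sum_div, ← add_div]
    congr 1
    rw [← add_sub_assoc, ← Finset.sum_add_distrib]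
    congr 1
    refine Finset.sum_congr rfl fun i _ => ?_
    ring
  · simp only [normVec, toll, pathLength_eq hroot]
    simp
    simp only [← Finset.sum_div, ← add_div]
    congr 1
    rw [← add_sub_assoc, ← Finset.sum_add_distrib]
    congr 1
    refine Finset.sum_congr rfl fun i _ => ?_
    ring

end

/-! ### Mean recursions and the distributional recursion -/

section
variable {b : ℕ} {Ω : Type*} [MeasurableSpace Ω] {P : Measure Ω} [IsProbabilityMeasure P]
  {ν : Measure (EuclideanSpace ℝ (Fin b))}
  {T : ℕ → Ω → Finset (Node b)} {Z : Node b → Ω → EuclideanSpace ℝ (Fin b)}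

/-- The mean Wiener index of the random tree of size `n`. -/
noncomputable def meanWiener (P : Measure Ω) (T : ℕ → Ω → Finset (Node b))
    (Z : Node b → Ω → EuclideanSpace ℝ (Fin b)) (n : ℕ) : ℝ :=
  ∫ ω, wienerIndex (fun u => Z u ω) (T n ω) ∂P

/-- The mean internal path length of the random tree of size `n`. -/
noncomputable def meanPath (P : Measure Ω) (T : ℕ → Ω → Finset (Node b))
    (Z : Node b → Ω → EuclideanSpace ℝ (Fin b)) (n : ℕ) : ℝ :=
  ∫ ω, pathLength (fun u => Z u ω) (T n ω) ∂P

lemma treeExp_subtree {𝕜 : Type*} [RCLike 𝕜] (hb : 2 ≤ b) (n : ℕ) (i : Fin b)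
    (c : (Fin b → ℕ) → 𝕜) (φ : Finset (Node b) → 𝕜) :
    treeExp (n + 1) (fun S => c (subtreeSizes S) * φ (sub S i))
      = treeExp (n + 1) (fun S => c (subtreeSizes S) * treeExp (subtreeSizes S i) φ) := by
  classical
  have h := treeExp_forest hb n c (fun _ j => if j = i then φ else fun _ => 1)
  have h1 : ∀ S : Finset (Node b), ∏ j, (if j = i then φ else fun _ => 1) (sub S j)
      = φ (sub S i) := by
    intro S
    rw [Finset.prod_eq_single i] <;> simp +contextual
  have h2 : ∀ S : Finset (Node b), ∏ j, treeExp (subtreeSizes S j)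
      (if j = i then φ else fun _ => 1) = treeExp (subtreeSizes S i) φ := by
    intro S
    rw [Finset.prod_eq_single i]
    · simp
    · intro j _ hj
      rw [if_neg hj, treeExp_const hb]
    · simp
  simpa only [h1, h2] using h

namespace IsWeightedRecursiveTree

lemma ae_weight_bound (h : IsWeightedRecursiveTree P ν T Z) {M : ℝ} (hM : ∀ᵐ z ∂ν, ‖z‖ ≤ M) :
    ∀ᵐ ω ∂P, ∀ u i, |Z u ω i| ≤ M := by
  rw [ae_all_iff]
  intro u
  rw [← h.law_weight u] at hM
  filter_upwards [ae_of_ae_map (h.measurable_weight u).aemeasurable hM] with ω hω i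
  exact (PiLp.norm_apply_le (Z u ω) i).trans hω

lemma integrable_root (h : IsWeightedRecursiveTree P ν T Z) {M : ℝ} (hM : ∀ᵐ z ∂ν, ‖z‖ ≤ M)
    (i : Fin b) : Integrable (fun ω => Z [] ω i) P := by
  refine Integrable.of_bound (C := M) ?_ ?_
  · exact ((measurable_weight_apply [] i).comp h.measurable_weights).aestronglyMeasurable
  · filter_upwards [h.ae_weight_bound hM] with ω hω using hω _ _

lemma exists_ae_bound (h : IsWeightedRecursiveTree P ν T Z) {M : ℝ} (hM : ∀ᵐ z ∂ν, ‖z‖ ≤ M)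
    (S : Finset (Node b)) : ∃ C : ℝ, ∀ᵐ ω ∂P, |wienerIndex (fun u => Z u ω) S| ≤ C ∧
      |pathLength (fun u => Z u ω) S| ≤ C := by
  obtain ⟨C, hC⟩ := exists_bound (max M 0) (le_max_right _ _) S
  refine ⟨C, ?_⟩
  filter_upwards [h.ae_weight_bound hM] with ω hω
  exact hC _ fun u i => (hω u i).trans (le_max_left _ _)

lemma integrable_wienerIndex (h : IsWeightedRecursiveTree P ν T Z) {M : ℝ}
    (hM : ∀ᵐ z ∂ν, ‖z‖ ≤ M) (S : Finset (Node b)) :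
    Integrable (fun ω => wienerIndex (fun u => Z u ω) S) P := by
  obtain ⟨C, hC⟩ := h.exists_ae_bound hM S
  exact Integrable.of_bound (C := C)
    ((measurable_wienerIndex S).comp h.measurable_weights).aestronglyMeasurable
    (hC.mono fun ω hω => hω.1)

lemma integrable_pathLength (h : IsWeightedRecursiveTree P ν T Z) {M : ℝ}
    (hM : ∀ᵐ z ∂ν, ‖z‖ ≤ M) (S : Finset (Node b)) :
    Integrable (fun ω => pathLength (fun u => Z u ω) S) P := by
  obtain ⟨C, hC⟩ := h.exists_ae_bound hM S
  exact Integrable.of_bound (C := C)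
    ((measurable_pathLength S).comp h.measurable_weights).aestronglyMeasurable
    (hC.mono fun ω hω => hω.2)

lemma meanWiener_eq_treeExp (hb : 2 ≤ b) (h : IsWeightedRecursiveTree P ν T Z) {M : ℝ}
    (hM : ∀ᵐ z ∂ν, ‖z‖ ≤ M) (n : ℕ) : meanWiener P T Z n
      = treeExp n fun S => ∫ ω, wienerIndex (fun u => Z u ω) S ∂P :=
  h.integral_eq_treeExp hb n (F := fun S w => wienerIndex w S) measurable_wienerIndex
    fun S _ => h.integrable_wienerIndex hM S

lemma meanPath_eq_treeExp (hb : 2 ≤ b) (h : IsWeightedRecursiveTree P ν T Z) {M : ℝ}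
    (hM : ∀ᵐ z ∂ν, ‖z‖ ≤ M) (n : ℕ) : meanPath P T Z n
      = treeExp n fun S => ∫ ω, pathLength (fun u => Z u ω) S ∂P :=
  h.integral_eq_treeExp hb n (F := fun S w => pathLength w S) measurable_pathLength
    fun S _ => h.integrable_pathLength hM S

lemma meanWiener_zero (hb : 2 ≤ b) (h : IsWeightedRecursiveTree P ν T Z) {M : ℝ}
    (hM : ∀ᵐ z ∂ν, ‖z‖ ≤ M) : meanWiener P T Z 0 = 0 := by
  rw [h.meanWiener_eq_treeExp hb hM]
  simp [treeExp, wienerIndex]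

lemma meanPath_zero (hb : 2 ≤ b) (h : IsWeightedRecursiveTree P ν T Z) {M : ℝ}
    (hM : ∀ᵐ z ∂ν, ‖z‖ ≤ M) : meanPath P T Z 0 = 0 := by
  rw [h.meanPath_eq_treeExp hb hM]
  simp [treeExp, pathLength]

/-- The mean path length satisfies the recursion obtained by conditioning on the subtree sizes. -/
lemma meanPath_succ (hb : 2 ≤ b) (h : IsWeightedRecursiveTree P ν T Z) {M : ℝ}
    (hM : ∀ᵐ z ∂ν, ‖z‖ ≤ M) (n : ℕ) : meanPath P T Z (n + 1)
      = treeExp (n + 1) fun S => ∑ i, (meanPath P T Z (subtreeSizes S i)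
          + (∫ ω, Z [] ω i ∂P) * (subtreeSizes S i : ℝ)) := by
  -- The factor `1 *` brings the term into the form that `treeExp_subtree` expects.
  have h1 : ∀ S ∈ shapes b (n + 1), ∫ ω, pathLength (fun u => Z u ω) S ∂P
      = ∑ i, (1 * (∫ ω, pathLength (fun u => Z u ω) (sub S i) ∂P)
          + (∫ ω, Z [] ω i ∂P) * (subtreeSizes S i : ℝ)) := by
    intro S hS
    simp only [pathLength_eq (root_mem_of_mem_shapes hS)]
    have hi1 : ∀ i, Integrable
        (fun ω => pathLength (shift (fun u => Z u ω) i) (sub S i)) P := fun i =>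
      (((h.identDistrib_shift i).comp (measurable_pathLength (sub S i))).integrable_iff).2
        (h.integrable_pathLength hM _)
    have hi2 : ∀ i, Integrable (fun ω => Z [] ω i * (subtreeSizes S i : ℝ)) P :=
      fun i => (h.integrable_root hM i).mul_const _
    have hi3 : ∀ i, Integrable (fun ω => pathLength (shift (fun u => Z u ω) i) (sub S i)
        + Z [] ω i * (subtreeSizes S i : ℝ)) P := fun i => (hi1 i).add (hi2 i)
    rw [integral_finsetSum _ fun i _ => hi3 i]
    refine Finset.sum_congr rfl fun i _ => ?_
    rw [integral_add (hi1 i) (hi2 i), integral_mul_const, one_mul,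
      h.integral_shift (measurable_pathLength (sub S i)) i]
  rw [h.meanPath_eq_treeExp hb hM, treeExp_congr h1, treeExp_sum, treeExp_sum]
  refine Finset.sum_congr rfl fun i _ => ?_
  rw [treeExp_add, treeExp_add, treeExp_subtree hb n i (fun _ => 1)
    (fun S => ∫ ω, pathLength (fun u => Z u ω) S ∂P)]
  simp only [one_mul, h.meanPath_eq_treeExp hb hM]

/-- The mean Wiener index satisfies the recursion obtained by conditioning on the subtree
sizes. -/
lemma meanWiener_succ (hb : 2 ≤ b) (h : IsWeightedRecursiveTree P ν T Z) {M : ℝ}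
    (hM : ∀ᵐ z ∂ν, ‖z‖ ≤ M) (n : ℕ) : meanWiener P T Z (n + 1)
      = treeExp (n + 1) fun S => ∑ i, (meanWiener P T Z (subtreeSizes S i)
          + (((n + 1 : ℕ) : ℝ) - subtreeSizes S i) * (meanPath P T Z (subtreeSizes S i)
          + (∫ ω, Z [] ω i ∂P) * (subtreeSizes S i : ℝ))) := by
  have h1 : ∀ S ∈ shapes b (n + 1), ∫ ω, wienerIndex (fun u => Z u ω) S ∂P
      = ∑ i, ((1 * (∫ ω, wienerIndex (fun u => Z u ω) (sub S i) ∂P)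
          + (((n + 1 : ℕ) : ℝ) - subtreeSizes S i) *
            (∫ ω, pathLength (fun u => Z u ω) (sub S i) ∂P))
          + (((n + 1 : ℕ) : ℝ) - subtreeSizes S i) *
            ((∫ ω, Z [] ω i ∂P) * (subtreeSizes S i : ℝ))) := by
    intro S hS
    simp only [wienerIndex_eq (root_mem_of_mem_shapes hS), card_of_mem_shapes hS]
    have hi0 : ∀ i, Integrable
        (fun ω => wienerIndex (shift (fun u => Z u ω) i) (sub S i)) P := fun i =>
      (((h.identDistrib_shift i).comp (measurable_wienerIndex (sub S i))).integrable_iff).2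
        (h.integrable_wienerIndex hM _)
    have hi1 : ∀ i, Integrable
        (fun ω => pathLength (shift (fun u => Z u ω) i) (sub S i)) P := fun i =>
      (((h.identDistrib_shift i).comp (measurable_pathLength (sub S i))).integrable_iff).2
        (h.integrable_pathLength hM _)
    have hi2 : ∀ i, Integrable (fun ω => Z [] ω i * (subtreeSizes S i : ℝ)) P :=
      fun i => (h.integrable_root hM i).mul_const _
    have hi3 : ∀ i, Integrable (fun ω => (((n + 1 : ℕ) : ℝ) - subtreeSizes S i) *
        (pathLength (shift (fun u => Z u ω) i) (sub S i) + Z [] ω i * (subtreeSizes S i : ℝ))) P :=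
      fun i => ((hi1 i).add (hi2 i)).const_mul _
    have hi4 : ∀ i, Integrable (fun ω => wienerIndex (shift (fun u => Z u ω) i) (sub S i)
        + (((n + 1 : ℕ) : ℝ) - subtreeSizes S i) *
        (pathLength (shift (fun u => Z u ω) i) (sub S i) + Z [] ω i * (subtreeSizes S i : ℝ))) P :=
      fun i => (hi0 i).add (hi3 i)
    rw [integral_finsetSum _ fun i _ => hi4 i]
    refine Finset.sum_congr rfl fun i _ => ?_
    rw [integral_add (hi0 i) (hi3 i), integral_const_mul,
      integral_add (hi1 i) (hi2 i), integral_mul_const, one_mul,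
      h.integral_shift (measurable_pathLength (sub S i)) i,
      h.integral_shift (measurable_wienerIndex (sub S i)) i]
    ring
  rw [h.meanWiener_eq_treeExp hb hM, treeExp_congr h1, treeExp_sum, treeExp_sum]
  refine Finset.sum_congr rfl fun i _ => ?_
  rw [treeExp_add, treeExp_add, treeExp_subtree hb n i (fun _ => 1)
    (fun S => ∫ ω, wienerIndex (fun u => Z u ω) S ∂P),
    treeExp_subtree hb n i (fun x => (((n + 1 : ℕ) : ℝ) - x i))
    (fun S => ∫ ω, pathLength (fun u => Z u ω) S ∂P), ← treeExp_add, ← treeExp_add]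
  simp only [one_mul, h.meanPath_eq_treeExp hb hM, h.meanWiener_eq_treeExp hb hM]
  congr 1
  funext S
  ring

/-- The law of the subtree sizes and the weights at the root. -/
lemma map_sizes_root (h : IsWeightedRecursiveTree P ν T Z) (n : ℕ) :
    P.map (fun ω => (subtreeSizes (T n ω), Z [] ω))
      = (P.map fun ω => subtreeSizes (T n ω)).prod ν := by
  have h1 : IndepFun (fun ω => subtreeSizes (T n ω)) (fun ω => Z [] ω) P :=
    (h.indep_tree n).comp (Measurable.of_discrete (f := subtreeSizes)) (measurable_pi_apply [])
  rw [(indepFun_iff_map_prod_eq_prod_map_map (h.measurable_subtreeSizes n).aemeasurable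
    (h.measurable_weight []).aemeasurable).1 h1, h.law_weight]

lemma ae_sizes (hb : 2 ≤ b) (h : IsWeightedRecursiveTree P ν T Z) (n : ℕ) :
    ∀ᵐ ω ∂P, ∑ i, subtreeSizes (T (n + 1) ω) i = n := by
  filter_upwards [h.ae_mem_shapes hb (n + 1)] with ω hω
  have h1 := card_of_mem_shapes hω
  have h2 := card_eq_one_add_sum (root_mem_of_mem_shapes hω)
  omega

/-- Given the sizes, both components of the toll are affine in the weights at the root; this treats
them together. -/
lemma integrable_toll_component (hb : 2 ≤ b) (h : IsWeightedRecursiveTree P ν T Z) {M : ℝ}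
    (hM : ∀ᵐ z ∂ν, ‖z‖ ≤ M) (n : ℕ) (c d : (Fin b → ℕ) → Fin b → ℝ) (e f : ℝ) :
    Integrable (fun ω => (∑ i, (c (subtreeSizes (T n ω)) i
      + d (subtreeSizes (T n ω)) i * Z [] ω i) - e) / f) P ∧
    ∫ ω, (∑ i, (c (subtreeSizes (T n ω)) i + d (subtreeSizes (T n ω)) i * Z [] ω i) - e) / f ∂P
      = (treeExp n (fun S => ∑ i, (c (subtreeSizes S) i
          + d (subtreeSizes S) i * ∫ ω, Z [] ω i ∂P)) - e) / f := by
  have hi : ∀ S ∈ shapes b n, Integrable (fun ω => ∑ i, (c (subtreeSizes S) i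
      + d (subtreeSizes S) i * Z [] ω i)) P := fun S _ =>
    integrable_finsetSum _ fun i _ =>
      (integrable_const _).add ((h.integrable_root hM i).const_mul _)
  have hi' := h.integrable_tree hb n (F := fun S w => ∑ i, (c (subtreeSizes S) i
      + d (subtreeSizes S) i * w [] i)) hi
  refine ⟨(hi'.sub (integrable_const e)).div_const f, ?_⟩
  rw [integral_div, integral_sub hi' (integrable_const e),
    h.integral_eq_treeExp hb n (F := fun S w => ∑ i, (c (subtreeSizes S) i
      + d (subtreeSizes S) i * w [] i)) ?_ hi]
  · simp only [integral_const, probReal_univ, smul_eq_mul, one_mul]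
    congr 3
    funext S
    have hi1 : ∀ i, Integrable (fun ω => c (subtreeSizes S) i
        + d (subtreeSizes S) i * Z [] ω i) P := fun i =>
      (integrable_const _).add ((h.integrable_root hM i).const_mul _)
    rw [integral_finsetSum _ fun i _ => hi1 i]
    refine Finset.sum_congr rfl fun i _ => ?_
    rw [integral_add (integrable_const _) ((h.integrable_root hM i).const_mul _),
      integral_const_mul]
    simp
  · intro S
    have := fun i : Fin b => measurable_weight_apply (b := b) [] i
    fun_prop

/-- That the toll has mean 0 is precisely the content of the recursions `meanWiener_succ` and
`meanPath_succ` for the means. -/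
lemma toll_integrable_and_integral (hb : 2 ≤ b) (h : IsWeightedRecursiveTree P ν T Z) {M : ℝ}
    (hM : ∀ᵐ z ∂ν, ‖z‖ ≤ M) (n : ℕ) :
    Integrable (fun ω => toll (meanWiener P T Z) (meanPath P T Z) (n + 1)
      (subtreeSizes (T (n + 1) ω)) (Z [] ω)) P ∧
    ∫ ω, toll (meanWiener P T Z) (meanPath P T Z) (n + 1)
      (subtreeSizes (T (n + 1) ω)) (Z [] ω) ∂P = 0 := by
  obtain ⟨i1, e1⟩ := h.integrable_toll_component hb hM (n + 1)
    (fun x i => meanWiener P T Z (x i) + (((n + 1 : ℕ) : ℝ) - x i) * meanPath P T Z (x i))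
    (fun x i => (((n + 1 : ℕ) : ℝ) - x i) * x i) (meanWiener P T Z (n + 1))
    (((n + 1 : ℕ) : ℝ) ^ 2)
  obtain ⟨i2, e2⟩ := h.integrable_toll_component hb hM (n + 1)
    (fun x i => meanPath P T Z (x i)) (fun x i => x i) (meanPath P T Z (n + 1)) ((n + 1 : ℕ) : ℝ)
  have hz1 : treeExp (n + 1) (fun S => ∑ i, ((meanWiener P T Z (subtreeSizes S i)
      + (((n + 1 : ℕ) : ℝ) - subtreeSizes S i) * meanPath P T Z (subtreeSizes S i))
      + ((((n + 1 : ℕ) : ℝ) - subtreeSizes S i) * subtreeSizes S i) * ∫ ω, Z [] ω i ∂P))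
      = meanWiener P T Z (n + 1) := by
    rw [h.meanWiener_succ hb hM]
    congr 1
    funext S
    refine Finset.sum_congr rfl fun i _ => ?_
    ring
  have hz2 : treeExp (n + 1) (fun S => ∑ i, (meanPath P T Z (subtreeSizes S i)
      + (subtreeSizes S i : ℝ) * ∫ ω, Z [] ω i ∂P)) = meanPath P T Z (n + 1) := by
    rw [h.meanPath_succ hb hM]
    congr 1
    funext S
    refine Finset.sum_congr rfl fun i _ => ?_
    ring
  rw [hz1, sub_self, zero_div] at e1
  rw [hz2, sub_self, zero_div] at e2
  have heq : ∀ ω, toll (meanWiener P T Z) (meanPath P T Z) (n + 1)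
      (subtreeSizes (T (n + 1) ω)) (Z [] ω)
      = ((∑ i, ((meanWiener P T Z (subtreeSizes (T (n + 1) ω) i)
      + (((n + 1 : ℕ) : ℝ) - subtreeSizes (T (n + 1) ω) i) *
        meanPath P T Z (subtreeSizes (T (n + 1) ω) i))
      + ((((n + 1 : ℕ) : ℝ) - subtreeSizes (T (n + 1) ω) i) * subtreeSizes (T (n + 1) ω) i)
        * Z [] ω i) - meanWiener P T Z (n + 1)) / ((n + 1 : ℕ) : ℝ) ^ 2)
          • EuclideanSpace.single 0 1
        + ((∑ i, (meanPath P T Z (subtreeSizes (T (n + 1) ω) i)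
          + (subtreeSizes (T (n + 1) ω) i : ℝ) * Z [] ω i) - meanPath P T Z (n + 1))
            / ((n + 1 : ℕ) : ℝ)) • EuclideanSpace.single 1 1 := by
    intro ω
    rw [toll, euclidean_two_eq]
    congr 5
    · funext i
      ring
    · funext i
      ring
  simp only [heq]
  refine ⟨(i1.smul_const _).add (i2.smul_const _), ?_⟩
  rw [integral_add (i1.smul_const _) (i2.smul_const _), integral_smul_const, integral_smul_const,
    e1, e2]
  simp

lemma measurable_normVec_comp (h : IsWeightedRecursiveTree P ν T Z) (eW eL : ℕ → ℝ) (n : ℕ) :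
    Measurable fun ω => normVec eW eL n (fun u => Z u ω) (T n ω) := by
  have h1 : Measurable (Function.uncurry fun (S : Finset (Node b))
      (w : Node b → EuclideanSpace ℝ (Fin b)) => normVec eW eL n w S) := by
    refine measurable_from_prod_countable_right fun S => ?_
    simp only [Function.uncurry_apply_pair]
    exact measurable_normVec eW eL n S
  have h2 := h1.comp ((h.measurable_tree n).prodMk h.measurable_weights)
  simpa only [Function.comp_def, Function.uncurry_apply_pair] using h2

theorem solvesSumRecursion (hb : 2 ≤ b) (h : IsWeightedRecursiveTree P ν T Z) {M : ℝ}
    (hM : ∀ᵐ z ∂ν, ‖z‖ ≤ M) (n : ℕ) :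
    SolvesSumRecursion (n + 1) (P.map fun ω => subtreeSizes (T (n + 1) ω)) ν
      (fun m => P.map fun ω => normVec (meanWiener P T Z) (meanPath P T Z) m
        (fun u => Z u ω) (T m ω))
      (coeff (n + 1)) (toll (meanWiener P T Z) (meanPath P T Z) (n + 1)) := by
  have hIm := h.measurable_subtreeSizes (n + 1)
  have hXm := h.measurable_normVec_comp (meanWiener P T Z) (meanPath P T Z)
  have : IsProbabilityMeasure ν := by
    rw [← h.law_weight []]
    exact Measure.isProbabilityMeasure_map (h.measurable_weight []).aemeasurable
  have : IsProbabilityMeasure (P.map fun ω => subtreeSizes (T (n + 1) ω)) :=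
    Measure.isProbabilityMeasure_map hIm.aemeasurable
  have : ∀ m, IsProbabilityMeasure (P.map fun ω => normVec (meanWiener P T Z) (meanPath P T Z) m
      (fun u => Z u ω) (T m ω)) :=
    fun m => Measure.isProbabilityMeasure_map (hXm m).aemeasurable
  have hd := measurable_toll (b := b) (meanWiener P T Z) (meanPath P T Z) (n + 1)
  have hdm := measurable_uncurry_toll hd
  obtain ⟨hti, ht0⟩ := h.toll_integrable_and_integral hb hM n
  have hpair : Measurable fun ω => (subtreeSizes (T (n + 1) ω), Z [] ω) :=
    hIm.prodMk (h.measurable_weight [])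
  refine solvesSumRecursion_of_charFun (n + 1) hd ?_ ?_ ?_ fun s => ?_
  · rw [ae_map_iff hIm.aemeasurable MeasurableSet.of_discrete]
    filter_upwards [h.ae_sizes hb n] with ω hω i
    have := Finset.single_le_sum (f := subtreeSizes (T (n + 1) ω)) (fun _ _ => Nat.zero_le _)
      (Finset.mem_univ i)
    omega
  · rw [← h.map_sizes_root, integrable_map_measure hdm.aestronglyMeasurable hpair.aemeasurable]
    exact hti
  · rw [← h.map_sizes_root, integral_map hpair.aemeasurable hdm.aestronglyMeasurable]
    exact ht0
  · rw [charFun_apply, integral_map (hXm _).aemeasurable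
      (Continuous.aestronglyMeasurable (by fun_prop)),
      integral_map hIm.aemeasurable (Measurable.of_discrete).aestronglyMeasurable]
    have hg : ∀ x : Fin b → ℕ, Measurable fun z => Complex.exp (inner ℝ
        (toll (meanWiener P T Z) (meanPath P T Z) (n + 1) x z) s * Complex.I) := by
      intro x
      have := hd x
      fun_prop
    have hf0 : ∀ (x : Fin b → ℕ) (i : Fin b), Measurable fun y : EuclideanSpace ℝ (Fin 2) =>
        Complex.exp (inner ℝ ((coeff (n + 1) i x).toEuclideanLin y) s * Complex.I) := by
      intro x i
      have := measurable_toEuclideanLin (coeff (n + 1) i x)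
      fun_prop
    have hf : ∀ (x : Fin b → ℕ) (i : Fin b) (t : Finset (Node b)),
        Measurable fun w => Complex.exp (inner ℝ
        ((coeff (n + 1) i x).toEuclideanLin (normVec (meanWiener P T Z) (meanPath P T Z) (x i) w t))
          s * Complex.I) :=
      fun x i t => (hf0 x i).comp (measurable_normVec _ _ _ t)
    have key := h.integral_decomposition hb n hg hf
      (fun x => Integrable.of_bound (C := 1)
        ((hg x).comp (h.measurable_weight [])).aestronglyMeasurable
        (Filter.Eventually.of_forall fun ω => (norm_charFun_integrand _ _).le))
      (fun x i t => Integrable.of_bound (C := 1)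
        ((hf x i t).comp h.measurable_weights).aestronglyMeasurable
        (Filter.Eventually.of_forall fun ω => (norm_charFun_integrand _ _).le))
    -- The pathwise decomposition turns the exponential of the sum into a root factor times one
    -- factor per subtree.
    have hL : ∫ ω, Complex.exp (inner ℝ (normVec (meanWiener P T Z) (meanPath P T Z) (n + 1)
        (fun u => Z u ω) (T (n + 1) ω)) s * Complex.I) ∂P
        = ∫ ω, Complex.exp (inner ℝ (toll (meanWiener P T Z) (meanPath P T Z) (n + 1)
            (subtreeSizes (T (n + 1) ω)) (Z [] ω)) s * Complex.I)
          * ∏ i, Complex.exp (inner ℝ ((coeff (n + 1) i (subtreeSizes (T (n + 1) ω))).toEuclideanLin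
            (normVec (meanWiener P T Z) (meanPath P T Z) (subtreeSizes (T (n + 1) ω) i)
              (shift (fun u => Z u ω) i) (sub (T (n + 1) ω) i))) s * Complex.I) ∂P := by
      refine integral_congr_ae ?_
      filter_upwards [h.ae_mem_shapes hb (n + 1)] with ω hω
      rw [normVec_decomposition (h.meanWiener_zero hb hM) (h.meanPath_zero hb hM) _ hω,
        inner_add_left, sum_inner, ← Complex.exp_sum, ← Complex.exp_add]
      congr 1
      push_cast
      rw [← Finset.sum_mul]
      ring
    rw [hL, key]
    refine integral_congr_ae (Filter.Eventually.of_forall fun ω => ?_)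
    simp only
    congr 1
    · rw [← integral_map (h.measurable_weight []).aemeasurable
        ((hg (subtreeSizes (T (n + 1) ω))).aestronglyMeasurable), h.law_weight]
    · refine Finset.prod_congr rfl fun i _ => ?_
      rw [integral_map (hXm _).aemeasurable (hf0 _ i).aestronglyMeasurable]

end IsWeightedRecursiveTree

end

end BaryTree

namespace BaryTree

set_option linter.unusedSectionVars false

section
variable {b : ℕ}

/-! ### The sizes of the subtrees of the root -/

/-- A Pólya urn: a subtree of size k receives the next node with probability N_k / N_{n+1}. -/
lemma treeExp_size_succ (n : ℕ) (i : Fin b) (φ : ℕ → ℝ) :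
    treeExp (n + 2) (fun S => φ (subtreeSizes S i))
      = treeExp (n + 1) (fun S => φ (subtreeSizes S i + 1) * numExternal b (subtreeSizes S i)
          + φ (subtreeSizes S i) * (numExternal b (n + 1) - numExternal b (subtreeSizes S i)))
        / numExternal b (n + 1) := by
  rw [treeExp_succ]
  simp only [RCLike.ofReal_real_eq_id, id_eq]
  congr 1
  refine treeExp_congr fun S hS => ?_
  have hroot := root_mem_of_mem_shapes hS
  have htree := isTree_of_mem_shapes hS
  have hs : ∀ j, ((external (sub S j)).card : ℝ) = numExternal b (subtreeSizes S j) := by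
    intro j
    rw [(htree.sub j).card_external_cast, card_sub]
  have htot : ∑ j, numExternal b (subtreeSizes S j) = numExternal b (n + 1) := by
    rw [← card_of_mem_shapes hS, ← htree.card_external_cast]
    have := sum_external hroot (fun _ => (1 : ℝ))
    simp only [Finset.sum_const, nsmul_eq_mul, mul_one] at this
    rw [this]
    exact Finset.sum_congr rfl fun j _ => (hs j).symm
  have hterm : ∀ j, ∑ v ∈ external (sub S j), φ (subtreeSizes (insert (j :: v) S) i)
      = numExternal b (subtreeSizes S j) * (if j = i then φ (subtreeSizes S i + 1)
          else φ (subtreeSizes S i)) := by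
    intro j
    rw [← hs, ← nsmul_eq_mul]
    refine Finset.sum_eq_card_nsmul fun v hv => ?_
    rw [← card_sub, sub_insert]
    split_ifs with hj
    · subst hj
      rw [Function.update_self, Finset.card_insert_of_notMem (mem_external.1 hv).2, card_sub]
    · rw [Function.update_of_ne (Ne.symm hj), card_sub]
  rw [sum_external hroot, Finset.sum_congr rfl fun j _ => hterm j, ← htot,
    ← Finset.add_sum_erase _ _ (Finset.mem_univ i), if_pos rfl,
    ← Finset.add_sum_erase Finset.univ (fun j => numExternal b (subtreeSizes S j))
      (Finset.mem_univ i),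
    Finset.sum_congr rfl (g := fun j => numExternal b (subtreeSizes S j) * φ (subtreeSizes S i))
      (fun j hj => by rw [if_neg (Finset.ne_of_mem_erase hj)]), ← Finset.sum_mul]
  ring

/-! ### The distribution of a single subtree size -/

/-- The probability that the `i`-th subtree of the random tree of size `n` has size `k`. -/
noncomputable def sizeProb (n : ℕ) (i : Fin b) (k : ℕ) : ℝ :=
  treeExp n fun S => if subtreeSizes S i = k then 1 else 0

lemma sizeProb_nonneg (hb : 2 ≤ b) (n : ℕ) (i : Fin b) (k : ℕ) : 0 ≤ sizeProb n i k := by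
  rw [← treeExp_const (𝕜 := ℝ) hb n 0]
  refine treeExp_mono fun S _ => ?_
  split_ifs <;> norm_num

lemma numExternal_mono (hb : 2 ≤ b) {k n : ℕ} (h : k ≤ n) : numExternal b k ≤ numExternal b n := by
  have h2 : (2 : ℝ) ≤ b := by exact_mod_cast hb
  have h3 : (k : ℝ) ≤ n := by exact_mod_cast h
  unfold numExternal
  nlinarith

/-- The urn recursion gives N_{n+1} p_{n+2}(k) = N_{k-1} p_{n+1}(k-1) + (N_{n+1} - N_k) p_{n+1}(k).
After multiplication by N_k the induction hypothesis bounds the right-hand side by N_k + (N_{n+1} -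
N_k), so the bound 1 reproduces itself. -/
theorem numExternal_mul_sizeProb_le (hb : 2 ≤ b) (n : ℕ) (i : Fin b) {k : ℕ} (hk : k ≤ n) :
    numExternal b k * sizeProb (n + 1) i k ≤ 1 := by
  induction n generalizing k with
  | zero =>
    obtain rfl : k = 0 := by omega
    have : sizeProb (0 + 1) i 0 ≤ 1 := by
      rw [← treeExp_const (𝕜 := ℝ) hb 1 1]
      refine treeExp_mono fun S _ => ?_
      split_ifs <;> norm_num
    simpa [numExternal] using this
  | succ n ih =>
    have hpos := numExternal_pos hb (n + 1)
    -- Size 0 has no predecessor; the case distinction prevents truncated subtraction from creating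
    -- one.
    have hrec : sizeProb (n + 2) i k
        = ((if k = 0 then 0 else numExternal b (k - 1) * sizeProb (n + 1) i (k - 1))
          + (numExternal b (n + 1) - numExternal b k) * sizeProb (n + 1) i k)
          / numExternal b (n + 1) := by
      rw [sizeProb, treeExp_size_succ n i (fun m => if m = k then 1 else 0)]
      congr 1
      rw [treeExp_add]
      congr 1
      · split_ifs with h0
        · subst h0
          simp [treeExp_const hb]
        · rw [sizeProb, ← treeExp_const_mul]
          congr 1
          funext S
          by_cases h : subtreeSizes S i = k - 1
          · rw [if_pos (by omega), if_pos h, h]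
            ring
          · rw [if_neg (by omega), if_neg h]
            ring
      · rw [sizeProb, ← treeExp_const_mul]
        congr 1
        funext S
        split_ifs with h
        · rw [h]
          ring
        · ring
    have h1 : (if k = 0 then 0 else numExternal b (k - 1) * sizeProb (n + 1) i (k - 1)) ≤ 1 := by
      split_ifs
      · exact zero_le_one
      · exact ih (by omega)
    have h2 : numExternal b k * ((numExternal b (n + 1) - numExternal b k) * sizeProb (n + 1) i k)
        ≤ numExternal b (n + 1) - numExternal b k := by
      -- The value k = n + 1 lies outside the induction hypothesis, but there the factor N_{n+1} -
      -- N_k is zero.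
      rcases Nat.lt_or_ge n k with h | h
      · obtain rfl : k = n + 1 := by omega
        simp
      · have h3 := numExternal_mono hb hk
        calc _ = (numExternal b (n + 1) - numExternal b k)
              * (numExternal b k * sizeProb (n + 1) i k) := by ring
          _ ≤ (numExternal b (n + 1) - numExternal b k) * 1 :=
              mul_le_mul_of_nonneg_left (ih h) (by linarith)
          _ = _ := mul_one _
    have hk0 := numExternal_pos hb k
    rw [hrec, ← mul_div_assoc, div_le_one hpos, mul_add]
    have := mul_le_mul_of_nonneg_left h1 hk0.le
    linarith

lemma sizeProb_le (hb : 2 ≤ b) (n : ℕ) (i : Fin b) {k : ℕ} (hk : k ≤ n) :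
    sizeProb (n + 1) i k ≤ 1 / ((k : ℝ) + 1) := by
  rw [le_div_iff₀ (by positivity), mul_comm]
  exact (mul_le_mul_of_nonneg_right (add_one_le_numExternal hb k)
    (sizeProb_nonneg hb _ i k)).trans (numExternal_mul_sizeProb_le hb n i hk)

lemma sizes_sum_of_mem_shapes {n : ℕ} {S : Finset (Node b)} (hS : S ∈ shapes b (n + 1)) :
    ∑ i, subtreeSizes S i = n := by
  have h1 := card_of_mem_shapes hS
  have h2 := card_eq_one_add_sum (root_mem_of_mem_shapes hS)
  omega

lemma size_le_of_mem_shapes {n : ℕ} {S : Finset (Node b)} (hS : S ∈ shapes b (n + 1)) (i : Fin b) :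
    subtreeSizes S i ≤ n := by
  rw [← sizes_sum_of_mem_shapes hS]
  exact Finset.single_le_sum (f := subtreeSizes S) (fun _ _ => Nat.zero_le _) (Finset.mem_univ i)

lemma treeExp_size_eq_sum (n : ℕ) (i : Fin b) (φ : ℕ → ℝ) :
    treeExp (n + 1) (fun S => φ (subtreeSizes S i))
      = ∑ k ∈ Finset.range (n + 1), φ k * sizeProb (n + 1) i k := by
  simp only [sizeProb, ← treeExp_const_mul]
  rw [← treeExp_sum]
  refine treeExp_congr fun S hS => ?_
  simp [size_le_of_mem_shapes hS i]

/-! ### The size defect -/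

/-- The amount by which the sum of the squares of the relative subtree sizes is smaller than
`1`. -/
noncomputable def sizeDefect (n : ℕ) (x : Fin b → ℕ) : ℝ := 1 - ∑ i, ((x i : ℝ) / n) ^ 2

/-- Since h ≤ e^h - 1, each term times h is at most a difference of consecutive exponentials, and
the differences telescope. -/
lemma sum_exp_le (N : ℕ) {h : ℝ} (hh : 0 < h) :
    ∑ k ∈ Finset.range N, Real.exp (-(h * ((N : ℝ) - k))) ≤ 1 / h := by
  rw [le_div_iff₀ hh, Finset.sum_mul]
  have h1 : ∀ k ∈ Finset.range N, Real.exp (-(h * ((N : ℝ) - k))) * h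
      ≤ Real.exp (-(h * ((N : ℝ) - (k + 1 : ℕ)))) - Real.exp (-(h * ((N : ℝ) - k))) := by
    intro k _
    have e1 : Real.exp (-(h * ((N : ℝ) - (k + 1 : ℕ))))
        = Real.exp (-(h * ((N : ℝ) - k))) * Real.exp h := by
      rw [← Real.exp_add]
      congr 1
      push_cast
      ring
    rw [e1]
    nlinarith [Real.add_one_le_exp h, Real.exp_pos (-(h * ((N : ℝ) - k)))]
  refine (Finset.sum_le_sum h1).trans ?_
  rw [Finset.sum_range_sub (fun k : ℕ => Real.exp (-(h * ((N : ℝ) - k))))]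
  simp [Real.exp_nonneg]

/-- The relative sizes v_j sum to at most 1, so ∑ v_j² ≤ max v_j and the defect is at least 1 - max
v_j. A maximum below 1/2 gives the first term; otherwise the largest subtree is one of those in the
sum. -/
lemma exp_neg_sizeDefect_le (hb : 2 ≤ b) {n : ℕ} {x : Fin b → ℕ} (hx : ∑ i, x i = n) {κ : ℝ}
    (hκ : 0 ≤ κ) : Real.exp (-(κ * sizeDefect (n + 1) x)) ≤ Real.exp (-(κ / 2))
      + ∑ i, (if n + 1 ≤ 2 * x i then
          Real.exp (-(κ / ((n + 1 : ℕ) : ℝ) * (((n + 1 : ℕ) : ℝ) - x i))) else 0) := by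
  have hN : (0 : ℝ) < ((n + 1 : ℕ) : ℝ) := by positivity
  obtain ⟨i, -, hi⟩ := Finset.exists_max_image Finset.univ x ⟨⟨0, by omega⟩, Finset.mem_univ _⟩
  have hsum : ∑ j, (x j : ℝ) / ((n + 1 : ℕ) : ℝ) ≤ 1 := by
    rw [← Finset.sum_div, div_le_one hN]
    exact_mod_cast (by omega : ∑ j, x j ≤ n + 1)
  have hd : 1 - (x i : ℝ) / ((n + 1 : ℕ) : ℝ) ≤ sizeDefect (n + 1) x := by
    unfold sizeDefect
    have : ∑ j, ((x j : ℝ) / ((n + 1 : ℕ) : ℝ)) ^ 2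
        ≤ ∑ j, (x i : ℝ) / ((n + 1 : ℕ) : ℝ) * ((x j : ℝ) / ((n + 1 : ℕ) : ℝ)) := by
      refine Finset.sum_le_sum fun j _ => ?_
      rw [sq]
      gcongr
      exact hi j (Finset.mem_univ j)
    rw [← Finset.mul_sum] at this
    have h2 : (x i : ℝ) / ((n + 1 : ℕ) : ℝ) * ∑ j, (x j : ℝ) / ((n + 1 : ℕ) : ℝ)
        ≤ (x i : ℝ) / ((n + 1 : ℕ) : ℝ) * 1 := mul_le_mul_of_nonneg_left hsum (by positivity)
    linarith
  have hexp : Real.exp (-(κ * sizeDefect (n + 1) x))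
      ≤ Real.exp (-(κ * (1 - (x i : ℝ) / ((n + 1 : ℕ) : ℝ)))) := by
    gcongr
  have hnn : ∀ j, 0 ≤ (if n + 1 ≤ 2 * x j then
      Real.exp (-(κ / ((n + 1 : ℕ) : ℝ) * (((n + 1 : ℕ) : ℝ) - x j))) else 0) := by
    intro j
    split_ifs
    · exact Real.exp_nonneg _
    · exact le_rfl
  refine hexp.trans ?_
  by_cases h : n + 1 ≤ 2 * x i
  · have h1 := Finset.single_le_sum (fun j _ => hnn j) (Finset.mem_univ i)
    rw [if_pos h] at h1
    have h2 : κ * (1 - (x i : ℝ) / ((n + 1 : ℕ) : ℝ))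
        = κ / ((n + 1 : ℕ) : ℝ) * (((n + 1 : ℕ) : ℝ) - x i) := by
      field_simp
    rw [h2]
    linarith [Real.exp_nonneg (-(κ / 2))]
  · have h1 : (x i : ℝ) / ((n + 1 : ℕ) : ℝ) ≤ 1 / 2 := by
      rw [div_le_div_iff₀ hN two_pos, mul_comm]
      exact_mod_cast (by omega : 2 * x i ≤ 1 * (n + 1))
    have h2 : Real.exp (-(κ * (1 - (x i : ℝ) / ((n + 1 : ℕ) : ℝ)))) ≤ Real.exp (-(κ / 2)) := by
      rw [Real.exp_le_exp]
      nlinarith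
    linarith [Finset.sum_nonneg fun j (_ : j ∈ Finset.univ) => hnn j]

/-- The Laplace transform of the size defect decays like `1 / κ`, uniformly in the size of the
tree. -/
theorem treeExp_exp_neg_sizeDefect_le (hb : 2 ≤ b) (n : ℕ) {κ : ℝ} (hκ : 0 < κ) :
    treeExp (n + 1) (fun S : Finset (Node b) => Real.exp (-(κ * sizeDefect (n + 1) (subtreeSizes S))))
      ≤ (2 * b + 2) / κ := by
  have hN : (0 : ℝ) < ((n + 1 : ℕ) : ℝ) := by positivity
  have h1 := treeExp_mono fun S (hS : S ∈ shapes b (n + 1)) =>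
    exp_neg_sizeDefect_le hb (sizes_sum_of_mem_shapes hS) hκ.le
  refine h1.trans ?_
  rw [treeExp_add, treeExp_const hb, treeExp_sum]
  have h2 : ∀ i : Fin b, treeExp (n + 1) (fun S : Finset (Node b) => if n + 1 ≤ 2 * subtreeSizes S i then
      Real.exp (-(κ / ((n + 1 : ℕ) : ℝ) * (((n + 1 : ℕ) : ℝ) - subtreeSizes S i))) else 0)
      ≤ 2 / κ := by
    intro i
    rw [treeExp_size_eq_sum n i (fun k => if n + 1 ≤ 2 * k then
      Real.exp (-(κ / ((n + 1 : ℕ) : ℝ) * (((n + 1 : ℕ) : ℝ) - k))) else 0)]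
    -- Only sizes k ≥ (n + 1)/2 count, and these have probability at most 1/(k + 1) ≤ 2/(n + 1).
    have h3 : ∀ k ∈ Finset.range (n + 1), (if n + 1 ≤ 2 * k then
        Real.exp (-(κ / ((n + 1 : ℕ) : ℝ) * (((n + 1 : ℕ) : ℝ) - k))) else 0) * sizeProb (n + 1) i k
        ≤ Real.exp (-(κ / ((n + 1 : ℕ) : ℝ) * (((n + 1 : ℕ) : ℝ) - k))) *
          (2 / ((n + 1 : ℕ) : ℝ)) := by
      intro k hk
      rw [Finset.mem_range] at hk
      split_ifs with h
      · refine mul_le_mul_of_nonneg_left ?_ (Real.exp_nonneg _)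
        refine (sizeProb_le hb n i (by omega)).trans ?_
        rw [div_le_div_iff₀ (by positivity) hN]
        exact_mod_cast (by omega : 1 * (n + 1) ≤ 2 * (k + 1))
      · rw [zero_mul]
        positivity
    refine (Finset.sum_le_sum h3).trans ?_
    rw [← Finset.sum_mul]
    have h4 := sum_exp_le (n + 1) (h := κ / ((n + 1 : ℕ) : ℝ)) (by positivity)
    calc _ ≤ 1 / (κ / ((n + 1 : ℕ) : ℝ)) * (2 / ((n + 1 : ℕ) : ℝ)) :=
          mul_le_mul_of_nonneg_right h4 (by positivity)
      _ = 2 / κ := by field_simp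
  have h5 : Real.exp (-(κ / 2)) ≤ 2 / κ := by
    rw [Real.exp_neg, ← inv_div κ 2]
    gcongr
    linarith [Real.add_one_le_exp (κ / 2)]
  have h6 : ∑ i : Fin b, treeExp (n + 1) (fun S : Finset (Node b) => if n + 1 ≤ 2 * subtreeSizes S i then
      Real.exp (-(κ / ((n + 1 : ℕ) : ℝ) * (((n + 1 : ℕ) : ℝ) - subtreeSizes S i))) else 0)
      ≤ b * (2 / κ) := by
    refine (Finset.sum_le_sum fun i _ => h2 i).trans ?_
    simp
  calc _ ≤ 2 / κ + b * (2 / κ) := add_le_add h5 h6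
    _ = (2 * b + 2) / κ := by ring

/-- Take means in 1 - κ U ≤ e^{-κ U} with κ = 2c, c = 2b + 2: the right-hand side is at most c/κ =
1/2, so the mean of U is at least 1/(4c). -/
theorem le_treeExp_sizeDefect (hb : 2 ≤ b) (n : ℕ) :
    1 / (4 * (2 * (b : ℝ) + 2))
      ≤ treeExp (n + 1) (fun S : Finset (Node b) => sizeDefect (n + 1) (subtreeSizes S)) := by
  set c : ℝ := 2 * (b : ℝ) + 2 with hc
  have hc0 : 0 < c := by positivity
  have h1 := treeExp_exp_neg_sizeDefect_le hb n (κ := 2 * c) (by positivity)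
  have h2 : treeExp (n + 1) (fun S : Finset (Node b) => 1 - 2 * c * sizeDefect (n + 1) (subtreeSizes S))
      ≤ treeExp (n + 1) (fun S : Finset (Node b) =>
        Real.exp (-(2 * c * sizeDefect (n + 1) (subtreeSizes S)))) := by
    refine treeExp_mono fun S _ => ?_
    linarith [Real.add_one_le_exp (-(2 * c * sizeDefect (n + 1) (subtreeSizes S)))]
  rw [treeExp_sub, treeExp_const hb, treeExp_const_mul] at h2
  have h3 : c / (2 * c) = 1 / 2 := by field_simp
  rw [h3] at h1
  rw [div_le_iff₀ (by positivity)]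
  linarith

/-! ### The sums of the reciprocals of the numbers of external nodes -/

/-- The sum of the reciprocals of the numbers of external nodes of the trees of sizes `1` to
`n`. -/
noncomputable def recipSum (b : ℕ) (n : ℕ) : ℝ := ∑ j ∈ Finset.range n, 1 / numExternal b (j + 1)

lemma recipSum_succ (n : ℕ) : recipSum b (n + 1) = recipSum b n + 1 / numExternal b (n + 1) := by
  rw [recipSum, Finset.sum_range_succ, recipSum]

lemma recip_le (hb : 2 ≤ b) (n : ℕ) : 1 / numExternal b n ≤ 1 / ((n : ℝ) + 1) :=
  one_div_le_one_div_of_le (by positivity) (add_one_le_numExternal hb n)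

lemma recipSum_mono (hb : 2 ≤ b) : Monotone (recipSum b) :=
  monotone_nat_of_le_succ fun n => by
    rw [recipSum_succ]
    linarith [one_div_pos.2 (numExternal_pos hb (n + 1))]

lemma recipSum_sub_le (hb : 2 ≤ b) {x n : ℕ} (h : x ≤ n) :
    recipSum b n - recipSum b x ≤ ((n : ℝ) - x) / ((x : ℝ) + 1) := by
  induction n, h using Nat.le_induction with
  | base => simp
  | succ n h ih =>
    rw [recipSum_succ]
    have h1 := recip_le hb (n + 1)
    have h2 : (1 : ℝ) / (((n + 1 : ℕ) : ℝ) + 1) ≤ 1 / ((x : ℝ) + 1) := by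
      refine one_div_le_one_div_of_le (by positivity) ?_
      exact_mod_cast (by omega : x + 1 ≤ n + 1 + 1)
    have h3 : (((n + 1 : ℕ) : ℝ) - x) / ((x : ℝ) + 1)
        = ((n : ℝ) - x) / ((x : ℝ) + 1) + 1 / ((x : ℝ) + 1) := by
      push_cast
      ring
    rw [h3]
    linarith

lemma recipSum_nonneg (hb : 2 ≤ b) (n : ℕ) : 0 ≤ recipSum b n := by
  simpa [recipSum] using recipSum_mono hb (Nat.zero_le n)

lemma recipSum_le (hb : 2 ≤ b) (n : ℕ) : recipSum b n ≤ n := by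
  simpa [recipSum] using recipSum_sub_le hb (Nat.zero_le n)

/-- The function `n ↦ n * recipSum b n` is almost additive over the subtrees of the root. -/
lemma recipSum_almost_additive (hb : 2 ≤ b) {n : ℕ} {x : Fin b → ℕ} (hx : ∑ i, x i = n) :
    |∑ i, (x i : ℝ) * recipSum b (x i) - ((n + 1 : ℕ) : ℝ) * recipSum b (n + 1)|
      ≤ ((b : ℝ) + 1) * ((n + 1 : ℕ) : ℝ) := by
  have hle : ∀ i, x i ≤ n + 1 := by
    intro i
    have := Finset.single_le_sum (f := x) (fun _ _ => Nat.zero_le _) (Finset.mem_univ i)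
    omega
  have hxr : ((n + 1 : ℕ) : ℝ) = 1 + ∑ i, (x i : ℝ) := by
    rw [← hx]
    push_cast
    ring
  -- Here n + 1 is written as 1 + ∑ x_i, the 1 standing for the root.
  have heq : ((n + 1 : ℕ) : ℝ) * recipSum b (n + 1) - ∑ i, (x i : ℝ) * recipSum b (x i)
      = recipSum b (n + 1) + ∑ i, (x i : ℝ) * (recipSum b (n + 1) - recipSum b (x i)) := by
    simp only [mul_sub, Finset.sum_sub_distrib, ← Finset.sum_mul]
    nth_rewrite 1 [hxr]
    ring
  have h1 : ∀ i, 0 ≤ (x i : ℝ) * (recipSum b (n + 1) - recipSum b (x i)) := fun i =>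
    mul_nonneg (by positivity) (sub_nonneg.2 (recipSum_mono hb (hle i)))
  -- Crude but sufficient: x (H_{n+1} - H_x) ≤ x (n + 1 - x)/(x + 1) ≤ n + 1.
  have h2 : ∀ i ∈ Finset.univ, (x i : ℝ) * (recipSum b (n + 1) - recipSum b (x i))
      ≤ ((n + 1 : ℕ) : ℝ) := by
    intro i _
    have h3 := recipSum_sub_le hb (hle i)
    have h4 : (x i : ℝ) ≤ ((n + 1 : ℕ) : ℝ) := by exact_mod_cast hle i
    have h5 : (0 : ℝ) ≤ x i := by positivity
    rw [le_div_iff₀ (by positivity)] at h3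
    have h6 := sub_nonneg.2 (recipSum_mono hb (hle i))
    nlinarith
  have h3 := Finset.sum_le_card_nsmul _ _ _ h2
  simp only [Finset.card_univ, Fintype.card_fin, nsmul_eq_mul] at h3
  have h4 := recipSum_le hb (n + 1)
  rw [abs_sub_comm, heq, abs_of_nonneg (add_nonneg (recipSum_nonneg hb _)
    (Finset.sum_nonneg fun i _ => h1 i))]
  linarith

end

end BaryTree

namespace BaryTree

set_option linter.unusedSectionVars false

section
variable {b : ℕ}

/-! ### Sums over the external nodes -/

/-- The inserted node stops being external and its b children, none of them internal, become so. -/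
lemma IsTree.sum_external_insert {S : Finset (Node b)} (hS : IsTree S) {u : Node b}
    (hu : u ∈ external S) (g : Node b → ℝ) :
    ∑ v ∈ external (Insert.insert u S), g v
      = ∑ v ∈ external S, g v - g u + ∑ i, g (u ++ [i]) := by
  have huS : u ∉ S := (mem_external.1 hu).2
  have hchild : ∀ i, u ++ [i] ∉ S := fun i h => huS (hS u i h)
  have heq : external (Insert.insert u S) = (external S).erase u ∪
      Finset.univ.image fun i : Fin b => u ++ [i] := by
    ext v
    simp only [mem_external, Finset.mem_union, Finset.mem_erase, Finset.mem_insert,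
      Finset.mem_image, Finset.mem_univ, true_and]
    constructor
    · rintro ⟨h | ⟨w, rfl | hw, i, rfl⟩, hv⟩
      · left
        refine ⟨fun h' => hv (Or.inl h'), Or.inl h, fun h' => hv (Or.inr h')⟩
      · exact Or.inr ⟨i, rfl⟩
      · left
        refine ⟨fun h' => hv (Or.inl h'), Or.inr ⟨w, hw, i, rfl⟩, fun h' => hv (Or.inr h')⟩
    · rintro (⟨hne, h, hv⟩ | ⟨i, rfl⟩)
      · refine ⟨h.imp_right ?_, by tauto⟩
        rintro ⟨w, hw, i, rfl⟩
        exact ⟨w, Or.inr hw, i, rfl⟩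
      · refine ⟨Or.inr ⟨u, Or.inl rfl, i, rfl⟩, ?_⟩
        rintro (h | h)
        · simp at h
        · exact hchild i h
  rw [heq, Finset.sum_union, Finset.sum_image, Finset.sum_erase_eq_sub hu]
  · intro i _ j _ h
    simpa using h
  · rw [Finset.disjoint_left]
    intro v hv hv'
    obtain ⟨i, -, rfl⟩ := Finset.mem_image.1 hv'
    rw [Finset.mem_erase, mem_external] at hv
    obtain ⟨-, h | ⟨w, hw, j, h⟩, -⟩ := hv
    · simp at h
    · rw [(List.append_inj' h rfl).1] at hw
      exact huS hw

/-- The expected sum over the external nodes of an additive function `g` on the nodes. -/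
lemma treeExp_sum_external (hb : 2 ≤ b) {g : Node b → ℝ} {m : Fin b → ℝ} (h0 : g [] = 0)
    (hg : ∀ u i, g (u ++ [i]) = g u + m i) (n : ℕ) :
    treeExp n (fun S => ∑ v ∈ external S, g v)
      = numExternal b n * ((∑ i, m i) * recipSum b n) := by
  induction n with
  | zero =>
    have : external (∅ : Finset (Node b)) = {[]} := by
      ext v
      simp [mem_external]
    simp [treeExp, this, h0, recipSum]
  | succ n ih =>
    rw [treeExp_succ]
    -- Summed over u, the old external sum occurs N_n times, is lost once and returns b times
    -- through the children; N_n - 1 + b = N_{n+1}.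
    have h1 : ∀ S ∈ shapes b n, ∑ u ∈ external S, ∑ v ∈ external (Insert.insert u S), g v
        = numExternal b (n + 1) * ∑ v ∈ external S, g v + numExternal b n * ∑ i, m i := by
      intro S hS
      have hS' := isTree_of_mem_shapes hS
      rw [Finset.sum_congr rfl fun u hu => hS'.sum_external_insert hu g]
      simp only [hg, Finset.sum_add_distrib, Finset.sum_sub_distrib, Finset.sum_const,
        nsmul_eq_mul, Finset.card_univ, Fintype.card_fin, ← Finset.mul_sum]
      rw [hS'.card_external_cast, card_of_mem_shapes hS]
      simp only [numExternal]
      push_cast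
      ring
    have h2 := (numExternal_pos hb n).ne'
    have h3 := (numExternal_pos hb (n + 1)).ne'
    rw [treeExp_congr h1, treeExp_add, treeExp_const_mul, treeExp_const hb, ih, recipSum_succ]
    simp only [RCLike.ofReal_real_eq_id, id_eq]
    field_simp

/-- The expected sum over the internal nodes of an additive function `g` on the nodes. -/
lemma treeExp_sum_internal (hb : 2 ≤ b) {g : Node b → ℝ} {m : Fin b → ℝ} (h0 : g [] = 0)
    (hg : ∀ u i, g (u ++ [i]) = g u + m i) (n : ℕ) :
    treeExp n (fun S => ∑ v ∈ S, g v) = (∑ i, m i) * ∑ k ∈ Finset.range n, recipSum b k := by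
  induction n with
  | zero => simp [treeExp]
  | succ n ih =>
    rw [treeExp_succ]
    have h1 : ∀ S ∈ shapes b n, ∑ u ∈ external S, ∑ v ∈ Insert.insert u S, g v
        = numExternal b n * ∑ v ∈ S, g v + ∑ u ∈ external S, g u := by
      intro S hS
      rw [Finset.sum_congr rfl fun u hu => Finset.sum_insert (mem_external.1 hu).2,
        Finset.sum_add_distrib, Finset.sum_const, nsmul_eq_mul,
        (isTree_of_mem_shapes hS).card_external_cast, card_of_mem_shapes hS]
      ring
    have h2 := (numExternal_pos hb n).ne'
    rw [treeExp_congr h1, treeExp_add, treeExp_const_mul, ih, treeExp_sum_external hb h0 hg,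
      Finset.sum_range_succ]
    simp only [RCLike.ofReal_real_eq_id, id_eq]
    field_simp

/-- The difference n H_n - ∑_{k<n} H_k grows in each step by (n + 1)/N_{n+1}, which lies between 0
and 1. -/
lemma abs_sum_recipSum_sub_le (hb : 2 ≤ b) (n : ℕ) :
    |∑ k ∈ Finset.range n, recipSum b k - n * recipSum b n| ≤ n := by
  have h : 0 ≤ n * recipSum b n - ∑ k ∈ Finset.range n, recipSum b k ∧
      n * recipSum b n - ∑ k ∈ Finset.range n, recipSum b k ≤ n := by
    induction n with
    | zero => simp
    | succ n ih =>
      have h1 : ((n + 1 : ℕ) : ℝ) * recipSum b (n + 1) - ∑ k ∈ Finset.range (n + 1), recipSum b k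
          = n * recipSum b n - ∑ k ∈ Finset.range n, recipSum b k
            + ((n : ℝ) + 1) * (1 / numExternal b (n + 1)) := by
        rw [recipSum_succ, Finset.sum_range_succ]
        push_cast
        ring
      have h2 := numExternal_pos hb (n + 1)
      have h3 : ((n : ℝ) + 1) * (1 / numExternal b (n + 1)) ≤ 1 := by
        rw [mul_one_div, div_le_one h2]
        have := add_one_le_numExternal hb (n + 1)
        push_cast at this
        linarith
      have h4 : 0 ≤ ((n : ℝ) + 1) * (1 / numExternal b (n + 1)) := by positivity
      rw [h1]
      push_cast
      constructor <;> linarith [ih.1, ih.2]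
  rw [abs_sub_comm, abs_of_nonneg h.1]
  exact h.2

/-! ### Bounds for the toll vector -/

/-- The toll of the Wiener index after subtracting the main terms of the means. -/
lemma abs_wiener_toll_le (hb : 2 ≤ b) {c M : ℝ} {p : ℕ → ℝ} (hM : 0 ≤ M)
    (hp : ∀ k, |p k - c * (k * recipSum b k)| ≤ |c| * k) {n : ℕ} {x : Fin b → ℕ}
    (hx : ∑ i, x i = n) {z : Fin b → ℝ} (hz : ∀ i, |z i| ≤ M) :
    |∑ i, (c * ((x i : ℝ) ^ 2 * recipSum b (x i)) + (((n + 1 : ℕ) : ℝ) - x i) * (p (x i) + z i * x i))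
      - c * (((n + 1 : ℕ) : ℝ) ^ 2 * recipSum b (n + 1))|
      ≤ (|c| * ((b : ℝ) + 2) + M) * ((n + 1 : ℕ) : ℝ) ^ 2 := by
  set N : ℝ := ((n + 1 : ℕ) : ℝ) with hN
  have hN0 : 0 ≤ N := by positivity
  have hle : ∀ i, (x i : ℝ) ≤ N := by
    intro i
    have := Finset.single_le_sum (f := x) (fun _ _ => Nat.zero_le _) (Finset.mem_univ i)
    rw [hN]
    exact_mod_cast (by omega : x i ≤ n + 1)
  have hsum : ∑ i, (x i : ℝ) ≤ N := by
    rw [hN]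
    exact_mod_cast (by omega : ∑ i, x i ≤ n + 1)
  -- The cancellation behind the bounded toll: c x² H_x + (N - x) c x H_x = c N x H_x, so the
  -- quadratic main terms reduce to N times the almost additive function.
  have h1 : ∑ i, (c * ((x i : ℝ) ^ 2 * recipSum b (x i)) + (N - x i) * (p (x i) + z i * x i))
      - c * (N ^ 2 * recipSum b (n + 1))
      = c * N * (∑ i, (x i : ℝ) * recipSum b (x i) - N * recipSum b (n + 1))
        + ∑ i, (N - x i) * ((p (x i) - c * (x i * recipSum b (x i))) + z i * x i) := by
    rw [mul_sub, Finset.mul_sum, sub_add_eq_add_sub, ← Finset.sum_add_distrib]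
    congr 1
    · refine Finset.sum_congr rfl fun i _ => ?_
      ring
    · ring
  have h2 := recipSum_almost_additive hb hx
  rw [← hN] at h2
  have h3 : |∑ i, (N - x i) * ((p (x i) - c * (x i * recipSum b (x i))) + z i * x i)|
      ≤ N * (|c| + M) * N := by
    refine (Finset.abs_sum_le_sum_abs _ _).trans ?_
    have : ∀ i ∈ Finset.univ, |(N - x i) * ((p (x i) - c * (x i * recipSum b (x i))) + z i * x i)|
        ≤ N * (|c| + M) * x i := by
      intro i _
      have hx0 : (0 : ℝ) ≤ x i := by positivity
      have e1 : |N - x i| ≤ N := by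
        rw [abs_of_nonneg (by linarith [hle i])]
        linarith
      have e2 : |(p (x i) - c * (x i * recipSum b (x i))) + z i * x i| ≤ (|c| + M) * x i := by
        refine (abs_add_le _ _).trans ?_
        rw [abs_mul, abs_of_nonneg hx0, add_mul]
        exact add_le_add (hp _) (mul_le_mul_of_nonneg_right (hz i) hx0)
      rw [abs_mul, mul_assoc]
      exact mul_le_mul e1 e2 (abs_nonneg _) hN0
    refine (Finset.sum_le_sum this).trans ?_
    rw [← Finset.mul_sum]
    exact mul_le_mul_of_nonneg_left hsum (by positivity)
  have h4 : |c * N * (∑ i, (x i : ℝ) * recipSum b (x i) - N * recipSum b (n + 1))|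
      ≤ |c| * N * (((b : ℝ) + 1) * N) := by
    rw [abs_mul, abs_mul, abs_of_nonneg hN0]
    exact mul_le_mul_of_nonneg_left h2 (by positivity)
  rw [h1]
  refine (abs_add_le _ _).trans ((add_le_add h4 h3).trans (le_of_eq ?_))
  ring

/-- The toll of the path length is bounded by a multiple of the size. -/
lemma abs_path_toll_le (hb : 2 ≤ b) {c M : ℝ} {p : ℕ → ℝ} (hM : 0 ≤ M)
    (hp : ∀ k, |p k - c * (k * recipSum b k)| ≤ |c| * k) {n : ℕ} {x : Fin b → ℕ}
    (hx : ∑ i, x i = n) {z : Fin b → ℝ} (hz : ∀ i, |z i| ≤ M) :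
    |∑ i, (p (x i) + z i * x i) - p (n + 1)|
      ≤ (|c| * ((b : ℝ) + 3) + M) * ((n + 1 : ℕ) : ℝ) := by
  have h0 := hp (n + 1)
  set N : ℝ := ((n + 1 : ℕ) : ℝ) with hN
  have hN0 : 0 ≤ N := by positivity
  have hsum : ∑ i, (x i : ℝ) ≤ N := by
    rw [hN]
    exact_mod_cast (by omega : ∑ i, x i ≤ n + 1)
  have h1 : ∑ i, (p (x i) + z i * x i) - p (n + 1)
      = c * (∑ i, (x i : ℝ) * recipSum b (x i) - N * recipSum b (n + 1))
        + ∑ i, ((p (x i) - c * (x i * recipSum b (x i))) + z i * x i)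
        + -(p (n + 1) - c * (N * recipSum b (n + 1))) := by
    simp only [Finset.sum_add_distrib, Finset.sum_sub_distrib, ← Finset.mul_sum]
    ring
  have h2 := recipSum_almost_additive hb hx
  rw [← hN] at h2
  have h3 : |∑ i, ((p (x i) - c * (x i * recipSum b (x i))) + z i * x i)| ≤ (|c| + M) * N := by
    refine (Finset.abs_sum_le_sum_abs _ _).trans ?_
    have : ∀ i ∈ Finset.univ, |(p (x i) - c * (x i * recipSum b (x i))) + z i * x i|
        ≤ (|c| + M) * x i := by
      intro i _
      have hx0 : (0 : ℝ) ≤ x i := by positivity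
      refine (abs_add_le _ _).trans ?_
      rw [abs_mul, abs_of_nonneg hx0, add_mul]
      exact add_le_add (hp _) (mul_le_mul_of_nonneg_right (hz i) hx0)
    refine (Finset.sum_le_sum this).trans ?_
    rw [← Finset.mul_sum]
    exact mul_le_mul_of_nonneg_left hsum (by positivity)
  have h4 : |c * (∑ i, (x i : ℝ) * recipSum b (x i) - N * recipSum b (n + 1))|
      ≤ |c| * (((b : ℝ) + 1) * N) := by
    rw [abs_mul]
    exact mul_le_mul_of_nonneg_left h2 (abs_nonneg _)
  rw [h1]
  refine (abs_add_three _ _ _).trans ?_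
  rw [abs_neg]
  nlinarith

lemma sum_sq_le {n : ℕ} {x : Fin b → ℕ} (hx : ∑ i, x i = n) :
    ∑ i, (x i : ℝ) ^ 2 ≤ ((n + 1 : ℕ) : ℝ) ^ 2 := by
  have h : ∑ i, (x i : ℝ) ^ 2 ≤ (∑ i, (x i : ℝ)) ^ 2 :=
    Finset.sum_sq_le_sq_sum_of_nonneg fun i _ => by positivity
  refine h.trans ?_
  have h2 : ∑ i, (x i : ℝ) ≤ ((n + 1 : ℕ) : ℝ) := by
    exact_mod_cast (by omega : ∑ i, x i ≤ n + 1)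
  have h3 : 0 ≤ ∑ i, (x i : ℝ) := by positivity
  gcongr

end

/-! ### Asymptotics of the means and boundedness of the toll -/

section
variable {b : ℕ} {Ω : Type*} [MeasurableSpace Ω] {P : Measure Ω} [IsProbabilityMeasure P]
  {ν : Measure (EuclideanSpace ℝ (Fin b))}
  {T : ℕ → Ω → Finset (Node b)} {Z : Node b → Ω → EuclideanSpace ℝ (Fin b)}

namespace IsWeightedRecursiveTree

lemma integrable_weightedDepth (h : IsWeightedRecursiveTree P ν T Z) {M : ℝ}
    (hM : ∀ᵐ z ∂ν, ‖z‖ ≤ M) (u : Node b) :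
    Integrable (fun ω => weightedDepth (fun u => Z u ω) u) P := by
  simpa [pathLength] using h.integrable_pathLength hM {u}

lemma integral_weightedDepth_cons (h : IsWeightedRecursiveTree P ν T Z) {M : ℝ}
    (hM : ∀ᵐ z ∂ν, ‖z‖ ≤ M) (i : Fin b) (u : Node b) :
    ∫ ω, weightedDepth (fun u => Z u ω) (i :: u) ∂P
      = ∫ ω, Z [] ω i ∂P + ∫ ω, weightedDepth (fun u => Z u ω) u ∂P := by
  simp only [weightedDepth_cons]
  rw [integral_add (h.integrable_root hM i), h.integral_shift (measurable_weightedDepth u) i]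
  exact (((h.identDistrib_shift i).comp (measurable_weightedDepth u)).integrable_iff).2
    (h.integrable_weightedDepth hM u)

lemma integral_weightedDepth_append (h : IsWeightedRecursiveTree P ν T Z) {M : ℝ}
    (hM : ∀ᵐ z ∂ν, ‖z‖ ≤ M) (u : Node b) (i : Fin b) :
    ∫ ω, weightedDepth (fun u => Z u ω) (u ++ [i]) ∂P
      = ∫ ω, weightedDepth (fun u => Z u ω) u ∂P + ∫ ω, Z [] ω i ∂P := by
  induction u with
  | nil => simp [weightedDepth]
  | cons j u ih =>
    rw [List.cons_append, h.integral_weightedDepth_cons hM, ih, h.integral_weightedDepth_cons hM,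
      add_assoc]

/-- The mean weighted depth of a fixed node is additive along its word, so `treeExp_sum_internal`
applies. -/
theorem meanPath_eq (hb : 2 ≤ b) (h : IsWeightedRecursiveTree P ν T Z) {M : ℝ}
    (hM : ∀ᵐ z ∂ν, ‖z‖ ≤ M) (n : ℕ) : meanPath P T Z n
      = (∑ i, ∫ ω, Z [] ω i ∂P) * ∑ k ∈ Finset.range n, recipSum b k := by
  rw [h.meanPath_eq_treeExp hb hM,
    ← treeExp_sum_internal hb (g := fun u => ∫ ω, weightedDepth (fun u => Z u ω) u ∂P)
      (m := fun i => ∫ ω, Z [] ω i ∂P) (by simp [weightedDepth])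
      (h.integral_weightedDepth_append hM)]
  congr 1
  funext S
  simp only [pathLength]
  rw [integral_finsetSum _ fun u _ => h.integrable_weightedDepth hM u]

lemma abs_meanPath_sub_le (hb : 2 ≤ b) (h : IsWeightedRecursiveTree P ν T Z) {M : ℝ}
    (hM : ∀ᵐ z ∂ν, ‖z‖ ≤ M) (n : ℕ) :
    |meanPath P T Z n - (∑ i, ∫ ω, Z [] ω i ∂P) * (n * recipSum b n)|
      ≤ |∑ i, ∫ ω, Z [] ω i ∂P| * n := by
  rw [h.meanPath_eq hb hM, ← mul_sub, abs_mul]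
  exact mul_le_mul_of_nonneg_left (abs_sum_recipSum_sub_le hb n) (abs_nonneg _)

/-- The remainder r_n satisfies r_n = E ∑ r_{I_i} + O(n²). Since E ∑ I_i² ≤ (1 - δ) n², a bound R n²
is propagated by strong induction. -/
theorem exists_abs_meanWiener_sub_le (hb : 2 ≤ b) (h : IsWeightedRecursiveTree P ν T Z) {M : ℝ}
    (hM0 : 0 ≤ M) (hM : ∀ᵐ z ∂ν, ‖z‖ ≤ M) : ∃ R : ℝ, 0 ≤ R ∧ ∀ n : ℕ,
    |meanWiener P T Z n - (∑ i, ∫ ω, Z [] ω i ∂P) * ((n : ℝ) ^ 2 * recipSum b n)|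
      ≤ R * (n : ℝ) ^ 2 := by
  set c : ℝ := ∑ i, ∫ ω, Z [] ω i ∂P with hc
  set C : ℝ := |c| * ((b : ℝ) + 2) + M with hC
  have hC0 : 0 ≤ C := by positivity
  have hmean : ∀ i, |∫ ω, Z [] ω i ∂P| ≤ M := by
    intro i
    have h1 := norm_integral_le_of_norm_le_const (μ := P) (f := fun ω => Z [] ω i) (C := M)
      ((h.ae_weight_bound hM).mono fun ω hω => hω [] i)
    simpa using h1
  set δ : ℝ := 1 / (4 * (2 * (b : ℝ) + 2)) with hδ
  have hδ0 : 0 < δ := by positivity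
  -- R = C/δ solves R (1 - δ) + C = R.
  refine ⟨C / δ, by positivity, fun n => ?_⟩
  induction n using Nat.strong_induction_on with
  | _ n ih =>
    rcases n with _ | n
    · simp [h.meanWiener_zero hb hM]
    · set N : ℝ := ((n + 1 : ℕ) : ℝ) with hN
      have hN0 : 0 < N := by positivity
      set r : ℕ → ℝ := fun k => meanWiener P T Z k - c * ((k : ℝ) ^ 2 * recipSum b k) with hr
      set B : (Fin b → ℕ) → ℝ := fun x => ∑ i, (c * ((x i : ℝ) ^ 2 * recipSum b (x i))
        + (N - x i) * (meanPath P T Z (x i) + (∫ ω, Z [] ω i ∂P) * x i))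
        - c * (N ^ 2 * recipSum b (n + 1)) with hB
      have h1 : meanWiener P T Z (n + 1) - c * (N ^ 2 * recipSum b (n + 1))
          = treeExp (n + 1) fun S => ∑ i, r (subtreeSizes S i) + B (subtreeSizes S) := by
        rw [h.meanWiener_succ hb hM]
        conv_lhs => rw [← treeExp_const (𝕜 := ℝ) hb (n + 1) (c * (N ^ 2 * recipSum b (n + 1)))]
        rw [← treeExp_sub]
        congr 1
        funext S
        simp only [hr, hB]
        rw [← add_sub_assoc, ← Finset.sum_add_distrib]
        congr 1
        refine Finset.sum_congr rfl fun i _ => ?_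
        ring
      have h2 : ∀ S ∈ shapes b (n + 1), |∑ i, r (subtreeSizes S i) + B (subtreeSizes S)|
          ≤ C / δ * N ^ 2 + C * N ^ 2 - C / δ * N ^ 2 * sizeDefect (n + 1) (subtreeSizes S) := by
        intro S hS
        have hx := sizes_sum_of_mem_shapes hS
        have e1 := abs_wiener_toll_le hb (c := c) hM0 (h.abs_meanPath_sub_le hb hM) hx hmean
        have e2 : |∑ i, r (subtreeSizes S i)| ≤ ∑ i, C / δ * (subtreeSizes S i : ℝ) ^ 2 :=
          (Finset.abs_sum_le_sum_abs _ _).trans (Finset.sum_le_sum fun i _ =>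
            ih _ (Nat.lt_succ_of_le (size_le_of_mem_shapes hS i)))
        rw [← Finset.mul_sum] at e2
        have e3 : N ^ 2 * sizeDefect (n + 1) (subtreeSizes S)
            = N ^ 2 - ∑ i, (subtreeSizes S i : ℝ) ^ 2 := by
          simp only [sizeDefect, div_pow, ← Finset.sum_div, ← hN]
          field_simp
        rw [mul_assoc (C / δ) (N ^ 2) (sizeDefect _ _), e3]
        have := abs_add_le (∑ i, r (subtreeSizes S i)) (B (subtreeSizes S))
        have e1' : |B (subtreeSizes S)| ≤ C * N ^ 2 := e1
        linarith
      have h3 : |treeExp (n + 1) fun S => ∑ i, r (subtreeSizes S i) + B (subtreeSizes S)|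
          ≤ treeExp (n + 1) (fun S : Finset (Node b) => C / δ * N ^ 2 + C * N ^ 2
            - C / δ * N ^ 2 * sizeDefect (n + 1) (subtreeSizes S)) := by
        rw [abs_le]
        constructor
        · rw [neg_le, ← neg_one_mul, ← treeExp_const_mul]
          refine treeExp_mono fun S hS => ?_
          linarith [h2 S hS, neg_abs_le (∑ i, r (subtreeSizes S i) + B (subtreeSizes S))]
        · exact treeExp_mono fun S hS => (le_abs_self _).trans (h2 S hS)
      rw [treeExp_sub, treeExp_const hb, treeExp_const_mul] at h3
      rw [h1]
      refine h3.trans ?_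
      have h4 := mul_le_mul_of_nonneg_left (le_treeExp_sizeDefect hb n)
        (show 0 ≤ C / δ * N ^ 2 by positivity)
      rw [← hδ] at h4
      have h5 : C / δ * N ^ 2 * δ = C * N ^ 2 := by field_simp
      linarith

/-- Substituting the expansions of the means leaves the remainders and the tolls of the main terms,
of order n² in the first component and n in the second. The bound holds for every admissible size
vector, not only on average. -/
theorem exists_toll_bound (hb : 2 ≤ b) (h : IsWeightedRecursiveTree P ν T Z) {M : ℝ}
    (hM0 : 0 ≤ M) (hM : ∀ᵐ z ∂ν, ‖z‖ ≤ M) : ∃ D : ℝ, 0 < D ∧ ∀ n : ℕ, ∀ x : Fin b → ℕ,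
    ∑ i, x i = n → ∀ z : EuclideanSpace ℝ (Fin b), (∀ i, |z i| ≤ M) →
      ‖toll (meanWiener P T Z) (meanPath P T Z) (n + 1) x z‖ ≤ D := by
  obtain ⟨R, hR0, hR⟩ := h.exists_abs_meanWiener_sub_le hb hM0 hM
  set c : ℝ := ∑ i, ∫ ω, Z [] ω i ∂P with hc
  refine ⟨(R + R + (|c| * ((b : ℝ) + 2) + M)) + (|c| * ((b : ℝ) + 3) + M) + 1, by positivity,
    fun n x hx z hz => ?_⟩
  have hN : (0 : ℝ) < ((n + 1 : ℕ) : ℝ) := by positivity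
  have e2 := abs_path_toll_le hb (c := c) hM0 (h.abs_meanPath_sub_le hb hM) hx hz
  have e1 : |∑ i, (meanWiener P T Z (x i) + (((n + 1 : ℕ) : ℝ) - x i) *
      (meanPath P T Z (x i) + z i * x i)) - meanWiener P T Z (n + 1)|
      ≤ (R + R + (|c| * ((b : ℝ) + 2) + M)) * ((n + 1 : ℕ) : ℝ) ^ 2 := by
    have f1 := abs_wiener_toll_le hb (c := c) hM0 (h.abs_meanPath_sub_le hb hM) hx hz
    have f2 : |∑ i, (meanWiener P T Z (x i) - c * ((x i : ℝ) ^ 2 * recipSum b (x i)))|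
        ≤ R * ((n + 1 : ℕ) : ℝ) ^ 2 := by
      refine (Finset.abs_sum_le_sum_abs _ _).trans
        ((Finset.sum_le_sum fun i _ => hR (x i)).trans ?_)
      rw [← Finset.mul_sum]
      exact mul_le_mul_of_nonneg_left (sum_sq_le hx) hR0
    have f3 := hR (n + 1)
    have f4 : ∑ i, (meanWiener P T Z (x i) + (((n + 1 : ℕ) : ℝ) - x i) *
        (meanPath P T Z (x i) + z i * x i)) - meanWiener P T Z (n + 1)
        = ∑ i, (meanWiener P T Z (x i) - c * ((x i : ℝ) ^ 2 * recipSum b (x i)))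
          + -(meanWiener P T Z (n + 1) - c * (((n + 1 : ℕ) : ℝ) ^ 2 * recipSum b (n + 1)))
          + (∑ i, (c * ((x i : ℝ) ^ 2 * recipSum b (x i)) + (((n + 1 : ℕ) : ℝ) - x i) *
            (meanPath P T Z (x i) + z i * x i))
            - c * (((n + 1 : ℕ) : ℝ) ^ 2 * recipSum b (n + 1))) := by
      simp only [Finset.sum_add_distrib, Finset.sum_sub_distrib]
      ring
    rw [f4]
    refine (abs_add_three _ _ _).trans ?_
    rw [abs_neg]
    linarith
  have h1 : ‖toll (meanWiener P T Z) (meanPath P T Z) (n + 1) x z‖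
      ≤ |(∑ i, (meanWiener P T Z (x i) + (((n + 1 : ℕ) : ℝ) - x i) *
      (meanPath P T Z (x i) + z i * x i)) - meanWiener P T Z (n + 1)) / ((n + 1 : ℕ) : ℝ) ^ 2|
      + |(∑ i, (meanPath P T Z (x i) + z i * x i) - meanPath P T Z (n + 1)) / ((n + 1 : ℕ) : ℝ)| := by
    rw [toll, euclidean_two_eq]
    refine (norm_add_le _ _).trans ?_
    rw [norm_smul, norm_smul, PiLp.norm_single, PiLp.norm_single, norm_one, mul_one, mul_one,
      Real.norm_eq_abs, Real.norm_eq_abs]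
  refine h1.trans ?_
  rw [abs_div, abs_div, abs_of_pos hN, abs_of_pos (pow_pos hN 2)]
  have g1 := (div_le_iff₀ (pow_pos hN 2)).2 e1
  have g2 := (div_le_iff₀ hN).2 e2
  linarith

end IsWeightedRecursiveTree

end

end BaryTree

namespace BaryTree

set_option linter.unusedSectionVars false

section
variable {b : ℕ}

/-! ### The exponential estimate for the toll -/

/-- The constant in the bound for the moment generating function. -/
noncomputable def mgfConst (b : ℕ) : ℝ := 24 * (2 * (b : ℝ) + 2) ^ 2

/-- The bound for the cumulant generating function. -/
noncomputable def mgfExponent (b : ℕ) (y : ℝ) : ℝ := mgfConst b * y ^ 2 * Real.exp y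

lemma mgfConst_pos (b : ℕ) : 0 < mgfConst b := by
  unfold mgfConst
  positivity

lemma mgfExponent_nonneg (b : ℕ) (y : ℝ) : 0 ≤ mgfExponent b y := by
  have := mgfConst_pos b
  unfold mgfExponent
  positivity

/-- The exponent is quadratic up to an increasing factor, so shrinking y by v gains v²; these gains
add up to 1 minus the size defect. -/
lemma mgfExponent_le_of_le_mul {y v y' : ℝ} (hv1 : v ≤ 1) (hy : 0 ≤ y)
    (hy'0 : 0 ≤ y') (hy' : y' ≤ v * y) : mgfExponent b y' ≤ v ^ 2 * mgfExponent b y := by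
  have hK := mgfConst_pos b
  have h1 : y' ≤ y := hy'.trans (by nlinarith)
  have h2 : y' ^ 2 ≤ v ^ 2 * y ^ 2 := by
    rw [← mul_pow]
    gcongr
  unfold mgfExponent
  calc mgfConst b * y' ^ 2 * Real.exp y' ≤ mgfConst b * (v ^ 2 * y ^ 2) * Real.exp y := by gcongr
    _ = _ := by ring

lemma sizeDefect_mem {n : ℕ} {x : Fin b → ℕ} (hx : ∑ i, x i = n) :
    0 ≤ sizeDefect (n + 1) x ∧ sizeDefect (n + 1) x ≤ 1 := by
  have hN : (0 : ℝ) < ((n + 1 : ℕ) : ℝ) := by positivity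
  constructor
  · have h := sum_sq_le hx
    simp only [sizeDefect, div_pow, ← Finset.sum_div]
    rw [sub_nonneg, div_le_one (by positivity)]
    exact h
  · unfold sizeDefect
    have : 0 ≤ ∑ i, ((x i : ℝ) / ((n + 1 : ℕ) : ℝ)) ^ 2 := by positivity
    linarith

/-- A function `G` of the subtree sizes between `exp (-y)` and `exp y`, whose mean is `1` up to
`y ^ 2` when `y` is small, is compensated by the size defect. -/
theorem treeExp_mul_exp_neg_sizeDefect_le_one (hb : 2 ≤ b) (n : ℕ) {y : ℝ} (hy : 0 ≤ y)
    {G : (Fin b → ℕ) → ℝ}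
    (hlow : ∀ S ∈ shapes b (n + 1), Real.exp (-y) ≤ G (subtreeSizes S))
    (hupp : ∀ S ∈ shapes b (n + 1), G (subtreeSizes S) ≤ Real.exp y)
    (hmean : y ≤ 1 → treeExp (n + 1) (fun S => G (subtreeSizes S)) ≤ 1 + y ^ 2) :
    treeExp (n + 1) (fun S => G (subtreeSizes S) *
      Real.exp (-(mgfExponent b y * sizeDefect (n + 1) (subtreeSizes S)))) ≤ 1 := by
  set κ := mgfExponent b y with hκ
  set C : ℝ := 2 * (b : ℝ) + 2 with hC
  have hC6 : 1 ≤ C := by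
    have : (0 : ℝ) ≤ b := by positivity
    linarith
  have hκ0 : 0 ≤ κ := mgfExponent_nonneg b y
  have hκeq : κ = 24 * C ^ 2 * y ^ 2 * Real.exp y := rfl
  -- In the first case y ≤ 1, so the mean estimate applies and the mean defect must absorb y². In
  -- the second, the Laplace transform of the defect is small enough to absorb e^y.
  rcases le_or_gt (24 * C * y ^ 2) 1 with hsmall | hlarge
  · have hy1 : y ≤ 1 := by nlinarith
    have h1 : treeExp (n + 1) (fun S => G (subtreeSizes S) *
        Real.exp (-(κ * sizeDefect (n + 1) (subtreeSizes S))))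
        ≤ treeExp (n + 1) (fun S : Finset (Node b) => G (subtreeSizes S)
          - Real.exp (-y) * (κ / (1 + κ)) * sizeDefect (n + 1) (subtreeSizes S)) := by
      refine treeExp_mono fun S hS => ?_
      obtain ⟨hU0, hU1⟩ := sizeDefect_mem (sizes_sum_of_mem_shapes hS)
      set U := sizeDefect (n + 1) (subtreeSizes S)
      -- From e^{-κU} ≤ 1/(1 + κU) and U ≤ 1.
      have e1 : κ / (1 + κ) * U ≤ 1 - Real.exp (-(κ * U)) := by
        have e2 : Real.exp (-(κ * U)) ≤ 1 / (1 + κ * U) := by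
          rw [Real.exp_neg, ← one_div]
          exact one_div_le_one_div_of_le (by positivity) (by linarith [Real.add_one_le_exp (κ * U)])
        have e3 : κ / (1 + κ) * U ≤ 1 - 1 / (1 + κ * U) := by
          rw [div_mul_eq_mul_div, one_sub_div (by positivity), add_sub_cancel_left]
          refine div_le_div_of_nonneg_left (by positivity) (by positivity) ?_
          nlinarith
        linarith
      have e4 := mul_le_mul (hlow S hS) e1 (by positivity) ((Real.exp_nonneg _).trans (hlow S hS))
      linarith
    rw [treeExp_sub, treeExp_const_mul] at h1
    have h2 := mul_le_mul_of_nonneg_left (le_treeExp_sizeDefect hb n)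
      (show 0 ≤ Real.exp (-y) * (κ / (1 + κ)) by positivity)
    -- Here e^{-y} ≥ 1/3, and κ ≥ 24 C² y² with 12 C y² ≤ 1/2 gives κ/(1 + κ) ≥ 12 C y²; the product
    -- with 1/(4C) is y². This fixes the 24 in `mgfConst`.
    have h3 : y ^ 2 ≤ Real.exp (-y) * (κ / (1 + κ)) * (1 / (4 * C)) := by
      have f1 : 1 / 3 ≤ Real.exp (-y) := by
        rw [Real.exp_neg, ← one_div]
        refine one_div_le_one_div_of_le (Real.exp_pos _) ?_
        exact (Real.exp_le_exp.2 hy1).trans (by linarith [Real.exp_one_lt_d9])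
      have f2 : 12 * C * y ^ 2 ≤ κ / (1 + κ) := by
        rw [le_div_iff₀ (by positivity)]
        have f3 : 24 * C ^ 2 * y ^ 2 ≤ κ := by
          rw [hκeq]
          exact le_mul_of_one_le_right (by positivity) (Real.one_le_exp hy)
        have f4 : 12 * C * y ^ 2 * κ ≤ 1 / 2 * κ :=
          mul_le_mul_of_nonneg_right (by linarith) hκ0
        have f5 : 12 * C * y ^ 2 ≤ 12 * C ^ 2 * y ^ 2 := by
          have : C ≤ C ^ 2 := by nlinarith
          have := sq_nonneg y
          nlinarith
        linarith
      have f6 : 1 / 3 * (12 * C * y ^ 2) ≤ Real.exp (-y) * (κ / (1 + κ)) :=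
        mul_le_mul f1 f2 (by positivity) (Real.exp_nonneg _)
      calc y ^ 2 = 1 / 3 * (12 * C * y ^ 2) * (1 / (4 * C)) := by field_simp; ring
        _ ≤ _ := mul_le_mul_of_nonneg_right f6 (by positivity)
    linarith [hmean hy1]
  · have hy0 : 0 < y ^ 2 := by
      by_contra h
      have : y ^ 2 = 0 := le_antisymm (not_lt.1 h) (sq_nonneg y)
      rw [this] at hlarge
      linarith
    have hκpos : 0 < κ := by
      rw [hκeq]
      positivity
    have h1 : treeExp (n + 1) (fun S => G (subtreeSizes S) *
        Real.exp (-(κ * sizeDefect (n + 1) (subtreeSizes S))))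
        ≤ treeExp (n + 1) (fun S : Finset (Node b) => Real.exp y *
          Real.exp (-(κ * sizeDefect (n + 1) (subtreeSizes S)))) :=
      treeExp_mono fun S hS => mul_le_mul_of_nonneg_right (hupp S hS) (Real.exp_nonneg _)
    rw [treeExp_const_mul] at h1
    have h2 := mul_le_mul_of_nonneg_left (treeExp_exp_neg_sizeDefect_le hb n hκpos)
      (Real.exp_nonneg y)
    refine h1.trans (h2.trans ?_)
    rw [← mul_div_assoc, div_le_one hκpos, hκeq]
    have h3 : C ≤ 24 * C ^ 2 * y ^ 2 := by nlinarith
    calc Real.exp y * C ≤ Real.exp y * (24 * C ^ 2 * y ^ 2) := by gcongr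
      _ = _ := by ring

/-! ### The moment generating function -/

lemma inner_euclidean_two (x y : EuclideanSpace ℝ (Fin 2)) :
    inner ℝ x y = x 0 * y 0 + x 1 * y 1 := by
  simp [PiLp.inner_apply, Fin.sum_univ_two, mul_comm]

lemma abs_inner_le (x s : EuclideanSpace ℝ (Fin 2)) :
    |inner ℝ x s| ≤ ‖x‖ * (|s 0| + |s 1|) := by
  rw [inner_euclidean_two, mul_add]
  refine (abs_add_le _ _).trans ?_
  rw [abs_mul, abs_mul]
  exact add_le_add (mul_le_mul_of_nonneg_right (PiLp.norm_apply_le x 0) (abs_nonneg _))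
    (mul_le_mul_of_nonneg_right (PiLp.norm_apply_le x 1) (abs_nonneg _))

lemma inner_coeff (n : ℕ) (i : Fin b) (x : Fin b → ℕ) (y s : EuclideanSpace ℝ (Fin 2)) :
    inner ℝ ((coeff n i x).toEuclideanLin y) s
      = inner ℝ y !₂[((x i : ℝ) / n) ^ 2 * s 0,
          (x i : ℝ) / n * (1 - (x i : ℝ) / n) * s 0 + (x i : ℝ) / n * s 1] := by
  rw [toEuclideanLin_coeff, inner_euclidean_two, inner_euclidean_two]
  rcases eq_or_ne (n : ℝ) 0 with hn | hn
  · simp [hn]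
  · simp
    field_simp
    ring

/-- Because v² + v (1 - v) = v, the transposed coefficient matrix contracts the ℓ¹ norm by exactly
the relative size allowed for; hence the use of |s₀| + |s₁|. -/
lemma abs_adjoint_coeff_le {v : ℝ} (hv0 : 0 ≤ v) (hv1 : v ≤ 1) (s0 s1 : ℝ) :
    |v ^ 2 * s0| + |v * (1 - v) * s0 + v * s1| ≤ v * (|s0| + |s1|) := by
  have h1 : |v * (1 - v) * s0 + v * s1| ≤ v * (1 - v) * |s0| + v * |s1| := by
    refine (abs_add_le _ _).trans (le_of_eq ?_)
    rw [abs_mul (v * (1 - v)), abs_mul v s1, abs_of_nonneg hv0,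
      abs_of_nonneg (mul_nonneg hv0 (sub_nonneg.2 hv1))]
  rw [abs_mul, abs_of_nonneg (sq_nonneg v)]
  linarith

lemma integrable_exp_of_ae_bound {Ω : Type*} [MeasurableSpace Ω] {P : Measure Ω}
    [IsFiniteMeasure P] {X : Ω → ℝ} {C : ℝ} (hX : Measurable X) (hC : ∀ᵐ ω ∂P, |X ω| ≤ C) :
    Integrable (fun ω => Real.exp (X ω)) P := by
  refine Integrable.of_bound (C := Real.exp C) hX.exp.aestronglyMeasurable ?_
  filter_upwards [hC] with ω hω
  rw [Real.norm_eq_abs, Real.abs_exp, Real.exp_le_exp]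
  exact (le_abs_self _).trans hω

end

section
variable {b : ℕ} {Ω : Type*} [MeasurableSpace Ω] {P : Measure Ω} [IsProbabilityMeasure P]
  {ν : Measure (EuclideanSpace ℝ (Fin b))}
  {T : ℕ → Ω → Finset (Node b)} {Z : Node b → Ω → EuclideanSpace ℝ (Fin b)}

namespace IsWeightedRecursiveTree

lemma exists_ae_bound_normVec (h : IsWeightedRecursiveTree P ν T Z) {M : ℝ}
    (hM : ∀ᵐ z ∂ν, ‖z‖ ≤ M) (eW eL : ℕ → ℝ) (n : ℕ) (s : EuclideanSpace ℝ (Fin 2))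
    (S : Finset (Node b)) :
    ∃ C : ℝ, ∀ᵐ ω ∂P, |inner ℝ (normVec eW eL n (fun u => Z u ω) S) s| ≤ C := by
  obtain ⟨C, hC⟩ := h.exists_ae_bound hM S
  refine ⟨(C + |eW n|) / |(n : ℝ) ^ 2| * |s 0| + (C + |eL n|) / |(n : ℝ)| * |s 1|, ?_⟩
  filter_upwards [hC] with ω hω
  rw [inner_euclidean_two]
  refine (abs_add_le _ _).trans ?_
  simp only [normVec, PiLp.toLp_apply, Matrix.cons_val_zero, Matrix.cons_val_one, abs_mul, abs_div]
  have h1 := (abs_sub (wienerIndex (fun u => Z u ω) S) (eW n)).trans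
    (add_le_add_left hω.1 |eW n|)
  have h2 := (abs_sub (pathLength (fun u => Z u ω) S) (eL n)).trans
    (add_le_add_left hω.2 |eL n|)
  gcongr

lemma integrable_exp_normVec (h : IsWeightedRecursiveTree P ν T Z) {M : ℝ}
    (hM : ∀ᵐ z ∂ν, ‖z‖ ≤ M) (eW eL : ℕ → ℝ) (n : ℕ) (s : EuclideanSpace ℝ (Fin 2))
    (S : Finset (Node b)) :
    Integrable (fun ω => Real.exp (inner ℝ (normVec eW eL n (fun u => Z u ω) S) s)) P := by
  obtain ⟨C, hC⟩ := h.exists_ae_bound_normVec hM eW eL n s S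
  refine integrable_exp_of_ae_bound ?_ hC
  have := (measurable_normVec eW eL n S).comp h.measurable_weights
  simp only [Function.comp_def] at this
  fun_prop

lemma ae_norm_root_le (h : IsWeightedRecursiveTree P ν T Z) {M : ℝ}
    (hM : ∀ᵐ z ∂ν, ‖z‖ ≤ M) : ∀ᵐ ω ∂P, ‖Z [] ω‖ ≤ M := by
  rw [← h.law_weight []] at hM
  exact ae_of_ae_map (h.measurable_weight []).aemeasurable hM

lemma continuous_toll (eW eL : ℕ → ℝ) (n : ℕ) (x : Fin b → ℕ) : Continuous (toll eW eL n x) := by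
  unfold toll
  simp only [euclidean_two_eq]
  fun_prop

lemma integrable_exp_toll (h : IsWeightedRecursiveTree P ν T Z) {M : ℝ}
    (hM : ∀ᵐ z ∂ν, ‖z‖ ≤ M) (eW eL : ℕ → ℝ) (n : ℕ) (s : EuclideanSpace ℝ (Fin 2))
    (x : Fin b → ℕ) :
    Integrable (fun ω => Real.exp (inner ℝ (toll eW eL n x (Z [] ω)) s)) P := by
  have hc : Continuous fun z => inner ℝ (toll eW eL n x z) s :=
    (continuous_toll eW eL n x).inner continuous_const
  obtain ⟨C, hC⟩ := (isCompact_closedBall (0 : EuclideanSpace ℝ (Fin b)) M).exists_bound_of_continuousOn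
    hc.continuousOn
  refine integrable_exp_of_ae_bound (C := C) (hc.measurable.comp (h.measurable_weight [])) ?_
  filter_upwards [h.ae_norm_root_le hM] with ω hω
  exact hC _ (by simpa using hω)

/-- Strong induction on n, for all s at once because the subtrees are evaluated at transformed
directions. Their bounds multiply to exp(κ (1 - U)), and the toll factor is compensated by exp(-κ
U). -/
theorem integral_exp_normVec_le (hb : 2 ≤ b) (h : IsWeightedRecursiveTree P ν T Z) {M D : ℝ}
    (hM : ∀ᵐ z ∂ν, ‖z‖ ≤ M) (hD0 : 0 < D)
    (hD : ∀ n : ℕ, ∀ x : Fin b → ℕ, ∑ i, x i = n → ∀ z : EuclideanSpace ℝ (Fin b),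
      (∀ i, |z i| ≤ M) → ‖toll (meanWiener P T Z) (meanPath P T Z) (n + 1) x z‖ ≤ D)
    (n : ℕ) (s : EuclideanSpace ℝ (Fin 2)) :
    ∫ ω, Real.exp (inner ℝ (normVec (meanWiener P T Z) (meanPath P T Z) n
        (fun u => Z u ω) (T n ω)) s) ∂P
      ≤ Real.exp (mgfExponent b (D * (|s 0| + |s 1|))) := by
  induction n using Nat.strong_induction_on generalizing s with
  | _ n ih =>
    rcases n with _ | n
    -- For n = 0 both denominators are zero, so the normalized vector is 0.
    · have h0 : ∀ ω, inner ℝ (normVec (meanWiener P T Z) (meanPath P T Z) 0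
          (fun u => Z u ω) (T 0 ω)) s = 0 := by
        intro ω
        simp [inner_euclidean_two, normVec]
      simp only [h0, Real.exp_zero, integral_const, probReal_univ, smul_eq_mul, mul_one]
      exact Real.one_le_exp (mgfExponent_nonneg _ _)
    · set eW := meanWiener P T Z with heW
      set eL := meanPath P T Z with heL
      set y : ℝ := D * (|s 0| + |s 1|) with hy
      have hy0 : 0 ≤ y := by positivity
      have hIm := h.measurable_subtreeSizes (n + 1)
      have hg : ∀ x : Fin b → ℕ, Measurable fun z =>
          Real.exp (inner ℝ (toll eW eL (n + 1) x z) s) := by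
        intro x
        have := measurable_toll (b := b) eW eL (n + 1) x
        fun_prop
      have hf : ∀ (x : Fin b → ℕ) (i : Fin b) (t : Finset (Node b)), Measurable fun w =>
          Real.exp (inner ℝ ((coeff (n + 1) i x).toEuclideanLin (normVec eW eL (x i) w t)) s) := by
        intro x i t
        have := (measurable_toEuclideanLin (coeff (n + 1) i x)).comp
          (measurable_normVec eW eL (x i) t)
        simp only [Function.comp_def] at this
        fun_prop
      have key := h.integral_decomposition hb n hg hf
        (fun x => h.integrable_exp_toll hM eW eL (n + 1) s x)
        (fun x i t => by
          simp only [inner_coeff]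
          exact h.integrable_exp_normVec hM eW eL (x i) _ t)
      have hL : ∫ ω, Real.exp (inner ℝ (normVec eW eL (n + 1)
          (fun u => Z u ω) (T (n + 1) ω)) s) ∂P
          = ∫ ω, Real.exp (inner ℝ (toll eW eL (n + 1)
            (subtreeSizes (T (n + 1) ω)) (Z [] ω)) s)
          * ∏ i, Real.exp (inner ℝ ((coeff (n + 1) i (subtreeSizes (T (n + 1) ω))).toEuclideanLin
            (normVec eW eL (subtreeSizes (T (n + 1) ω) i)
              (shift (fun u => Z u ω) i) (sub (T (n + 1) ω) i))) s) ∂P := by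
        refine integral_congr_ae ?_
        filter_upwards [h.ae_mem_shapes hb (n + 1)] with ω hω
        rw [normVec_decomposition (h.meanWiener_zero hb hM) (h.meanPath_zero hb hM) _ hω,
          inner_add_left, sum_inner, ← Real.exp_sum, ← Real.exp_add, add_comm]
      set G : (Fin b → ℕ) → ℝ := fun x => ∫ ω, Real.exp (inner ℝ (toll eW eL (n + 1) x (Z [] ω)) s) ∂P
        with hG
      rw [hL, key, h.integral_tree hb (n + 1) (fun S => G (subtreeSizes S) *
        ∏ i, ∫ ω', Real.exp (inner ℝ ((coeff (n + 1) i (subtreeSizes S)).toEuclideanLin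
            (normVec eW eL (subtreeSizes S i) (fun u => Z u ω') (T (subtreeSizes S i) ω'))) s) ∂P)]
      have hY : ∀ S ∈ shapes b (n + 1), ∀ᵐ ω ∂P,
          |inner ℝ (toll eW eL (n + 1) (subtreeSizes S) (Z [] ω)) s| ≤ y := by
        intro S hS
        filter_upwards [h.ae_weight_bound hM] with ω hω
        refine (abs_inner_le _ _).trans ?_
        exact mul_le_mul_of_nonneg_right (hD n _ (sizes_sum_of_mem_shapes hS) _ (hω []))
          (by positivity)
      have hGlow : ∀ S ∈ shapes b (n + 1), Real.exp (-y) ≤ G (subtreeSizes S) := by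
        intro S hS
        have h1 : ∫ _, Real.exp (-y) ∂P ≤ G (subtreeSizes S) := by
          refine integral_mono_ae (integrable_const _)
            (h.integrable_exp_toll hM eW eL (n + 1) s _) ?_
          filter_upwards [hY S hS] with ω hω
          exact Real.exp_le_exp.2 (abs_le.1 hω).1
        simpa using h1
      have hGupp : ∀ S ∈ shapes b (n + 1), G (subtreeSizes S) ≤ Real.exp y := by
        intro S hS
        have h1 : G (subtreeSizes S) ≤ ∫ _, Real.exp y ∂P := by
          refine integral_mono_ae (h.integrable_exp_toll hM eW eL (n + 1) s _)
            (integrable_const _) ?_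
          filter_upwards [hY S hS] with ω hω
          exact Real.exp_le_exp.2 (abs_le.1 hω).2
        simpa using h1
      -- By e^x ≤ 1 + x + x² for |x| ≤ 1; the linear term integrates to 0.
      have hGmean : y ≤ 1 → treeExp (n + 1) (fun S => G (subtreeSizes S)) ≤ 1 + y ^ 2 := by
        intro hy1
        obtain ⟨hti, ht0⟩ := h.toll_integrable_and_integral hb hM n
        rw [← h.integral_eq_treeExp hb (n + 1) (F := fun S w =>
          Real.exp (inner ℝ (toll eW eL (n + 1) (subtreeSizes S) (w [])) s))
          (fun S => (hg _).comp (measurable_pi_apply []))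
          (fun S _ => h.integrable_exp_toll hM eW eL (n + 1) s _)]
        have hi : Integrable (fun ω => inner ℝ (toll eW eL (n + 1)
            (subtreeSizes (T (n + 1) ω)) (Z [] ω)) s) P := hti.inner_const s
        have hz : ∫ ω, inner ℝ (toll eW eL (n + 1)
            (subtreeSizes (T (n + 1) ω)) (Z [] ω)) s ∂P = 0 := by
          have := integral_inner (𝕜 := ℝ) hti s
          rw [ht0, inner_zero_right] at this
          rw [← this]
          congr 1
          funext ω
          exact real_inner_comm _ _
        have h1 : ∫ ω, Real.exp (inner ℝ (toll eW eL (n + 1)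
            (subtreeSizes (T (n + 1) ω)) (Z [] ω)) s) ∂P
            ≤ ∫ ω, (1 + y ^ 2 + inner ℝ (toll eW eL (n + 1)
              (subtreeSizes (T (n + 1) ω)) (Z [] ω)) s) ∂P := by
          refine integral_mono_ae (h.integrable_tree hb (n + 1) (F := fun S w =>
            Real.exp (inner ℝ (toll eW eL (n + 1) (subtreeSizes S) (w [])) s))
            (fun S _ => h.integrable_exp_toll hM eW eL (n + 1) s _))
            ((integrable_const _).add hi) ?_
          filter_upwards [h.ae_weight_bound hM, h.ae_sizes hb n] with ω hω hs
          have h2 : |inner ℝ (toll eW eL (n + 1) (subtreeSizes (T (n + 1) ω)) (Z [] ω)) s| ≤ y :=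
            (abs_inner_le _ _).trans
              (mul_le_mul_of_nonneg_right (hD n _ hs _ (hω [])) (by positivity))
          have h3 := (abs_le.1 (Real.abs_exp_sub_one_sub_id_le (h2.trans hy1))).2
          have h4 := sq_le_sq' (abs_le.1 h2).1 (abs_le.1 h2).2
          linarith
        rw [integral_add (integrable_const _) hi, hz] at h1
        simpa using h1
      have hmain := treeExp_mul_exp_neg_sizeDefect_le_one hb n hy0 hGlow hGupp hGmean
      have hcomp : treeExp (n + 1) (fun S => G (subtreeSizes S) *
          ∏ i, ∫ ω', Real.exp (inner ℝ ((coeff (n + 1) i (subtreeSizes S)).toEuclideanLin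
            (normVec eW eL (subtreeSizes S i) (fun u => Z u ω') (T (subtreeSizes S i) ω'))) s) ∂P)
          ≤ treeExp (n + 1) (fun S => Real.exp (mgfExponent b y) * (G (subtreeSizes S) *
            Real.exp (-(mgfExponent b y * sizeDefect (n + 1) (subtreeSizes S))))) := by
        refine treeExp_mono fun S hS => ?_
        have hG0 : 0 ≤ G (subtreeSizes S) := (Real.exp_nonneg _).trans (hGlow S hS)
        have hprod : ∏ i, ∫ ω', Real.exp (inner ℝ
            ((coeff (n + 1) i (subtreeSizes S)).toEuclideanLin (normVec eW eL (subtreeSizes S i)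
              (fun u => Z u ω') (T (subtreeSizes S i) ω'))) s) ∂P
            ≤ ∏ i, Real.exp (((subtreeSizes S i : ℝ) / ((n + 1 : ℕ) : ℝ)) ^ 2
              * mgfExponent b y) := by
          refine Finset.prod_le_prod (fun i _ => integral_nonneg fun _ => Real.exp_nonneg _)
            fun i _ => ?_
          simp only [inner_coeff]
          have hsz := size_le_of_mem_shapes hS i
          refine (ih _ (Nat.lt_succ_of_le hsz) _).trans (Real.exp_le_exp.2 ?_)
          have hv0 : 0 ≤ (subtreeSizes S i : ℝ) / ((n + 1 : ℕ) : ℝ) := by positivity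
          have hv1 : (subtreeSizes S i : ℝ) / ((n + 1 : ℕ) : ℝ) ≤ 1 := by
            rw [div_le_one (by positivity)]
            exact_mod_cast hsz.trans (Nat.le_succ n)
          refine mgfExponent_le_of_le_mul hv1 hy0 (by positivity) ?_
          have := mul_le_mul_of_nonneg_left (abs_adjoint_coeff_le hv0 hv1 (s 0) (s 1)) hD0.le
          simp only [Matrix.cons_val_zero, Matrix.cons_val_one]
          linarith
        refine (mul_le_mul_of_nonneg_left hprod hG0).trans (le_of_eq ?_)
        rw [← Real.exp_sum, ← Finset.sum_mul, mul_left_comm, ← Real.exp_add]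
        congr 2
        rw [sizeDefect]
        ring
      refine hcomp.trans ?_
      rw [treeExp_const_mul]
      exact mul_le_of_le_one_right (Real.exp_nonneg _) hmain

lemma integrable_exp_normVec_tree (hb : 2 ≤ b) (h : IsWeightedRecursiveTree P ν T Z) {M : ℝ}
    (hM : ∀ᵐ z ∂ν, ‖z‖ ≤ M) (eW eL : ℕ → ℝ) (n : ℕ) (s : EuclideanSpace ℝ (Fin 2)) :
    Integrable (fun ω => Real.exp (inner ℝ (normVec eW eL n (fun u => Z u ω) (T n ω)) s)) P :=
  h.integrable_tree hb n (F := fun S w => Real.exp (inner ℝ (normVec eW eL n w S) s))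
    fun S _ => h.integrable_exp_normVec hM eW eL n s S

/-- The Chernoff bound in direction `s`. -/
theorem measureReal_inner_gt_le (hb : 2 ≤ b) (h : IsWeightedRecursiveTree P ν T Z) {M D : ℝ}
    (hM : ∀ᵐ z ∂ν, ‖z‖ ≤ M) (hD0 : 0 < D)
    (hD : ∀ n : ℕ, ∀ x : Fin b → ℕ, ∑ i, x i = n → ∀ z : EuclideanSpace ℝ (Fin b),
      (∀ i, |z i| ≤ M) → ‖toll (meanWiener P T Z) (meanPath P T Z) (n + 1) x z‖ ≤ D)
    (n : ℕ) {s : EuclideanSpace ℝ (Fin 2)} (hs : |s 0| + |s 1| = 1) {l : ℝ} (hl : 0 ≤ l) (t : ℝ) :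
    P.real {ω | t < inner ℝ (normVec (meanWiener P T Z) (meanPath P T Z) n
        (fun u => Z u ω) (T n ω)) s}
      ≤ Real.exp (-(l * t) + mgfExponent b (D * l)) := by
  set X : Ω → ℝ := fun ω => inner ℝ (normVec (meanWiener P T Z) (meanPath P T Z) n
        (fun u => Z u ω) (T n ω)) s with hX
  have hexp : ∀ ω, Real.exp (l * X ω) = Real.exp (inner ℝ (normVec (meanWiener P T Z)
      (meanPath P T Z) n (fun u => Z u ω) (T n ω)) (l • s)) := by
    intro ω
    rw [inner_smul_right]
  have hint : Integrable (fun ω => Real.exp (l * X ω)) P := by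
    simp only [hexp]
    exact h.integrable_exp_normVec_tree hb hM _ _ n (l • s)
  have h1 := measure_ge_le_exp_mul_mgf (μ := P) (X := X) t hl hint
  have h2 : mgf X P l ≤ Real.exp (mgfExponent b (D * l)) := by
    have h3 := h.integral_exp_normVec_le hb hM hD0 hD n (l • s)
    have h4 : |(l • s) 0| + |(l • s) 1| = l := by
      simp only [PiLp.smul_apply, smul_eq_mul, abs_mul, abs_of_nonneg hl, ← mul_add, hs, mul_one]
    rw [h4] at h3
    simp only [mgf, hexp]
    exact h3
  have h5 : P.real {ω | t < X ω} ≤ P.real {ω | t ≤ X ω} :=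
    measureReal_mono fun ω (hω : t < X ω) => hω.le
  refine h5.trans (h1.trans ?_)
  rw [Real.exp_add, ← neg_mul]
  exact mul_le_mul_of_nonneg_left h2 (Real.exp_nonneg _)

end IsWeightedRecursiveTree

end

/-! ### Optimization of the Chernoff bound -/

/-- A sign change on [1, 10] yields a positive root, and the greatest root is at least that one;
e^10 is bounded below by 2^10 > 600. -/
lemma nonneg_of_isGreatest {L₀ : ℝ} (hL₀ : IsGreatest {l : ℝ | Real.exp l = 6 * l ^ 2} L₀) :
    0 ≤ L₀ := by
  have hc : ContinuousOn (fun l : ℝ => Real.exp l - 6 * l ^ 2) (Set.Icc 1 10) :=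
    Continuous.continuousOn (by fun_prop)
  have h1 : Real.exp 1 - 6 * 1 ^ 2 ≤ 0 := by linarith [Real.exp_one_lt_d9]
  have h2 : 0 ≤ Real.exp 10 - 6 * 10 ^ 2 := by
    have h3 : Real.exp 10 = Real.exp 1 ^ 10 := by
      rw [← Real.exp_nat_mul]
      norm_num
    have h4 : (2 : ℝ) ^ 10 ≤ Real.exp 1 ^ 10 := by
      gcongr
      linarith [Real.exp_one_gt_d9]
    rw [h3]
    linarith
  obtain ⟨l, hl, hl0⟩ := intermediate_value_Icc (by norm_num) hc ⟨h1, h2⟩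
  have h5 : l ≤ L₀ := hL₀.2 (sub_eq_zero.1 hl0)
  linarith [hl.1]

lemma exists_scale (b : ℕ) {γ : ℝ} (hγ : 0 < γ) (R : ℝ) : ∃ B : ℝ, 1 ≤ B ∧
    (∀ y, 0 ≤ y → y ≤ R → mgfExponent b (y / B) ≤ 5 / 2 * γ ^ 2 * y ^ 2 ∧
      mgfExponent b (y / B) ≤ 24 * y ^ 2) ∧
    ∀ y, 0 ≤ y → mgfExponent b (y / B) ≤ 4 * Real.exp y := by
  have hK := mgfConst_pos b
  set c : ℝ := min (5 / 2 * γ ^ 2) 24 with hc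
  have hc0 : 0 < c := lt_min (by positivity) (by norm_num)
  set A : ℝ := mgfConst b * Real.exp R / c with hA
  have hA0 : 0 < A := by positivity
  -- The summand A handles the bounded range, through K e^R ≤ c B²; 2 gives e^{y/B} ≤ e^{y/2}, and
  -- 2K gives K/B² ≤ 1/2.
  set B : ℝ := 2 + 2 * mgfConst b + A with hB
  have hB2 : 2 ≤ B := by linarith
  have hB0 : 0 < B := by linarith
  have hBB : B ≤ B ^ 2 := by nlinarith
  refine ⟨B, by linarith, fun y hy hyR => ?_, fun y hy => ?_⟩
  · have h1 : mgfExponent b (y / B) ≤ c * y ^ 2 := by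
      have e1 : y / B ≤ R := (div_le_self hy (by linarith)).trans hyR
      have e2 : mgfConst b * Real.exp R ≤ c * B ^ 2 := by
        have : A * c = mgfConst b * Real.exp R := div_mul_cancel₀ _ hc0.ne'
        rw [← this, mul_comm]
        exact mul_le_mul_of_nonneg_left (by linarith) hc0.le
      calc mgfExponent b (y / B) = mgfConst b * Real.exp (y / B) * (y / B) ^ 2 := by
            rw [mgfExponent]; ring
        _ ≤ mgfConst b * Real.exp R * (y / B) ^ 2 := by gcongr
        _ ≤ c * B ^ 2 * (y / B) ^ 2 := by gcongr
        _ = c * y ^ 2 := by field_simp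
    exact ⟨h1.trans (mul_le_mul_of_nonneg_right (min_le_left _ _) (sq_nonneg y)),
      h1.trans (mul_le_mul_of_nonneg_right (min_le_right _ _) (sq_nonneg y))⟩
  · have e1 : y / B ≤ y / 2 := div_le_div_of_nonneg_left hy two_pos hB2
    have e2 : y ^ 2 ≤ 8 * Real.exp (y / 2) := by
      have := Real.quadratic_le_exp_of_nonneg (x := y / 2) (by positivity)
      nlinarith
    have e3 : Real.exp (y / 2) * Real.exp (y / 2) = Real.exp y := by
      rw [← Real.exp_add]
      ring_nf
    calc mgfExponent b (y / B) ≤ mgfConst b * (y / B) ^ 2 * Real.exp (y / 2) := by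
          rw [mgfExponent]
          gcongr
      _ = mgfConst b / B ^ 2 * (y ^ 2 * Real.exp (y / 2)) := by
          field_simp
      _ ≤ 1 / 2 * (8 * Real.exp (y / 2) * Real.exp (y / 2)) := by
          refine mul_le_mul ?_ (mul_le_mul_of_nonneg_right e2 (Real.exp_nonneg _))
            (by positivity) (by norm_num)
          rw [div_le_div_iff₀ (by positivity) two_pos]
          linarith
      _ = 4 * Real.exp y := by
          rw [mul_assoc 8, e3]
          ring

/-- Write θ = t/D. The choices are y = θ/(5γ²), the minimizer of -yθ + 5γ²y²/2, as long as it is at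
most 1/γ, then y = 1/γ; y = θ/48, the minimizer of -yθ + 24y², as long as it is at most L₀, then y =
L₀; and finally y = log(θ/4), the minimizer of -yθ + 4e^y. -/
lemma le_tailBound {b : ℕ} {γ L₀ B D t p : ℝ} (hγ : 0 < γ) (hL₀ : 0 ≤ L₀) (hD : 0 < D)
    (ht : 0 < t)
    (hsq : ∀ y, 0 ≤ y → y ≤ max L₀ (1 / γ) → mgfExponent b (y / B) ≤ 5 / 2 * γ ^ 2 * y ^ 2 ∧
      mgfExponent b (y / B) ≤ 24 * y ^ 2)
    (hexp : ∀ y, 0 ≤ y → mgfExponent b (y / B) ≤ 4 * Real.exp y)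
    (hp : ∀ y, 0 ≤ y → p ≤ Real.exp (-(y * (t / D)) + mgfExponent b (y / B))) :
    p ≤ tailBound γ L₀ D t := by
  have hθ : 0 < t / D := by positivity
  unfold tailBound
  split_ifs with h1 h2 h3 h4
  · have hy : t / D / (5 * γ ^ 2) ≤ 1 / γ := by
      rw [div_div, div_le_div_iff₀ (by positivity) hγ]
      nlinarith
    refine (hp (t / D / (5 * γ ^ 2)) (by positivity)).trans (Real.exp_le_exp.2 ?_)
    refine (add_le_add_right (hsq _ (by positivity) (hy.trans (le_max_right _ _))).1 _).trans
      (le_of_eq ?_)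
    field_simp
    ring
  · refine (hp (1 / γ) (by positivity)).trans (Real.exp_le_exp.2 ?_)
    refine (add_le_add_right (hsq _ (by positivity) (le_max_right _ _)).1 _).trans (le_of_eq ?_)
    field_simp
    ring
  · have hy : t / D / 48 ≤ L₀ := by
      rw [div_div, div_le_iff₀ (by positivity)]
      linarith
    refine (hp (t / D / 48) (by positivity)).trans (Real.exp_le_exp.2 ?_)
    refine (add_le_add_right (hsq _ (by positivity) (hy.trans (le_max_left _ _))).2 _).trans
      (le_of_eq ?_)
    field_simp
    ring
  · refine (hp L₀ hL₀).trans (Real.exp_le_exp.2 ?_)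
    refine (add_le_add_right (hsq _ hL₀ (le_max_left _ _)).2 _).trans (le_of_eq ?_)
    field_simp
    ring
  · have h5 : Real.exp L₀ ≤ t / (4 * D) := by
      rw [le_div_iff₀ (by positivity)]
      linarith [not_le.1 h4]
    have h6 : L₀ ≤ Real.log (t / (4 * D)) := (Real.le_log_iff_exp_le (by positivity)).2 h5
    refine (hp (Real.log (t / (4 * D))) (hL₀.trans h6)).trans (Real.exp_le_exp.2 ?_)
    refine (add_le_add_right (hexp _ (hL₀.trans h6)) _).trans (le_of_eq ?_)
    rw [Real.exp_log (by positivity)]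
    field_simp
    ring

end BaryTree

/-! ### The theorem -/

theorem theorem2 {b : ℕ} (hb : 2 ≤ b)
    {Ω : Type*} [MeasurableSpace Ω] (P : Measure Ω) [IsProbabilityMeasure P]
    (ν : Measure (EuclideanSpace ℝ (Fin b)))
    (hν_nonneg : ∀ᵐ z ∂ν, ∀ i, 0 ≤ z i)
    (hν_bdd : ∃ M : ℝ, ∀ᵐ z ∂ν, ‖z‖ ≤ M)
    (T : ℕ → Ω → Finset (BaryTree.Node b))
    (Z : BaryTree.Node b → Ω → EuclideanSpace ℝ (Fin b))
    (hTZ : BaryTree.IsWeightedRecursiveTree P ν T Z)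
    (W L : ℕ → Ω → ℝ)
    (hW : ∀ n ω, W n ω = BaryTree.wienerIndex (fun u => Z u ω) (T n ω))
    (hL : ∀ n ω, L n ω = BaryTree.pathLength (fun u => Z u ω) (T n ω))
    (γ L₀ : ℝ) (hγ_pos : 0 < γ) (hγ : 12 / 7 = Real.exp (2 / γ) - 2 / γ)
    (hL₀ : IsGreatest {l : ℝ | Real.exp l = 6 * l ^ 2} L₀) :
    (∀ n, Integrable (W n) P ∧ Integrable (L n) P) ∧
    ∃ D : ℝ, 0 < D ∧ ∀ n : ℕ, 1 ≤ n →
      -- the recursion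
      BaryTree.SolvesSumRecursion n
        (P.map fun ω => BaryTree.subtreeSizes (T n ω)) ν
        (fun m => P.map (BaryTree.normalized P W L m))
        (BaryTree.coeff n)
        (BaryTree.toll (fun m => ∫ ω, W m ω ∂P) (fun m => ∫ ω, L m ω ∂P) n) ∧
      -- the bound for the toll vector
      (∀ᵐ ω ∂P, ‖BaryTree.toll (fun m => ∫ ω, W m ω ∂P) (fun m => ∫ ω, L m ω ∂P) n
        (BaryTree.subtreeSizes (T n ω)) (Z [] ω)‖ ≤ D) ∧
      -- the right and left tails
      ∀ t : ℝ, 0 < t →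
        P.real {ω | (W n ω - ∫ ω', W n ω' ∂P) / (n : ℝ) ^ 2 > t} ≤ BaryTree.tailBound γ L₀ D t ∧
        P.real {ω | (L n ω - ∫ ω', L n ω' ∂P) / (n : ℝ) > t} ≤ BaryTree.tailBound γ L₀ D t ∧
        P.real {ω | (W n ω - ∫ ω', W n ω' ∂P) / (n : ℝ) ^ 2 < -t} ≤
          BaryTree.tailBound γ L₀ D t ∧
        P.real {ω | (L n ω - ∫ ω', L n ω' ∂P) / (n : ℝ) < -t} ≤ BaryTree.tailBound γ L₀ D t := by
  obtain rfl : W = fun n ω => BaryTree.wienerIndex (fun u => Z u ω) (T n ω) :=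
    funext fun n => funext fun ω => hW n ω
  obtain rfl : L = fun n ω => BaryTree.pathLength (fun u => Z u ω) (T n ω) :=
    funext fun n => funext fun ω => hL n ω
  obtain ⟨M, hM, hM0⟩ : ∃ M : ℝ, (∀ᵐ z ∂ν, ‖z‖ ≤ M) ∧ 0 ≤ M := by
    obtain ⟨M, hM⟩ := hν_bdd
    exact ⟨max M 0, hM.mono fun z hz => hz.trans (le_max_left _ _), le_max_right _ _⟩
  refine ⟨fun n => ⟨hTZ.integrable_tree hb n (F := fun S w => BaryTree.wienerIndex w S)
      fun S _ => hTZ.integrable_wienerIndex hM S,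
    hTZ.integrable_tree hb n (F := fun S w => BaryTree.pathLength w S)
      fun S _ => hTZ.integrable_pathLength hM S⟩, ?_⟩
  obtain ⟨D₀, hD₀, htoll⟩ := hTZ.exists_toll_bound hb hM0 hM
  obtain ⟨B, hB1, hsq, hexp⟩ := BaryTree.exists_scale b hγ_pos (max L₀ (1 / γ))
  have hB0 : 0 < B := by linarith
  -- As B ≥ 1, this constant still bounds the toll.
  refine ⟨B * D₀, by positivity, fun n hn => ?_⟩
  obtain ⟨n, rfl⟩ : ∃ m, n = m + 1 := ⟨n - 1, by omega⟩
  refine ⟨hTZ.solvesSumRecursion hb hM n, ?_, fun t ht => ?_⟩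
  · filter_upwards [hTZ.ae_weight_bound hM, hTZ.ae_sizes hb n] with ω hω hs
    exact (htoll n _ hs _ (hω [])).trans (le_mul_of_one_le_left hD₀.le hB1)
  -- Chernoff's parameter y/(B D₀) turns the exponent into its value at y/B. The four tails are the
  -- directions (±1, 0) and (0, ±1).
  · have hdir : ∀ s : EuclideanSpace ℝ (Fin 2), |s 0| + |s 1| = 1 →
        P.real {ω | t < inner ℝ (BaryTree.normVec (BaryTree.meanWiener P T Z)
          (BaryTree.meanPath P T Z) (n + 1) (fun u => Z u ω) (T (n + 1) ω)) s}
          ≤ BaryTree.tailBound γ L₀ (B * D₀) t := by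
      intro s hs
      refine BaryTree.le_tailBound hγ_pos (BaryTree.nonneg_of_isGreatest hL₀) (by positivity) ht
        hsq hexp fun y hy => ?_
      have h := hTZ.measureReal_inner_gt_le hb hM hD₀ htoll (n + 1) hs
        (l := y / (B * D₀)) (by positivity) t
      have h1 : y / (B * D₀) * t = y * (t / (B * D₀)) := by ring
      have h2 : D₀ * (y / (B * D₀)) = y / B := by field_simp
      rwa [h1, h2] at h
    refine ⟨?_, ?_, ?_, ?_⟩
    · simpa [BaryTree.inner_euclidean_two, BaryTree.normVec, BaryTree.meanWiener] using
        hdir !₂[1, 0] (by simp)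
    · simpa [BaryTree.inner_euclidean_two, BaryTree.normVec, BaryTree.meanPath] using
        hdir !₂[0, 1] (by simp)
    · simpa [BaryTree.inner_euclidean_two, BaryTree.normVec, BaryTree.meanWiener, lt_neg] using
        hdir !₂[-1, 0] (by simp)
    · simpa [BaryTree.inner_euclidean_two, BaryTree.normVec, BaryTree.meanPath, lt_neg] using
        hdir !₂[0, -1] (by simp)
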